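/- Let $0<\tau_1<1$ and, for $\tau_1<\tau<\infty$, $0<c<1$, let $\hat U(\tau,c)=-(1-c)\log\frac{\tau-c\tau_1}{1-c}$ and $U(\tau,c)=\hat U(\tau,c)+W(c,\theta)$. With $\rho=1/\tau$, put $p(\rho,c)=-U_\tau(\tau,c)$ and $q(\rho,c)=-U_c(\tau,c)$. Fluid states are pairs $(\rho,c)$ with $0<\rho<1/\tau_1$, $0<c<1$. For constants $\delta>0$ and $\mu,\lambda\in\mathbb R$, consider in dimension $d\ge 1$ the Navier–Stokes–Allen–Cahn system $$\partial_t\rho+\nabla\cdot(\rho\mathbf u)=0,$$ $$\partial_t(\rho\mathbf u)+\nabla\cdot(\rho\mathbf u\otimes\mathbf u+p\,\mathbf I)=\nabla\cdot\bigl(\mu(\nabla\mathbf u+(\nabla\mathbf u)^T)+(\lambda\nabla\cdot\mathbf u)\mathbf I-\delta\rho\nabla c\otimes\nabla c\bigr),$$ $$\partial_t(\rho c)+\nabla\cdot(\rho c\,\mathbf u)=\delta^{-1/2}\bigl(\rho q+\nabla\cdot(\delta\rho\nabla c)\bigr).$$ Suppose that $W$ is $C^4$ on $(0,1)\times\Theta$,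 $\Theta\subseteq\mathbb R$ open, and that at some $(c_*,\theta_*)\in(0,1)\times\Theta$ the function $W(\cdot,\theta)$ passes generically from convex ($\theta>\theta_*$) to double-well ($\theta<\theta_*$): $$W_{cc}=W_{ccc}=0,\qquad W_{cccc}>0,\qquad W_{cc\theta}>0\qquad\text{at }(c_*,\theta_*);$$ suppose also $W_c(c_*,\theta_*)<-\log\tau_1$ (for instance $W_c(c_*,\theta_*)=0$). Then there are $\tilde\theta<\theta_*$, an open set $N$ of fluid states, and functions $\theta\mapsto(\underline\rho_0,\underline c_0)\in N$, $\theta\mapsto(\overline\rho_0,\overline c_0)\in N$ (Maxwell states), continuous on $(\tilde\theta,\theta_*]$, with the following properties. (i) For every $\theta\in(\tilde\theta,\theta_*]$, $q(\underline\rho_0,\underline c_0)=q(\overline\rho_0,\overline c_0)=0$ and $p(\underline\rho_0,\underline c_0)=p(\overline\rho_0,\overline c_0)=:\pi_*(\theta)$. If $\theta=\theta_*$, the two states coincide and have $c=c_*$, and any two states in $N$ with $q=0$ and equal $p$ coincide. (ii) For every $\theta\in(\tilde\theta,\theta_*)$, $\underline\rho_0<\overline\rho_0$, and there are functions $R,C:\mathbb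 R\to\mathbb R$ with $C'>0$ such that, for every unit vector $e\in\mathbb R^d$, the fields $\rho=R(e\cdot x)$, $\mathbf u=0$, $c=C(e\cdot x)$ are a classical stationary (no-flux, $m=0$) solution of the system with $(R,C)(-\infty)=(\underline\rho_0,\underline c_0)$ and $(R,C)(\infty)=(\overline\rho_0,\overline c_0)$; and the reflected profile $(R(-x),C(-x))$ likewise gives a no-flux phase boundary from $(\overline\rho_0,\overline c_0)$ to $(\underline\rho_0,\underline c_0)$. (iii) Let $\hat G(p,c)=(1-c)(1+\log p)+cp\tau_1$, let $P^\pi(c,y)$ be the unique positive root $p$ of $0=(p-\pi)(c\tau_1p+(1-c))+y^2p$, and $\Gamma^{\theta,\pi}(c,y)=\hat G(P^\pi(c,y),c)+W(c,\theta)+\frac12y^2$. For every $\theta\in(\tilde\theta,\theta_*)$ and with $\pi=\pi_*(\theta)$, the points $(\underline c_0,0)$ and $(\overline c_0,0)$ are distinct nondegenerate saddles of $\Gamma^{\theta,\pi}$ at the same level; the curve $(C,\sqrt\delta\,C')$ and the corresponding curve of the reflected profile run in the level set of these saddles and join them in the two directions, and $p(R,C)=P^\pi(C,\sqrt\delta\,C')$.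 (iv) (Local uniqueness.) For every $\theta\in(\tilde\theta,\theta_*)$, any two distinct states $a,b\in N$ with $q(a)=q(b)=0$ and $p(a)=p(b)$ that are joined by a no-flux phase boundary are, up to order, the two Maxwell states. The same is true of any two states $a=(\rho_a,c_a),b=(\rho_b,c_b)\in N$ with $p(a)=p(b)=:\pi$ for which $(c_a,0)$ and $(c_b,0)$ are distinct saddles of $\Gamma^{\theta,\pi}$ at the same level; so $\pi=\pi_*(\theta)$. -/

import Mathlib

open Set Filter Topology

noncomputable section

namespace NSAC

/-- The mechanical part of the thermodynamic potential, as a function of the specific volume `τ`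
and the mass fraction `c`; `τ₁` is the specific volume of the incompressible phase. -/
def Uhat (τ₁ τ c : ℝ) : ℝ := -(1 - c) * Real.log ((τ - c * τ₁) / (1 - c))

/-- The potential at constant temperature `θ`, without its gradient part. -/
def U (τ₁ : ℝ) (W : ℝ → ℝ → ℝ) (θ τ c : ℝ) : ℝ := Uhat τ₁ τ c + W c θ

/-- The pressure `p(ρ, c) = -U_τ(τ, c)` at `τ = 1 / ρ`; a fluid state is a pair `s = (ρ, c)`. -/
def pressure (τ₁ : ℝ) (W : ℝ → ℝ → ℝ) (θ : ℝ) (s : ℝ × ℝ) : ℝ :=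
  -deriv (fun τ => U τ₁ W θ τ s.2) (1 / s.1)

/-- The transformation rate `q(ρ, c) = -U_c(τ, c)` at `τ = 1 / ρ`. -/
def rate (τ₁ : ℝ) (W : ℝ → ℝ → ℝ) (θ : ℝ) (s : ℝ × ℝ) : ℝ :=
  -deriv (fun c => U τ₁ W θ (1 / s.1) c) s.2

/-- The fluid states `(ρ, c)`, i.e. those with `τ₁ < τ = 1 / ρ < ∞` and `0 < c < 1`. -/
def stateSpace (τ₁ : ℝ) : Set (ℝ × ℝ) :=
  {s | 0 < s.1 ∧ τ₁ < 1 / s.1 ∧ 0 < s.2 ∧ s.2 < 1}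

/-- `W(·, θ)`, `θ ∈ Θ`, undergoes at `(cs, θs)` a generic transition from convex (`θ > θs`) to
convex-concave-convex (`θ < θs`), with decreasing `θ`: the strict inequalities are the
nondegeneracy conditions, under which near `(cs, θs)` the second derivative `W_cc(·, θ)` is a
strictly convex function of `c` which is positive for `θ > θs`, has the single zero `cs` for
`θ = θs`, and is negative exactly between two zeros for `θ < θs`. -/
structure GenericTransition (W : ℝ → ℝ → ℝ) (Θ : Set ℝ) (cs θs : ℝ) : Prop where
  isOpen : IsOpen Θ
  mem_temp : θs ∈ Θ
  mem_frac : cs ∈ Ioo (0 : ℝ) 1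
  smooth : ContDiffOn ℝ 4 (fun z : ℝ × ℝ => W z.1 z.2) (Ioo 0 1 ×ˢ Θ)
  cc_eq : iteratedDeriv 2 (fun c => W c θs) cs = 0
  ccc_eq : iteratedDeriv 3 (fun c => W c θs) cs = 0
  cccc_pos : 0 < iteratedDeriv 4 (fun c => W c θs) cs
  ccθ_pos : 0 < deriv (fun θ => iteratedDeriv 2 (fun c => W c θ) cs) θs

/-! ### The Navier-Stokes-Allen-Cahn system -/

/-- The partial derivative `∂ f / ∂ x_i`. -/
def pd {d : ℕ} (i : Fin d) (f : EuclideanSpace ℝ (Fin d) → ℝ) (x : EuclideanSpace ℝ (Fin d)) :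
    ℝ :=
  fderiv ℝ f x (EuclideanSpace.single i 1)

/-- Classical solutions `(ρ, u, c)`, on all of space-time `ℝ × ℝᵈ`, of the system
`∂ₜρ + ∇·(ρ u) = 0`,
`∂ₜ(ρ u) + ∇·(ρ u ⊗ u + p I) = ∇·(μ (∇u + (∇u)ᵀ) + (lam ∇·u) I - δ ρ ∇c ⊗ ∇c)`,
`∂ₜ(ρ c) + ∇·(ρ c u) = δ^(-1/2) (ρ q + ∇·(δ ρ ∇c))`. -/
structure IsSolution (τ₁ : ℝ) (W : ℝ → ℝ → ℝ) (θ : ℝ) (d : ℕ) (δ μ lam : ℝ)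
    (ρ : ℝ → EuclideanSpace ℝ (Fin d) → ℝ)
    (u : ℝ → EuclideanSpace ℝ (Fin d) → EuclideanSpace ℝ (Fin d))
    (c : ℝ → EuclideanSpace ℝ (Fin d) → ℝ) : Prop where
  smooth_ρ : ContDiff ℝ 1 (fun z : ℝ × EuclideanSpace ℝ (Fin d) => ρ z.1 z.2)
  smooth_u : ContDiff ℝ 2 (fun z : ℝ × EuclideanSpace ℝ (Fin d) => u z.1 z.2)
  smooth_c : ContDiff ℝ 2 (fun z : ℝ × EuclideanSpace ℝ (Fin d) => c z.1 z.2)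
  mem_states : ∀ t x, (ρ t x, c t x) ∈ stateSpace τ₁
  mass : ∀ t x,
    deriv (fun s => ρ s x) t + ∑ i, pd i (fun z => ρ t z * u t z i) x = 0
  momentum : ∀ t x (j : Fin d),
    deriv (fun s => ρ s x * u s x j) t
      + ∑ i, pd i (fun z => ρ t z * u t z i * u t z j
          + if i = j then pressure τ₁ W θ (ρ t z, c t z) else 0) x
    = ∑ i, pd i (fun z =>
          μ * (pd i (fun w => u t w j) z + pd j (fun w => u t w i) z)
          + (if i = j then lam * ∑ k, pd k (fun w => u t w k) z else 0)
          - δ * ρ t z * (pd i (c t) z * pd j (c t) z)) x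
  phase : ∀ t x,
    deriv (fun s => ρ s x * c s x) t + ∑ i, pd i (fun z => ρ t z * c t z * u t z i) x
    = (Real.sqrt δ)⁻¹ * (ρ t x * rate τ₁ W θ (ρ t x, c t x)
        + ∑ i, pd i (fun z => δ * ρ t z * pd i (c t) z) x)

/-- The profile `(R, 0, C)` is a no-flux (the velocity vanishes, so `m = 0`) phase boundary in
the direction `e`, with left end state `a` and right end state `b`: the stationary planar fields
`ρ = R(e·x)`, `u = 0`, `c = C(e·x)` solve the system, `(R, C)(-∞) = a` and `(R, C)(∞) = b`. -/
structure IsNoFluxPhaseBoundary (τ₁ : ℝ) (W : ℝ → ℝ → ℝ) (θ : ℝ) (d : ℕ) (δ μ lam : ℝ)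
    (e : EuclideanSpace ℝ (Fin d)) (R C : ℝ → ℝ) (a b : ℝ × ℝ) : Prop where
  solution : IsSolution τ₁ W θ d δ μ lam
    (fun _ x => R (inner ℝ e x)) (fun _ _ => 0) (fun _ x => C (inner ℝ e x))
  left_end : Tendsto (fun x => (R x, C x)) atBot (𝓝 a)
  right_end : Tendsto (fun x => (R x, C x)) atTop (𝓝 b)

/-- Condition (i) on a pair of states: zero transformation rate, equal pressure. -/
def IsEquilibriumPair (τ₁ : ℝ) (W : ℝ → ℝ → ℝ) (θ : ℝ) (a b : ℝ × ℝ) : Prop :=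
  rate τ₁ W θ a = 0 ∧ rate τ₁ W θ b = 0 ∧ pressure τ₁ W θ a = pressure τ₁ W θ b

/-! ### The function `Γ` -/

/-- The Gibbs potential `Û + p τ` associated with `Û`, as a function of `(p, c)`. -/
def Ghat (τ₁ p c : ℝ) : ℝ := (1 - c) * (1 + Real.log p) + c * p * τ₁

/-- The unique positive root `p` of `0 = (p - ϖ) (c τ₁ p + (1 - c)) + y² p`
(see `proot_spec`). -/
def proot (τ₁ ϖ c y : ℝ) : ℝ :=
  (-((1 - c) - ϖ * c * τ₁ + y ^ 2)
    + Real.sqrt (((1 - c) - ϖ * c * τ₁ + y ^ 2) ^ 2 + 4 * (c * τ₁) * (ϖ * (1 - c))))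
    / (2 * (c * τ₁))

theorem proot_spec {τ₁ ϖ c : ℝ} (hτ : 0 < τ₁) (hϖ : 0 < ϖ) (hc : 0 < c) (hc1 : c < 1) (y : ℝ) :
    0 < proot τ₁ ϖ c y ∧
    ∀ p : ℝ, 0 < p → ((p - ϖ) * (c * τ₁ * p + (1 - c)) + y ^ 2 * p = 0 ↔ p = proot τ₁ ϖ c y) := by
  have hA : 0 < c * τ₁ := mul_pos hc hτ
  have hK : 0 < ϖ * (1 - c) := mul_pos hϖ (by linarith)
  unfold proot
  set B : ℝ := (1 - c) - ϖ * c * τ₁ + y ^ 2 with hB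
  set S : ℝ := Real.sqrt (B ^ 2 + 4 * (c * τ₁) * (ϖ * (1 - c))) with hS
  have hpos : 0 < 4 * (c * τ₁) * (ϖ * (1 - c)) := by positivity
  have hS2 : S ^ 2 = B ^ 2 + 4 * (c * τ₁) * (ϖ * (1 - c)) :=
    Real.sq_sqrt (by positivity)
  have hS0 : 0 ≤ S := Real.sqrt_nonneg _
  have hBS : |B| < S := abs_lt_of_sq_lt_sq (by linarith) hS0
  obtain ⟨h1, h2⟩ := abs_lt.mp hBS
  refine ⟨div_pos (by linarith) (by linarith), fun p hp => ?_⟩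
  rw [eq_div_iff (by positivity)]
  have key : 4 * (c * τ₁) * ((p - ϖ) * (c * τ₁ * p + (1 - c)) + y ^ 2 * p)
      = (p * (2 * (c * τ₁)) + B - S) * (p * (2 * (c * τ₁)) + B + S) := by
    have : (p * (2 * (c * τ₁)) + B - S) * (p * (2 * (c * τ₁)) + B + S)
      = (p * (2 * (c * τ₁)) + B) ^ 2 - S ^ 2 := by ring
    rw [this, hS2, hB]; ring
  have hne : p * (2 * (c * τ₁)) + B + S ≠ 0 := by
    have : 0 < p * (2 * (c * τ₁)) := by positivity
    linarith
  constructor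
  · intro h
    rw [h, mul_zero] at key
    rcases mul_eq_zero.mp key.symm with h' | h'
    · linarith
    · exact absurd h' hne
  · intro h
    have h0 : p * (2 * (c * τ₁)) + B - S = 0 := by linarith
    rw [h0, zero_mul] at key
    exact (mul_eq_zero.mp key).resolve_left (by positivity)

/-- `Γ^{θ,ϖ}(c, y)`, a function on the `(c, y)`-plane. -/
def Gam (τ₁ : ℝ) (W : ℝ → ℝ → ℝ) (θ ϖ : ℝ) (z : ℝ × ℝ) : ℝ :=
  Ghat τ₁ (proot τ₁ ϖ z.1 z.2) z.1 + W z.1 θ + 1 / 2 * z.2 ^ 2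

/-- A nondegenerate saddle of a function on the plane: a critical point at which the second
derivative takes both signs. -/
def IsSaddle (F : ℝ × ℝ → ℝ) (z : ℝ × ℝ) : Prop :=
  DifferentiableAt ℝ F z ∧ fderiv ℝ F z = 0 ∧
    (∃ v, fderiv ℝ (fderiv ℝ F) z v v < 0) ∧ ∃ v, 0 < fderiv ℝ (fderiv ℝ F) z v v

/-- Two distinct saddles of `F` at the same level. -/
def AreEqualLevelSaddles (F : ℝ × ℝ → ℝ) (z w : ℝ × ℝ) : Prop :=
  z ≠ w ∧ IsSaddle F z ∧ IsSaddle F w ∧ F z = F w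

/-- The parametrized curve `γ` runs in a level set of `F`, from `z` to `w`. -/
def JoinsInLevelSet (F : ℝ × ℝ → ℝ) (γ : ℝ → ℝ × ℝ) (z w : ℝ × ℝ) : Prop :=
  (∀ x, F (γ x) = F z) ∧ Tendsto γ atBot (𝓝 z) ∧ Tendsto γ atTop (𝓝 w)

end NSAC

end

/-!
In a no-flux phase boundary the momentum balance makes the total pressure `p + δ ρ c'²` a constant
`π`, and the remaining equation then has `Γ` as a first integral: phase boundaries are heteroclinic
orbits on the level sets of `Γ`. Since `Ĝ` is affine in `c`, two points `(a, 0)` and `(b, 0)` are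
critical for `Γ` and on the same level iff the line of slope `-∂Ĝ/∂c` touches the graph of `W(·, θ)`
both at `a` and at `b`, and this slope is strictly increasing in `π`. So Maxwell states correspond
to bitangents of `W(·, θ)`.

Near `c_*` and for `θ < θ_*` the function `W_cc` is strictly convex with a negative minimum, so
`W(·, θ)` is convex, then concave, then convex, and has exactly one bitangent. Its points of contact
tend to `c_*` as `θ` tends to `θ_*`, because a limit of bitangents with distinct contacts would be
one at `θ_*`, where `W` is strictly convex. Between the contacts the graph lies strictly above the
bitangent; hence the level set of `Γ` is a curve `y = y(c) > 0` there, vanishing at most linearly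
at the contacts, and `√δ C' = y(C)` is solved by a profile defined on all of `ℝ`.
-/

noncomputable section

namespace NSAC

/-! ### Calculus on an interval -/

theorem strictMonoOn_Icc_of_hasDerivAt_pos {f f' : ℝ → ℝ} {x y : ℝ}
    (hf : ∀ t ∈ Icc x y, HasDerivAt f (f' t) t) (hpos : ∀ t ∈ Ioo x y, 0 < f' t) :
    StrictMonoOn f (Icc x y) := by
  refine strictMonoOn_of_hasDerivWithinAt_pos (f' := f') (convex_Icc x y)
    (fun t ht => (hf t ht).continuousAt.continuousWithinAt) ?_ ?_ <;> rw [interior_Icc]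
  · exact fun t ht => (hf t (Ioo_subset_Icc_self ht)).hasDerivWithinAt
  · exact hpos

theorem strictAntiOn_Icc_of_hasDerivAt_neg {f f' : ℝ → ℝ} {x y : ℝ}
    (hf : ∀ t ∈ Icc x y, HasDerivAt f (f' t) t) (hneg : ∀ t ∈ Ioo x y, f' t < 0) :
    StrictAntiOn f (Icc x y) := fun _ hs _ ht hst =>
  neg_lt_neg_iff.1 <| strictMonoOn_Icc_of_hasDerivAt_pos (fun t ht => (hf t ht).neg)
    (fun t ht => neg_pos.2 (hneg t ht)) hs ht hst

theorem exists_sub_eq_deriv_mul_sub {w f : ℝ → ℝ} {x y : ℝ} (hxy : x < y)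
    (hw : ∀ t ∈ Icc x y, HasDerivAt w (f t) t) : ∃ t ∈ Ioo x y, w y - w x = f t * (y - x) := by
  obtain ⟨t, ht, h⟩ := exists_hasDerivAt_eq_slope w f hxy
    (fun t ht => (hw t ht).continuousAt.continuousWithinAt)
    fun t ht => hw t (Ioo_subset_Icc_self ht)
  exact ⟨t, ht, by rw [h, div_mul_cancel₀ _ (sub_pos.2 hxy).ne']⟩

theorem mul_sub_lt_sub_of_lt_deriv {w f : ℝ → ℝ} {x y m : ℝ} (hxy : x < y)
    (hw : ∀ t ∈ Icc x y, HasDerivAt w (f t) t) (hm : ∀ t ∈ Ioo x y, m < f t) :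
    m * (y - x) < w y - w x := by
  obtain ⟨t, ht, e⟩ := exists_sub_eq_deriv_mul_sub hxy hw
  exact e ▸ mul_lt_mul_of_pos_right (hm t ht) (sub_pos.2 hxy)

theorem mul_sub_le_sub_of_le_deriv {w f : ℝ → ℝ} {x y m : ℝ} (hxy : x ≤ y)
    (hw : ∀ t ∈ Icc x y, HasDerivAt w (f t) t) (hm : ∀ t ∈ Ioo x y, m ≤ f t) :
    m * (y - x) ≤ w y - w x := by
  rcases hxy.eq_or_lt with rfl | hxy
  · simp
  · obtain ⟨t, ht, e⟩ := exists_sub_eq_deriv_mul_sub hxy hw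
    exact e ▸ mul_le_mul_of_nonneg_right (hm t ht) (sub_pos.2 hxy).le

theorem sub_le_mul_sub_of_deriv_le {w f : ℝ → ℝ} {x y m : ℝ} (hxy : x ≤ y)
    (hw : ∀ t ∈ Icc x y, HasDerivAt w (f t) t) (hm : ∀ t ∈ Ioo x y, f t ≤ m) :
    w y - w x ≤ m * (y - x) := by
  have := mul_sub_le_sub_of_le_deriv hxy (fun t ht => (hw t ht).neg)
    fun t ht => neg_le_neg (hm t ht)
  simp only [Pi.neg_apply] at this
  linarith

theorem tangent_le_of_monotoneOn {w f : ℝ → ℝ} {p q x y : ℝ}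
    (hw : ∀ t ∈ Icc p q, HasDerivAt w (f t) t) (hf : MonotoneOn f (Icc p q))
    (hx : x ∈ Icc p q) (hy : y ∈ Icc p q) : f x * (y - x) ≤ w y - w x := by
  rcases le_total x y with h | h
  · exact mul_sub_le_sub_of_le_deriv h (fun t ht => hw t ⟨hx.1.trans ht.1, ht.2.trans hy.2⟩)
      fun t ht => hf hx ⟨hx.1.trans ht.1.le, ht.2.le.trans hy.2⟩ ht.1.le
  · have := sub_le_mul_sub_of_deriv_le h (fun t ht => hw t ⟨hy.1.trans ht.1, ht.2.trans hx.2⟩)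
      fun t ht => hf ⟨hy.1.trans ht.1.le, ht.2.le.trans hx.2⟩ hx ht.2.le
    linarith

theorem continuousOn_of_unique_limit {X Y : Type*} [TopologicalSpace X] [TopologicalSpace Y]
    {φ : X → Y} {s : Set X} {K : Set Y} (hK : IsCompact K) (hφ : MapsTo φ s K)
    (hlim : ∀ x ∈ s, ∀ z ∈ K, ∀ U : Ultrafilter X, ↑U ≤ 𝓝[s] x → Tendsto φ U (𝓝 z) → z = φ x) :
    ContinuousOn φ s := by
  intro x hx
  refine (tendsto_iff_ultrafilter _ _ _).2 fun U hU => ?_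
  have hs : ∀ᶠ t in (U : Filter X), t ∈ s := hU self_mem_nhdsWithin
  have hmem : ↑(U.map φ) ≤ 𝓟 K := le_principal_iff.2 (hs.mono hφ)
  obtain ⟨z, hz, hUz⟩ := hK.ultrafilter_le_nhds _ hmem
  exact hlim x hx z hz U hU hUz ▸ hUz

theorem exists_continuousOn_inverse {f : ℝ → ℝ} {x y : ℝ} (hxy : x ≤ y)
    (hf : ContinuousOn f (Icc x y)) (hinj : InjOn f (Icc x y)) :
    ∃ g : ℝ → ℝ, ContinuousOn g (Icc (f x) (f y)) ∧
      ∀ m ∈ Icc (f x) (f y), g m ∈ Icc x y ∧ f (g m) = m := by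
  have hsurj := intermediate_value_Icc hxy hf
  have hg : ∀ m ∈ Icc (f x) (f y),
      Function.invFunOn f (Icc x y) m ∈ Icc x y ∧ f (Function.invFunOn f (Icc x y) m) = m :=
    fun m hm => Function.invFunOn_pos (hsurj hm)
  refine ⟨_, continuousOn_of_unique_limit isCompact_Icc (fun m hm => (hg m hm).1) ?_, hg⟩
  intro m hm z hz U hU hUz
  refine hinj hz (hg m hm).1 ((hg m hm).2.symm ▸ ?_)
  have hU' : ∀ᶠ n in (U : Filter ℝ), n ∈ Icc (f x) (f y) := hU self_mem_nhdsWithin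
  have hfz : Tendsto (fun n => f (Function.invFunOn f (Icc x y) n)) U (𝓝 (f z)) :=
    (hf z hz).tendsto.comp (tendsto_nhdsWithin_iff.2 ⟨hUz, hU'.mono fun n hn => (hg n hn).1⟩)
  exact tendsto_nhds_unique (hfz.congr' (hU'.mono fun n hn => (hg n hn).2))
    (hU.trans nhdsWithin_le_nhds)

/-! ### Common tangents of convex-concave-convex functions -/

/-- The graph of `w`, whose derivative is `f`, has one and the same tangent at `x` and `y`. -/
structure IsBitangent (w f : ℝ → ℝ) (x y : ℝ) : Prop where
  slope_eq : f x = f y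
  sub_eq : w y - w x = f x * (y - x)

theorem IsBitangent.reflect {w f : ℝ → ℝ} {x y : ℝ} (h : IsBitangent w f x y) :
    IsBitangent (fun c => w (-c)) (fun c => -f (-c)) (-y) (-x) := by
  constructor
  · simp only [neg_neg, h.slope_eq]
  · have := h.sub_eq
    rw [h.slope_eq] at this
    simp only [neg_neg]
    linarith

/-- The function `w` on `[l, r]`, with derivative `f` and second derivative `g`, is strictly convex
on `[l, α]` and on `[β, r]` and strictly concave in between, and its slope at `l` and `r` lies
below and above its slopes on `[α, β]`. -/
structure ConvexConcaveConvex (w f g : ℝ → ℝ) (l α β r : ℝ) : Prop where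
  lt_left : l < α
  lt_mid : α < β
  lt_right : β < r
  hasDerivAt_fun : ∀ c ∈ Icc l r, HasDerivAt w (f c) c
  hasDerivAt_slope : ∀ c ∈ Icc l r, HasDerivAt f (g c) c
  pos_left : ∀ c ∈ Ico l α, 0 < g c
  neg_mid : ∀ c ∈ Ioo α β, g c < 0
  pos_right : ∀ c ∈ Ioc β r, 0 < g c
  slope_left : f l < f β
  slope_right : f α < f r

/-- The points `a < b` of `(l, r)` are the two phases of `w`: the contact points of its only
bitangent over `[l, r]`. They are nondegenerate, and `w` lies above the bitangent between them. -/
structure IsMaxwellPair (w f g : ℝ → ℝ) (l r a b : ℝ) : Prop where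
  left_lt : l < a
  lt : a < b
  lt_right : b < r
  bitangent : IsBitangent w f a b
  pos_left : 0 < g a
  pos_right : 0 < g b
  above : ∀ c ∈ Ioo a b, 0 < w c - w a - f a * (c - a)
  unique : ∀ x y, l ≤ x → x < y → y ≤ r → IsBitangent w f x y → x = a ∧ y = b

namespace ConvexConcaveConvex

variable {w f g : ℝ → ℝ} {l α β r x y : ℝ}

theorem reflect (h : ConvexConcaveConvex w f g l α β r) :
    ConvexConcaveConvex (fun c => w (-c)) (fun c => -f (-c)) (fun c => g (-c))
      (-r) (-β) (-α) (-l) where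
  lt_left := neg_lt_neg h.lt_right
  lt_mid := neg_lt_neg h.lt_mid
  lt_right := neg_lt_neg h.lt_left
  hasDerivAt_fun c hc := by
    simpa [Function.comp_def] using
      (h.hasDerivAt_fun (-c) ⟨le_neg.2 hc.2, neg_le.2 hc.1⟩).comp c (hasDerivAt_neg c)
  hasDerivAt_slope c hc := by
    simpa [Function.comp_def, Pi.neg_def] using
      ((h.hasDerivAt_slope (-c) ⟨le_neg.2 hc.2, neg_le.2 hc.1⟩).comp c (hasDerivAt_neg c)).neg
  pos_left c hc := h.pos_right (-c) ⟨lt_neg.2 hc.2, neg_le.2 hc.1⟩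
  neg_mid c hc := h.neg_mid (-c) ⟨lt_neg.2 hc.2, neg_lt.2 hc.1⟩
  pos_right c hc := h.pos_left (-c) ⟨le_neg.2 hc.2, neg_lt.2 hc.1⟩
  slope_left := by simpa using h.slope_right
  slope_right := by simpa using h.slope_left

theorem strictMonoOn_left (h : ConvexConcaveConvex w f g l α β r) : StrictMonoOn f (Icc l α) :=
  strictMonoOn_Icc_of_hasDerivAt_pos
    (fun c hc => h.hasDerivAt_slope c ⟨hc.1, hc.2.trans (h.lt_mid.trans h.lt_right).le⟩)
    fun c hc => h.pos_left c (Ioo_subset_Ico_self hc)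

theorem strictMonoOn_right (h : ConvexConcaveConvex w f g l α β r) :
    StrictMonoOn f (Icc β r) :=
  strictMonoOn_Icc_of_hasDerivAt_pos
    (fun c hc => h.hasDerivAt_slope c ⟨(h.lt_left.trans h.lt_mid).le.trans hc.1, hc.2⟩)
    fun c hc => h.pos_right c (Ioo_subset_Ioc_self hc)

theorem strictAntiOn_mid (h : ConvexConcaveConvex w f g l α β r) : StrictAntiOn f (Icc α β) :=
  strictAntiOn_Icc_of_hasDerivAt_neg
    (fun c hc => h.hasDerivAt_slope c ⟨h.lt_left.le.trans hc.1, hc.2.trans h.lt_right.le⟩)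
    h.neg_mid

theorem left_lt_of_isBitangent (h : ConvexConcaveConvex w f g l α β r) (hx : l ≤ x) (hxy : x < y)
    (hy : y ≤ r) (ht : IsBitangent w f x y) : x < α := by
  by_contra! hα
  have hxβ : x < β := by
    by_contra! hβ
    exact (h.strictMonoOn_right ⟨hβ, hxy.le.trans hy⟩ ⟨hβ.trans hxy.le, hy⟩ hxy).ne ht.slope_eq
  have hβy : β < y := by
    by_contra! hβ
    exact (h.strictAntiOn_mid ⟨hα, hxβ.le⟩ ⟨hα.trans hxy.le, hβ⟩ hxy).ne' ht.slope_eq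
  have hslope : ∀ t ∈ Ioo x y, -f x < -f t := fun t htxy => neg_lt_neg <| by
    rcases le_total t β with h' | h'
    · exact h.strictAntiOn_mid ⟨hα, hxβ.le⟩ ⟨hα.trans htxy.1.le, h'⟩ htxy.1
    · rw [ht.slope_eq]
      exact h.strictMonoOn_right ⟨h', htxy.2.le.trans hy⟩ ⟨hβy.le, hy⟩ htxy.2
  have := mul_sub_lt_sub_of_lt_deriv hxy
    (fun t htxy => (h.hasDerivAt_fun t ⟨hx.trans htxy.1, htxy.2.trans hy⟩).neg) hslope
  have := ht.sub_eq
  simp only [Pi.neg_apply] at *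
  linarith

theorem lt_right_of_isBitangent (h : ConvexConcaveConvex w f g l α β r) (hx : l ≤ x)
    (hxy : x < y) (hy : y ≤ r) (ht : IsBitangent w f x y) : β < y :=
  neg_lt_neg_iff.1 <| h.reflect.left_lt_of_isBitangent (neg_le_neg hy) (neg_lt_neg hxy)
    (neg_le_neg hx) ht.reflect

theorem slope_le_of_isBitangent (h : ConvexConcaveConvex w f g l α β r) {x' y' : ℝ}
    (hx : x ∈ Icc l α) (hy : y ∈ Icc β r) (ht : IsBitangent w f x y)
    (hx' : x' ∈ Icc l α) (hy' : y' ∈ Icc β r) (ht' : IsBitangent w f x' y') : f x' ≤ f x := by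
  have tangent_x := tangent_le_of_monotoneOn
    (fun c hc => h.hasDerivAt_fun c ⟨hc.1, hc.2.trans (h.lt_mid.trans h.lt_right).le⟩)
    h.strictMonoOn_left.monotoneOn hx hx'
  have tangent_y' := tangent_le_of_monotoneOn
    (fun c hc => h.hasDerivAt_fun c ⟨(h.lt_left.trans h.lt_mid).le.trans hc.1, hc.2⟩)
    h.strictMonoOn_right.monotoneOn hy' hy
  rw [← ht'.slope_eq] at tangent_y'
  have hlt : x' < y := hx'.2.trans_lt (h.lt_mid.trans_le hy.1)
  by_contra! hslope
  linarith [ht.sub_eq, ht'.sub_eq, mul_pos (sub_pos.2 hslope) (sub_pos.2 hlt)]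

theorem isBitangent_unique (h : ConvexConcaveConvex w f g l α β r) {x' y' : ℝ}
    (hx : l ≤ x) (hxy : x < y) (hy : y ≤ r) (ht : IsBitangent w f x y)
    (hx' : l ≤ x') (hxy' : x' < y') (hy' : y' ≤ r) (ht' : IsBitangent w f x' y') :
    x' = x ∧ y' = y := by
  have mx : x ∈ Icc l α := ⟨hx, (h.left_lt_of_isBitangent hx hxy hy ht).le⟩
  have my : y ∈ Icc β r := ⟨(h.lt_right_of_isBitangent hx hxy hy ht).le, hy⟩
  have mx' : x' ∈ Icc l α := ⟨hx', (h.left_lt_of_isBitangent hx' hxy' hy' ht').le⟩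
  have my' : y' ∈ Icc β r := ⟨(h.lt_right_of_isBitangent hx' hxy' hy' ht').le, hy'⟩
  have slope_eq : f x' = f x := (h.slope_le_of_isBitangent mx my ht mx' my' ht').antisymm
    (h.slope_le_of_isBitangent mx' my' ht' mx my ht)
  exact ⟨h.strictMonoOn_left.injOn mx' mx slope_eq,
    h.strictMonoOn_right.injOn my' my (by rw [← ht'.slope_eq, slope_eq, ht.slope_eq])⟩

theorem above_tangent_of_slope_le (h : ConvexConcaveConvex w f g l α β r) {c : ℝ} (hx : l ≤ x)
    (hy : y ≤ r) (ht : IsBitangent w f x y) (hc : c ∈ Ioo x y)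
    (hfc : f x ≤ f c) : 0 < w c - w x - f x * (c - x) := by
  have hxy : x < y := hc.1.trans hc.2
  have hxα := h.left_lt_of_isBitangent hx hxy hy ht
  have hcβ : c ≤ β := by
    by_contra! hβ
    exact (hfc.trans_lt
      (h.strictMonoOn_right ⟨hβ.le, hc.2.le.trans hy⟩ ⟨hβ.le.trans hc.2.le, hy⟩ hc.2)).ne
      ht.slope_eq
  have := mul_sub_lt_sub_of_lt_deriv (m := f x) hc.1
    (fun t htc => h.hasDerivAt_fun t ⟨hx.trans htc.1, (htc.2.trans hc.2.le).trans hy⟩)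
    fun t htc => by
      rcases le_total t α with h' | h'
      · exact h.strictMonoOn_left ⟨hx, hxα.le⟩ ⟨hx.trans htc.1.le, h'⟩ htc.1
      · exact hfc.trans_lt
          (h.strictAntiOn_mid ⟨h', htc.2.le.trans hcβ⟩ ⟨h'.trans htc.2.le, hcβ⟩ htc.2)
  linarith

theorem above_tangent (h : ConvexConcaveConvex w f g l α β r) {c : ℝ} (hx : l ≤ x)
    (hy : y ≤ r) (ht : IsBitangent w f x y) (hc : c ∈ Ioo x y) :
    0 < w c - w x - f x * (c - x) := by
  rcases le_total (f x) (f c) with hfc | hfc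
  · exact h.above_tangent_of_slope_le hx hy ht hc hfc
  · have := h.reflect.above_tangent_of_slope_le (neg_le_neg hy) (neg_le_neg hx) ht.reflect
      (c := -c) ⟨neg_lt_neg hc.2, neg_lt_neg hc.1⟩ (by simpa [← ht.slope_eq] using hfc)
    have hsub := ht.sub_eq
    simp only [neg_neg, ← ht.slope_eq] at this
    linarith

theorem tangent_le_of_slope_eq_left (h : ConvexConcaveConvex w f g l α β r) (hx : x ∈ Icc l α)
    (hslope : f x = f β) : f β * (β - x) ≤ w β - w x := by
  refine mul_sub_le_sub_of_le_deriv (hx.2.trans h.lt_mid.le)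
    (fun c hc => h.hasDerivAt_fun c ⟨hx.1.trans hc.1, hc.2.trans h.lt_right.le⟩) fun t ht => ?_
  rcases le_total t α with h' | h'
  · exact hslope ▸ h.strictMonoOn_left.monotoneOn hx ⟨hx.1.trans ht.1.le, h'⟩ ht.1.le
  · exact h.strictAntiOn_mid.antitoneOn ⟨h', ht.2.le⟩ (right_mem_Icc.2 h.lt_mid.le) ht.2.le

theorem le_tangent_of_slope_eq_right (h : ConvexConcaveConvex w f g l α β r) (hy : y ∈ Icc β r)
    (hslope : f y = f α) : w y - w α ≤ f α * (y - α) := by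
  have := h.reflect.tangent_le_of_slope_eq_left (x := -y) ⟨neg_le_neg hy.2, neg_le_neg hy.1⟩
    (by simpa using hslope)
  simp only [neg_neg] at this
  linarith

/- The points `a m ≤ α` and `b m ≥ β` of slope `m` are followed from `m = f β` to `m = f α`; the
vertical gap between the two tangents of slope `m` changes sign on the way. -/
theorem exists_isBitangent (h : ConvexConcaveConvex w f g l α β r) :
    ∃ x ∈ Icc l α, ∃ y ∈ Icc β r, f x ∈ Icc (f β) (f α) ∧ IsBitangent w f x y := by
  have hα : Icc l α ⊆ Icc l r := Icc_subset_Icc_right (h.lt_mid.trans h.lt_right).le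
  have hβ : Icc β r ⊆ Icc l r := Icc_subset_Icc_left (h.lt_left.trans h.lt_mid).le
  have hf : ContinuousOn f (Icc l r) := HasDerivAt.continuousOn h.hasDerivAt_slope
  have hw : ContinuousOn w (Icc l r) := HasDerivAt.continuousOn h.hasDerivAt_fun
  obtain ⟨a, hac, ha⟩ := exists_continuousOn_inverse h.lt_left.le (hf.mono hα)
    h.strictMonoOn_left.injOn
  obtain ⟨b, hbc, hb⟩ := exists_continuousOn_inverse h.lt_right.le (hf.mono hβ)
    h.strictMonoOn_right.injOn
  have hle : f β ≤ f α :=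
    (h.strictAntiOn_mid (left_mem_Icc.2 h.lt_mid.le) (right_mem_Icc.2 h.lt_mid.le) h.lt_mid).le
  have hsa : Icc (f β) (f α) ⊆ Icc (f l) (f α) := Icc_subset_Icc_left h.slope_left.le
  have hsb : Icc (f β) (f α) ⊆ Icc (f β) (f r) := Icc_subset_Icc_right h.slope_right.le
  have hgap : ContinuousOn (fun m => w (b m) - w (a m) - m * (b m - a m)) (Icc (f β) (f α)) :=
    have ca := hac.mono hsa
    have cb := hbc.mono hsb
    ((hw.comp cb fun m hm => hβ (hb m (hsb hm)).1).sub
      (hw.comp ca fun m hm => hα (ha m (hsa hm)).1)).sub (continuousOn_id.mul (cb.sub ca))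
  have gap_left : 0 ≤ w (b (f β)) - w (a (f β)) - f β * (b (f β) - a (f β)) := by
    obtain ⟨hb₁, hb₂⟩ := hb _ (hsb (left_mem_Icc.2 hle))
    obtain ⟨ha₁, ha₂⟩ := ha _ (hsa (left_mem_Icc.2 hle))
    rw [h.strictMonoOn_right.injOn hb₁ (left_mem_Icc.2 h.lt_right.le) hb₂]
    exact sub_nonneg.2 (h.tangent_le_of_slope_eq_left ha₁ ha₂)
  have gap_right : w (b (f α)) - w (a (f α)) - f α * (b (f α) - a (f α)) ≤ 0 := by
    obtain ⟨hb₁, hb₂⟩ := hb _ (hsb (right_mem_Icc.2 hle))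
    obtain ⟨ha₁, ha₂⟩ := ha _ (hsa (right_mem_Icc.2 hle))
    rw [h.strictMonoOn_left.injOn ha₁ (right_mem_Icc.2 h.lt_left.le) ha₂]
    exact sub_nonpos.2 (h.le_tangent_of_slope_eq_right hb₁ hb₂)
  obtain ⟨m, hm, hm₀⟩ := intermediate_value_Icc' hle hgap ⟨gap_right, gap_left⟩
  obtain ⟨ham, hfa⟩ := ha m (hsa hm)
  obtain ⟨hbm, hfb⟩ := hb m (hsb hm)
  exact ⟨a m, ham, b m, hbm, hfa.symm ▸ hm, hfa.trans hfb.symm, hfa.symm ▸ sub_eq_zero.1 hm₀⟩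

theorem exists_isMaxwellPair (h : ConvexConcaveConvex w f g l α β r) :
    ∃ a ∈ Ioo l α, ∃ b ∈ Ioo β r, IsMaxwellPair w f g l r a b := by
  obtain ⟨a, ha, b, hb, hm, ht⟩ := h.exists_isBitangent
  have hab : a < b := ha.2.trans_lt (h.lt_mid.trans_le hb.1)
  have hla : l < a := ha.1.lt_of_ne fun e => (h.slope_left.trans_le hm.1).ne (e ▸ rfl)
  have hbr : b < r := hb.2.lt_of_ne fun e =>
    (hm.2.trans_lt h.slope_right).ne (ht.slope_eq.trans (e ▸ rfl))
  have haα := h.left_lt_of_isBitangent hla.le hab hbr.le ht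
  have hβb := h.lt_right_of_isBitangent hla.le hab hbr.le ht
  exact ⟨a, ⟨hla, haα⟩, b, ⟨hβb, hbr⟩,
    { left_lt := hla
      lt := hab
      lt_right := hbr
      bitangent := ht
      pos_left := h.pos_left a ⟨hla.le, haα⟩
      pos_right := h.pos_right b ⟨hβb, hbr.le⟩
      above := fun c hc => h.above_tangent hla.le hbr.le ht hc
      unique := fun x y hx hxy hy => h.isBitangent_unique hla.le hab hbr.le ht hx hxy hy }⟩

end ConvexConcaveConvex

theorem exists_convexConcaveConvex_of_strictConvexOn {w f g : ℝ → ℝ} {l l' c₀ r' r : ℝ}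
    (hl : l < l') (hl' : l' < c₀) (hr' : c₀ < r') (hr : r' < r)
    (hw : ∀ c ∈ Icc l r, HasDerivAt w (f c) c) (hf : ∀ c ∈ Icc l r, HasDerivAt f (g c) c)
    (hg : ContinuousOn g (Icc l r)) (hconv : StrictConvexOn ℝ (Icc l r) g)
    (hgl : 0 < g l') (hgc : g c₀ < 0) (hgr : 0 < g r')
    (hfl : ∀ c ∈ Icc l' r', f l < f c) (hfr : ∀ c ∈ Icc l' r', f c < f r) :
    ∃ α β, α < c₀ ∧ c₀ < β ∧ ConvexConcaveConvex w f g l α β r := by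
  obtain ⟨α, ⟨hlα, hαc⟩, hgα⟩ := intermediate_value_Ioo' hl'.le
    (hg.mono (Icc_subset_Icc hl.le (hr'.trans hr).le)) ⟨hgc, hgl⟩
  obtain ⟨β, ⟨hcβ, hβr⟩, hgβ⟩ := intermediate_value_Ioo hr'.le
    (hg.mono (Icc_subset_Icc (hl.trans hl').le hr.le)) ⟨hgc, hgr⟩
  have hαβ : α < β := hαc.trans hcβ
  have mα : α ∈ Icc l r := ⟨by linarith, by linarith⟩
  have mβ : β ∈ Icc l r := ⟨by linarith, by linarith⟩
  refine ⟨α, β, hαc, hcβ,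
    { lt_left := hl.trans hlα
      lt_mid := hαβ
      lt_right := hβr.trans hr
      hasDerivAt_fun := hw
      hasDerivAt_slope := hf
      pos_left := fun c hc => ?_
      neg_mid := fun c hc => ?_
      pos_right := fun c hc => ?_
      slope_left := hfl β ⟨by linarith, hβr.le⟩
      slope_right := hfr α ⟨hlα.le, by linarith⟩ }⟩
  · have := hconv.slope_strict_mono_adjacent ⟨hc.1, hc.2.le.trans mα.2⟩ mβ hc.2 hαβ
    rwa [hgα, hgβ, sub_zero, zero_div, zero_sub, neg_div, neg_lt_zero,
      div_pos_iff_of_pos_right (sub_pos.2 hc.2)] at this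
  · have := hconv.lt_on_openSegment mα mβ hαβ.ne (z := c) (by rwa [openSegment_eq_Ioo hαβ])
    rwa [hgα, hgβ, max_self] at this
  · have := hconv.slope_strict_mono_adjacent mα ⟨mβ.1.trans hc.1.le, hc.2⟩ hαβ hc.1
    rwa [hgα, hgβ, sub_zero, sub_zero, zero_div, div_pos_iff_of_pos_right (sub_pos.2 hc.1)] at this

/-! ### The Maxwell family of a generic transition -/

theorem contDiffOn_deriv_fst {F : ℝ × ℝ → ℝ} {S : Set (ℝ × ℝ)} (hS : IsOpen S) {m n : WithTop ℕ∞}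
    (hF : ContDiffOn ℝ n F S) (hmn : m + 1 ≤ n) :
    ContDiffOn ℝ m (fun z : ℝ × ℝ => deriv (fun c => F (c, z.2)) z.1) S := by
  have hn : n ≠ 0 := by rintro rfl; simp at hmn
  have h : ContDiffOn ℝ m (fun z => fderiv ℝ F z (1, 0)) S :=
    (hF.fderiv_of_isOpen hS hmn).clm_apply contDiffOn_const
  refine h.congr fun z hz => ?_
  have hd : HasFDerivAt F (fderiv ℝ F z) z :=
    (((hF z hz).contDiffAt (hS.mem_nhds hz)).differentiableAt hn).hasFDerivAt
  have hl : HasDerivAt (fun c : ℝ => ((c, z.2) : ℝ × ℝ)) (1, 0) z.1 :=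
    (hasDerivAt_id z.1).prodMk (hasDerivAt_const _ _)
  exact (HasFDerivAt.comp_hasDerivAt z.1 (f := fun c : ℝ => ((c, z.2) : ℝ × ℝ)) hd hl).deriv

theorem pos_of_strictMonoOn_deriv {f f' : ℝ → ℝ} {l r c x : ℝ}
    (hf : ∀ t ∈ Icc l r, HasDerivAt f (f' t) t) (hmono : StrictMonoOn f' (Icc l r))
    (hc : c ∈ Icc l r) (hfc : f c = 0) (hfc' : f' c = 0) (hx : x ∈ Icc l r) (hne : x ≠ c) :
    0 < f x := by
  rcases lt_or_gt_of_ne hne with hxc | hcx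
  · have := strictAntiOn_Icc_of_hasDerivAt_neg
      (fun t ht => hf t ⟨hx.1.trans ht.1, ht.2.trans hc.2⟩) (fun t ht => hfc' ▸
        hmono ⟨hx.1.trans ht.1.le, ht.2.le.trans hc.2⟩ hc ht.2)
      (left_mem_Icc.2 hxc.le) (right_mem_Icc.2 hxc.le) hxc
    rwa [hfc] at this
  · have := strictMonoOn_Icc_of_hasDerivAt_pos
      (fun t ht => hf t ⟨hc.1.trans ht.1, ht.2.trans hx.2⟩) (fun t ht => hfc' ▸
        hmono hc ⟨hc.1.trans ht.1.le, ht.2.le.trans hx.2⟩ ht.1)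
      (left_mem_Icc.2 hcx.le) (right_mem_Icc.2 hcx.le) hcx
    rwa [hfc] at this

theorem strictMonoOn_Icc_of_hasDerivAt_pos_off {f f' : ℝ → ℝ} {l r c : ℝ} (hc : c ∈ Icc l r)
    (hf : ∀ t ∈ Icc l r, HasDerivAt f (f' t) t) (hpos : ∀ t ∈ Icc l r, t ≠ c → 0 < f' t) :
    StrictMonoOn f (Icc l r) := by
  rw [← Icc_union_Icc_eq_Icc hc.1 hc.2]
  exact (strictMonoOn_Icc_of_hasDerivAt_pos (fun t ht => hf t ⟨ht.1, ht.2.trans hc.2⟩)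
      fun t ht => hpos t ⟨ht.1.le, ht.2.le.trans hc.2⟩ ht.2.ne).union
    (strictMonoOn_Icc_of_hasDerivAt_pos (fun t ht => hf t ⟨hc.1.trans ht.1, ht.2⟩)
      fun t ht => hpos t ⟨hc.1.trans ht.1.le, ht.2.le⟩ ht.1.ne')
    (isGreatest_Icc hc.1) (isLeast_Icc hc.2)

theorem exists_Icc_forall_of_mem_nhds {c₀ θ₀ ε₀ : ℝ} {V : Set (ℝ × ℝ)} (hV : V ∈ 𝓝 (c₀, θ₀))
    (hε₀ : 0 < ε₀) :
    ∃ ε, 0 < ε ∧ ε ≤ ε₀ ∧ ∀ᶠ θ in 𝓝 θ₀, ∀ c ∈ Icc (c₀ - ε) (c₀ + ε), (c, θ) ∈ V := by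
  obtain ⟨η, hη, hball⟩ := Metric.mem_nhds_iff.1 hV
  refine ⟨min (η / 2) ε₀, lt_min (half_pos hη) hε₀, min_le_right _ _, ?_⟩
  filter_upwards [Metric.ball_mem_nhds θ₀ hη] with θ hθ c hc
  refine hball (ball_prod_same c₀ θ₀ η ▸ ⟨?_, hθ⟩)
  rw [← Real.closedBall_eq_Icc] at hc
  exact Metric.closedBall_subset_ball ((min_le_left _ _).trans_lt (half_lt_self hη)) hc

/-- The partial derivative `∂ᵏW / ∂cᵏ`, as a function of `(c, θ)`. -/
def cDeriv (W : ℝ → ℝ → ℝ) (k : ℕ) (z : ℝ × ℝ) : ℝ := iteratedDeriv k (fun c => W c z.2) z.1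

/-- The functions `a`, `b` of `θ ∈ (θt, θs]` are continuous families of phases of `W(·, θ)` on
`[cs - ε, cs + ε]` for `θ < θs`, which merge at `θs` in the point `cs`. -/
structure IsMaxwellFamily (W : ℝ → ℝ → ℝ) (cs θs θt ε : ℝ) (a b : ℝ → ℝ) : Prop where
  radius_pos : 0 < ε
  lt_crit : θt < θs
  continuousOn_left : ContinuousOn a (Ioc θt θs)
  continuousOn_right : ContinuousOn b (Ioc θt θs)
  left_crit : a θs = cs
  right_crit : b θs = cs
  injOn_crit : InjOn (fun c => cDeriv W 1 (c, θs)) (Icc (cs - ε) (cs + ε))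
  pair : ∀ θ ∈ Ioo θt θs, IsMaxwellPair (fun c => W c θ) (fun c => cDeriv W 1 (c, θ))
    (fun c => cDeriv W 2 (c, θ)) (cs - ε) (cs + ε) (a θ) (b θ)

namespace IsMaxwellFamily

variable {W : ℝ → ℝ → ℝ} {cs θs θt ε θ : ℝ} {a b : ℝ → ℝ}

theorem left_mem (h : IsMaxwellFamily W cs θs θt ε a b) (hθ : θ ∈ Ioc θt θs) :
    a θ ∈ Ioo (cs - ε) (cs + ε) := by
  rcases hθ.2.eq_or_lt with rfl | hlt
  · rw [h.left_crit]
    exact ⟨sub_lt_self _ h.radius_pos, lt_add_of_pos_right _ h.radius_pos⟩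
  · exact ⟨(h.pair θ ⟨hθ.1, hlt⟩).left_lt,
      (h.pair θ ⟨hθ.1, hlt⟩).lt.trans (h.pair θ ⟨hθ.1, hlt⟩).lt_right⟩

theorem right_mem (h : IsMaxwellFamily W cs θs θt ε a b) (hθ : θ ∈ Ioc θt θs) :
    b θ ∈ Ioo (cs - ε) (cs + ε) := by
  rcases hθ.2.eq_or_lt with rfl | hlt
  · rw [h.right_crit]
    exact ⟨sub_lt_self _ h.radius_pos, lt_add_of_pos_right _ h.radius_pos⟩
  · exact ⟨(h.pair θ ⟨hθ.1, hlt⟩).left_lt.trans (h.pair θ ⟨hθ.1, hlt⟩).lt,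
      (h.pair θ ⟨hθ.1, hlt⟩).lt_right⟩

theorem slope_eq (h : IsMaxwellFamily W cs θs θt ε a b) (hθ : θ ∈ Ioc θt θs) :
    cDeriv W 1 (a θ, θ) = cDeriv W 1 (b θ, θ) := by
  rcases hθ.2.eq_or_lt with rfl | hlt
  · rw [h.left_crit, h.right_crit]
  · exact (h.pair θ ⟨hθ.1, hlt⟩).bitangent.slope_eq

end IsMaxwellFamily

namespace GenericTransition

variable {W : ℝ → ℝ → ℝ} {Θ : Set ℝ} {cs θs c θ ε : ℝ} {k : ℕ}

theorem isOpen_domain (h : GenericTransition W Θ cs θs) : IsOpen (Ioo (0 : ℝ) 1 ×ˢ Θ) :=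
  isOpen_Ioo.prod h.isOpen

theorem contDiffOn_cDeriv (h : GenericTransition W Θ cs θs) :
    ∀ k m : ℕ, k + m = 4 → ContDiffOn ℝ m (cDeriv W k) (Ioo (0 : ℝ) 1 ×ˢ Θ)
  | 0, m, hm => by
    obtain rfl : m = 4 := by omega
    have e : cDeriv W 0 = fun z : ℝ × ℝ => W z.1 z.2 := by
      ext z; simp [cDeriv]
    exact_mod_cast e ▸ h.smooth
  | k + 1, m, hm => by
    refine (contDiffOn_deriv_fst (m := m) h.isOpen_domain
      (h.contDiffOn_cDeriv k (m + 1) (by omega)) (by simp)).congr fun z _ => ?_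
    simp only [cDeriv, iteratedDeriv_succ]

theorem contDiffAt_cDeriv (h : GenericTransition W Θ cs θs) {m : ℕ} (hk : k + m = 4)
    (hz : (c, θ) ∈ Ioo (0 : ℝ) 1 ×ˢ Θ) : ContDiffAt ℝ m (cDeriv W k) (c, θ) :=
  (h.contDiffOn_cDeriv k m hk).contDiffAt (h.isOpen_domain.mem_nhds hz)

theorem continuousAt_cDeriv (h : GenericTransition W Θ cs θs) (hk : k ≤ 4)
    (hz : (c, θ) ∈ Ioo (0 : ℝ) 1 ×ˢ Θ) : ContinuousAt (cDeriv W k) (c, θ) :=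
  (h.contDiffAt_cDeriv (Nat.add_sub_cancel' hk) hz).continuousAt

theorem hasDerivAt_cDeriv (h : GenericTransition W Θ cs θs) (hk : k < 4)
    (hz : (c, θ) ∈ Ioo (0 : ℝ) 1 ×ˢ Θ) :
    HasDerivAt (fun x => cDeriv W k (x, θ)) (cDeriv W (k + 1) (c, θ)) c := by
  have h₁ : DifferentiableAt ℝ (cDeriv W k) (c, θ) :=
    (h.contDiffAt_cDeriv (m := 4 - k) (by omega) hz).differentiableAt
      (by exact_mod_cast (by omega : 4 - k ≠ 0))
  have h₂ : DifferentiableAt ℝ (fun x => cDeriv W k (x, θ)) c :=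
    DifferentiableAt.fun_comp' (f := fun x : ℝ => ((x, θ) : ℝ × ℝ)) c h₁ (by fun_prop)
  have e : cDeriv W (k + 1) (c, θ) = deriv (fun x => cDeriv W k (x, θ)) c := by
    simp only [cDeriv, iteratedDeriv_succ]
  exact e ▸ h₂.hasDerivAt

theorem hasDerivAt_potential (h : GenericTransition W Θ cs θs)
    (hz : (c, θ) ∈ Ioo (0 : ℝ) 1 ×ˢ Θ) :
    HasDerivAt (fun x => W x θ) (cDeriv W 1 (c, θ)) c := by
  simpa [cDeriv] using h.hasDerivAt_cDeriv (k := 0) (by norm_num) hz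

theorem continuousAt_potential (h : GenericTransition W Θ cs θs)
    (hz : (c, θ) ∈ Ioo (0 : ℝ) 1 ×ˢ Θ) : ContinuousAt (fun z : ℝ × ℝ => W z.1 z.2) (c, θ) :=
  (h.smooth.contDiffAt (h.isOpen_domain.mem_nhds hz)).continuousAt

theorem eventually_cDeriv_two_neg (h : GenericTransition W Θ cs θs) :
    ∀ᶠ θ in 𝓝 θs, θ < θs → cDeriv W 2 (cs, θ) < 0 := by
  filter_upwards [eventually_nhdsWithin_sign_eq_of_deriv_pos h.ccθ_pos h.cc_eq] with θ hθ hlt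
  rw [sign_neg (sub_neg.2 hlt)] at hθ
  exact sign_eq_neg_one_iff.1 hθ

section Critical

variable {l r : ℝ}

theorem cDeriv_two_pos_of_ne (h : GenericTransition W Θ cs θs) (hcs : cs ∈ Icc l r)
    (hdom : ∀ c ∈ Icc l r, (c, θs) ∈ Ioo (0 : ℝ) 1 ×ˢ Θ)
    (h4 : ∀ c ∈ Icc l r, 0 < cDeriv W 4 (c, θs)) (hc : c ∈ Icc l r) (hne : c ≠ cs) :
    0 < cDeriv W 2 (c, θs) := by
  have mono_three : StrictMonoOn (fun x => cDeriv W 3 (x, θs)) (Icc l r) :=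
    strictMonoOn_Icc_of_hasDerivAt_pos
      (fun c hc => h.hasDerivAt_cDeriv (by norm_num) (hdom c hc))
      fun c hc => h4 c (Ioo_subset_Icc_self hc)
  exact pos_of_strictMonoOn_deriv (fun c hc => h.hasDerivAt_cDeriv (by norm_num) (hdom c hc))
    mono_three hcs h.cc_eq h.ccc_eq hc hne

theorem strictMonoOn_cDeriv_one (h : GenericTransition W Θ cs θs) (hcs : cs ∈ Icc l r)
    (hdom : ∀ c ∈ Icc l r, (c, θs) ∈ Ioo (0 : ℝ) 1 ×ˢ Θ)
    (h4 : ∀ c ∈ Icc l r, 0 < cDeriv W 4 (c, θs)) :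
    StrictMonoOn (fun c => cDeriv W 1 (c, θs)) (Icc l r) :=
  strictMonoOn_Icc_of_hasDerivAt_pos_off hcs
    (fun c hc => h.hasDerivAt_cDeriv (by norm_num) (hdom c hc))
    fun _ hc hne => h.cDeriv_two_pos_of_ne hcs hdom h4 hc hne

end Critical

theorem eventually_slope_lt (h : GenericTransition W Θ cs θs) {K : Set ℝ} {x y : ℝ → ℝ}
    (hK : IsCompact K) (hx : Continuous x) (hy : Continuous y)
    (hxdom : ∀ c ∈ K, (x c, θs) ∈ Ioo (0 : ℝ) 1 ×ˢ Θ)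
    (hydom : ∀ c ∈ K, (y c, θs) ∈ Ioo (0 : ℝ) 1 ×ˢ Θ)
    (hlt : ∀ c ∈ K, cDeriv W 1 (x c, θs) < cDeriv W 1 (y c, θs)) :
    ∀ᶠ θ in 𝓝 θs, ∀ c ∈ K, cDeriv W 1 (x c, θ) < cDeriv W 1 (y c, θ) := by
  refine hK.eventually_forall_of_forall_eventually fun c hc => ?_
  have cont : ∀ u : ℝ → ℝ, Continuous u → (u c, θs) ∈ Ioo (0 : ℝ) 1 ×ˢ Θ →
      ContinuousAt (fun z : ℝ × ℝ => cDeriv W 1 (u z.2, z.1)) (θs, c) := fun u hu hdom =>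
    ContinuousAt.comp' (f := fun z : ℝ × ℝ => (u z.2, z.1)) (x := (θs, c))
      (h.continuousAt_cDeriv (by norm_num) hdom) (by fun_prop)
  exact (cont x hx (hxdom c hc)).eventually_lt (cont y hy (hydom c hc)) (hlt c hc)

theorem eventually_cDeriv_two_pos (h : GenericTransition W Θ cs θs)
    (hdom : (c, θs) ∈ Ioo (0 : ℝ) 1 ×ˢ Θ) (hpos : 0 < cDeriv W 2 (c, θs)) :
    ∀ᶠ θ in 𝓝 θs, 0 < cDeriv W 2 (c, θ) :=
  (ContinuousAt.comp' (f := fun θ : ℝ => (c, θ)) (h.continuousAt_cDeriv (by norm_num) hdom)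
    (by fun_prop)).eventually (lt_mem_nhds hpos)

theorem strictConvexOn_cDeriv_two (h : GenericTransition W Θ cs θs) {l r : ℝ}
    (hdom : ∀ c ∈ Icc l r, (c, θ) ∈ Ioo (0 : ℝ) 1 ×ˢ Θ)
    (h4 : ∀ c ∈ Icc l r, 0 < cDeriv W 4 (c, θ)) :
    StrictConvexOn ℝ (Icc l r) fun c => cDeriv W 2 (c, θ) := by
  refine strictConvexOn_of_deriv2_pos' (convex_Icc _ _)
    (HasDerivAt.continuousOn fun c hc => h.hasDerivAt_cDeriv (by norm_num) (hdom c hc))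
    fun c hc => ?_
  have e : deriv^[2] (fun c => cDeriv W 2 (c, θ)) c = cDeriv W 4 (c, θ) := by
    simp only [cDeriv, iteratedDeriv_succ, Function.iterate_succ, Function.comp_apply,
      Function.iterate_zero, id]
  exact e ▸ h4 c hc

theorem eventually_exists_convexConcaveConvex (h : GenericTransition W Θ cs θs) (hε : 0 < ε)
    (hnear : ∀ᶠ θ in 𝓝 θs, ∀ c ∈ Icc (cs - ε) (cs + ε),
      (c, θ) ∈ Ioo (0 : ℝ) 1 ×ˢ Θ ∧ 0 < cDeriv W 4 (c, θ)) :
    ∀ᶠ θ in 𝓝 θs, θ < θs → ∃ α β, α < cs ∧ cs < β ∧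
      ConvexConcaveConvex (fun c => W c θ) (fun c => cDeriv W 1 (c, θ))
        (fun c => cDeriv W 2 (c, θ)) (cs - ε) α β (cs + ε) := by
  have hcrit := hnear.self_of_nhds
  have hdom := fun c hc => (hcrit c hc).1
  have mem_cs : cs ∈ Icc (cs - ε) (cs + ε) := ⟨by linarith, by linarith⟩
  have mem_l : cs - ε ∈ Icc (cs - ε) (cs + ε) := ⟨le_rfl, by linarith⟩
  have mem_r : cs + ε ∈ Icc (cs - ε) (cs + ε) := ⟨by linarith, le_rfl⟩
  have mem_l' : cs - ε / 2 ∈ Icc (cs - ε) (cs + ε) := ⟨by linarith, by linarith⟩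
  have mem_r' : cs + ε / 2 ∈ Icc (cs - ε) (cs + ε) := ⟨by linarith, by linarith⟩
  have hsub : Icc (cs - ε / 2) (cs + ε / 2) ⊆ Icc (cs - ε) (cs + ε) :=
    Icc_subset_Icc mem_l'.1 mem_r'.2
  have mono := h.strictMonoOn_cDeriv_one mem_cs hdom fun c hc => (hcrit c hc).2
  have pos : ∀ c ∈ Icc (cs - ε) (cs + ε), c ≠ cs → 0 < cDeriv W 2 (c, θs) := fun c hc =>
    h.cDeriv_two_pos_of_ne mem_cs hdom (fun c hc => (hcrit c hc).2) hc
  filter_upwards [hnear, h.eventually_cDeriv_two_neg,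
    h.eventually_cDeriv_two_pos (hdom _ mem_l') (pos _ mem_l' (by linarith)),
    h.eventually_cDeriv_two_pos (hdom _ mem_r') (pos _ mem_r' (by linarith)),
    h.eventually_slope_lt isCompact_Icc continuous_const continuous_id (fun _ _ => hdom _ mem_l)
      (fun c hc => hdom c (hsub hc)) fun c hc =>
        mono mem_l (hsub hc) (show cs - ε < c by linarith [hc.1]),
    h.eventually_slope_lt isCompact_Icc continuous_id continuous_const
      (fun c hc => hdom c (hsub hc)) (fun _ _ => hdom _ mem_r)
      fun c hc => mono (hsub hc) mem_r (show c < cs + ε by linarith [hc.2])]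
    with θ hθ neg_cs pos_l pos_r slope_l slope_r hlt
  have deriv_two : ∀ c ∈ Icc (cs - ε) (cs + ε),
      HasDerivAt (fun x => cDeriv W 2 (x, θ)) (cDeriv W 3 (c, θ)) c :=
    fun c hc => h.hasDerivAt_cDeriv (by norm_num) (hθ c hc).1
  exact exists_convexConcaveConvex_of_strictConvexOn (by linarith) (by linarith) (by linarith)
    (by linarith) (fun c hc => h.hasDerivAt_potential (hθ c hc).1)
    (fun c hc => h.hasDerivAt_cDeriv (by norm_num) (hθ c hc).1) (HasDerivAt.continuousOn deriv_two)
    (h.strictConvexOn_cDeriv_two (fun c hc => (hθ c hc).1) fun c hc => (hθ c hc).2)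
    pos_l (neg_cs hlt) pos_r slope_l slope_r

theorem isBitangent_of_tendsto (h : GenericTransition W Θ cs θs) {F : Filter ℝ} [F.NeBot]
    {a b : ℝ → ℝ} {x y : ℝ} (hF : F ≤ 𝓝 θ) (ha : Tendsto a F (𝓝 x)) (hb : Tendsto b F (𝓝 y))
    (hx : (x, θ) ∈ Ioo (0 : ℝ) 1 ×ˢ Θ) (hy : (y, θ) ∈ Ioo (0 : ℝ) 1 ×ˢ Θ)
    (ht : ∀ᶠ t in F, IsBitangent (fun c => W c t) (fun c => cDeriv W 1 (c, t)) (a t) (b t)) :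
    IsBitangent (fun c => W c θ) (fun c => cDeriv W 1 (c, θ)) x y := by
  have ha' : Tendsto (fun t => (a t, t)) F (𝓝 (x, θ)) := ha.prodMk_nhds hF
  have hb' : Tendsto (fun t => (b t, t)) F (𝓝 (y, θ)) := hb.prodMk_nhds hF
  have slope_a := (h.continuousAt_cDeriv (k := 1) (by norm_num) hx).tendsto.comp ha'
  have slope_b := (h.continuousAt_cDeriv (k := 1) (by norm_num) hy).tendsto.comp hb'
  have pot_a := (h.continuousAt_potential hx).tendsto.comp ha'
  have pot_b := (h.continuousAt_potential hy).tendsto.comp hb'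
  exact ⟨tendsto_nhds_unique_of_eventuallyEq slope_a slope_b (ht.mono fun _ h => h.slope_eq),
    tendsto_nhds_unique_of_eventuallyEq (pot_b.sub pot_a) (slope_a.mul (hb.sub ha))
      (ht.mono fun _ h => h.sub_eq)⟩

/-- `a` and `b` are the phases of `W(·, θ)` on the two sides of `cs`, or both equal to `cs` in the
critical case `θ = θs`. -/
structure IsPhasePair (W : ℝ → ℝ → ℝ) (cs θs ε θ a b : ℝ) : Prop where
  left_mem : a ∈ Icc (cs - ε) cs
  right_mem : b ∈ Icc cs (cs + ε)
  bitangent : IsBitangent (fun c => W c θ) (fun c => cDeriv W 1 (c, θ)) a b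
  nonneg_left : 0 ≤ cDeriv W 2 (a, θ)
  eq_of_crit : θ = θs → a = cs ∧ b = cs
  isMaxwellPair : θ < θs → IsMaxwellPair (fun c => W c θ) (fun c => cDeriv W 1 (c, θ))
    (fun c => cDeriv W 2 (c, θ)) (cs - ε) (cs + ε) a b

theorem eventually_exists_isPhasePair (h : GenericTransition W Θ cs θs) (hε : 0 < ε)
    (hnear : ∀ᶠ θ in 𝓝 θs, ∀ c ∈ Icc (cs - ε) (cs + ε),
      (c, θ) ∈ Ioo (0 : ℝ) 1 ×ˢ Θ ∧ 0 < cDeriv W 4 (c, θ)) :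
    ∀ᶠ θ in 𝓝 θs, θ ≤ θs → ∃ a b, IsPhasePair W cs θs ε θ a b := by
  filter_upwards [h.eventually_exists_convexConcaveConvex hε hnear] with θ hccc hθ
  rcases hθ.eq_or_lt with rfl | hlt
  · exact ⟨cs, cs, ⟨by linarith, le_rfl⟩, ⟨le_rfl, by linarith⟩, ⟨rfl, by simp⟩, h.cc_eq.ge,
      fun _ => ⟨rfl, rfl⟩, fun hlt => absurd hlt (lt_irrefl _)⟩
  · obtain ⟨α, β, hα, hβ, hW⟩ := hccc hlt
    obtain ⟨a, ha, b, hb, hpair⟩ := hW.exists_isMaxwellPair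
    exact ⟨a, b, ⟨ha.1.le, (ha.2.trans hα).le⟩, ⟨(hβ.trans hb.1).le, hb.2.le⟩, hpair.bitangent,
      hpair.pos_left.le, fun e => absurd e hlt.ne, fun _ => hpair⟩

theorem continuousOn_of_isPhasePair (h : GenericTransition W Θ cs θs) (hε : 0 < ε) {θt : ℝ}
    {a b : ℝ → ℝ} (hdom : Icc (cs - ε) (cs + ε) ×ˢ Ioc θt θs ⊆ Ioo (0 : ℝ) 1 ×ˢ Θ)
    (hinj : InjOn (fun c => cDeriv W 1 (c, θs)) (Icc (cs - ε) (cs + ε)))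
    (hneg : ∀ θ ∈ Ioo θt θs, cDeriv W 2 (cs, θ) < 0)
    (hpair : ∀ θ ∈ Ioc θt θs, IsPhasePair W cs θs ε θ (a θ) (b θ)) :
    ContinuousOn (fun θ => (a θ, b θ)) (Ioc θt θs) := by
  refine continuousOn_of_unique_limit (isCompact_Icc.prod isCompact_Icc)
    (fun θ hθ => ⟨(hpair θ hθ).left_mem, (hpair θ hθ).right_mem⟩) ?_
  rintro θ hθ ⟨x, y⟩ ⟨hx, hy⟩ U hU hlim
  dsimp only at hx hy
  have hUT : ∀ᶠ t in (U : Filter ℝ), t ∈ Ioc θt θs := hU self_mem_nhdsWithin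
  have hU' : (U : Filter ℝ) ≤ 𝓝 θ := hU.trans nhdsWithin_le_nhds
  have hUa : Tendsto a U (𝓝 x) := (continuous_fst.tendsto (x, y)).comp hlim
  have hUb : Tendsto b U (𝓝 y) := (continuous_snd.tendsto (x, y)).comp hlim
  have mx : x ∈ Icc (cs - ε) (cs + ε) := ⟨hx.1, by linarith [hx.2]⟩
  have my : y ∈ Icc (cs - ε) (cs + ε) := ⟨by linarith [hy.1], hy.2⟩
  have ht := h.isBitangent_of_tendsto hU' hUa hUb (hdom ⟨mx, hθ⟩) (hdom ⟨my, hθ⟩)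
    (hUT.mono fun t ht => (hpair t ht).bitangent)
  rcases hθ.2.eq_or_lt with rfl | hlt
  · obtain ⟨ea, eb⟩ := (hpair θ hθ).eq_of_crit rfl
    have hxy := hinj mx my ht.slope_eq
    rw [ea, eb, le_antisymm hx.2 (hxy ▸ hy.1), le_antisymm (hxy ▸ hx.2) hy.1]
  · have nonneg_x : 0 ≤ cDeriv W 2 (x, θ) := ge_of_tendsto
      ((h.continuousAt_cDeriv (by norm_num) (hdom ⟨mx, hθ⟩)).tendsto.comp (hUa.prodMk_nhds hU'))
      (hUT.mono fun t ht => (hpair t ht).nonneg_left)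
    have hxcs : x < cs := hx.2.lt_of_ne fun e => (hneg θ ⟨hθ.1, hlt⟩).not_ge (e ▸ nonneg_x)
    obtain ⟨ex, ey⟩ := ((hpair θ hθ).isMaxwellPair hlt).unique x y hx.1 (hxcs.trans_le hy.1)
      hy.2 ht
    rw [ex, ey]

theorem exists_isMaxwellFamily (h : GenericTransition W Θ cs θs) {ε₀ : ℝ} {V : Set (ℝ × ℝ)}
    (hV : V ∈ 𝓝 (cs, θs)) (hε₀ : 0 < ε₀) :
    ∃ ε θt a b, ε ≤ ε₀ ∧ Icc (cs - ε) (cs + ε) ×ˢ Ioc θt θs ⊆ V ∧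
      IsMaxwellFamily W cs θs θt ε a b := by
  have hz : (cs, θs) ∈ Ioo (0 : ℝ) 1 ×ˢ Θ := ⟨h.mem_frac, h.mem_temp⟩
  have hdom : ∀ᶠ z in 𝓝 (cs, θs), z ∈ V ∧ z ∈ Ioo (0 : ℝ) 1 ×ˢ Θ ∧ 0 < cDeriv W 4 z :=
    (show ∀ᶠ z in 𝓝 (cs, θs), z ∈ V from hV).and ((h.isOpen_domain.eventually_mem hz).and
      ((h.continuousAt_cDeriv (by norm_num) hz).eventually (lt_mem_nhds h.cccc_pos)))
  obtain ⟨ε, hε, hεle, hnear⟩ := exists_Icc_forall_of_mem_nhds hdom hε₀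
  have hnear' : ∀ᶠ θ in 𝓝 θs, ∀ c ∈ Icc (cs - ε) (cs + ε),
      (c, θ) ∈ Ioo (0 : ℝ) 1 ×ˢ Θ ∧ 0 < cDeriv W 4 (c, θ) :=
    hnear.mono fun θ hθ c hc => (hθ c hc).2
  have hcrit := hnear'.self_of_nhds
  have hinj := (h.strictMonoOn_cDeriv_one ⟨by linarith, by linarith⟩
    (fun c hc => (hcrit c hc).1) fun c hc => (hcrit c hc).2).injOn
  obtain ⟨η, hη, hball⟩ := Metric.eventually_nhds_iff_ball.1
    (hnear.and (h.eventually_cDeriv_two_neg.and (h.eventually_exists_isPhasePair hε hnear')))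
  have hIoc : ∀ θ ∈ Ioc (θs - η) θs, θ ∈ Metric.ball θs η := fun θ hθ => by
    rw [Real.ball_eq_Ioo]; exact ⟨hθ.1, by linarith [hθ.2]⟩
  choose! a b hpair using fun θ (hθ : θ ∈ Ioc (θs - η) θs) => (hball θ (hIoc θ hθ)).2.2 hθ.2
  have mem_crit : θs ∈ Ioc (θs - η) θs := ⟨by linarith, le_rfl⟩
  have hcont := h.continuousOn_of_isPhasePair hε
    (fun z hz => ((hball z.2 (hIoc _ hz.2)).1 z.1 hz.1).2.1) hinj
    (fun θ hθ => (hball θ (hIoc θ (Ioo_subset_Ioc_self hθ))).2.1 hθ.2) hpair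
  exact ⟨ε, θs - η, a, b, hεle, fun z hz => ((hball z.2 (hIoc _ hz.2)).1 z.1 hz.1).1,
    { radius_pos := hε
      lt_crit := by linarith
      continuousOn_left := hcont.fst
      continuousOn_right := hcont.snd
      left_crit := ((hpair θs mem_crit).eq_of_crit rfl).1
      right_crit := ((hpair θs mem_crit).eq_of_crit rfl).2
      injOn_crit := hinj
      pair := fun θ hθ => (hpair θ (Ioo_subset_Ioc_self hθ)).isMaxwellPair hθ.2 }⟩

end GenericTransition


/-! ### Pressure and mass fraction as coordinates on the states -/

/-- The derivative `-Ĝ_c`, as a function of the pressure. -/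
def affinity (τ₁ p : ℝ) : ℝ := 1 + Real.log p - τ₁ * p

/-- The specific volume `Ĝ_p`, as a function of pressure and mass fraction. -/
def specVol (τ₁ p c : ℝ) : ℝ := c * τ₁ + (1 - c) / p

/-- The state with given pressure and mass fraction. -/
def stateOf (τ₁ p c : ℝ) : ℝ × ℝ := (1 / specVol τ₁ p c, c)

section State

variable {τ₁ p c : ℝ} {s : ℝ × ℝ}

theorem specVol_pos (hτ : 0 < τ₁) (hp : 0 < p) (hc : c ∈ Ioo (0 : ℝ) 1) : 0 < specVol τ₁ p c :=
  add_pos (mul_pos hc.1 hτ) (div_pos (sub_pos.2 hc.2) hp)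

theorem hasDerivAt_Uhat_vol {τ : ℝ} (hτ : 0 < τ - c * τ₁) (hc : c < 1) :
    HasDerivAt (fun τ => Uhat τ₁ τ c) (-((1 - c) / (τ - c * τ₁))) τ := by
  have hc' : 0 < 1 - c := sub_pos.2 hc
  refine (((((hasDerivAt_id' τ).sub_const (c * τ₁)).div_const (1 - c)).log
    (div_pos hτ hc').ne').const_mul (-(1 - c))).congr_deriv ?_
  field_simp

theorem hasDerivAt_Uhat_frac {τ : ℝ} (hτ : 0 < τ - c * τ₁) (hc : c < 1) :
    HasDerivAt (fun c => Uhat τ₁ τ c) (-affinity τ₁ ((1 - c) / (τ - c * τ₁))) c := by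
  have hc' : 0 < 1 - c := sub_pos.2 hc
  have hden : HasDerivAt (fun x : ℝ => 1 - x) (-1) c := (hasDerivAt_id' c).const_sub 1
  have hnum : HasDerivAt (fun x : ℝ => τ - x * τ₁) (-τ₁) c := by
    simpa using ((hasDerivAt_id' c).mul_const τ₁).const_sub τ
  refine (hden.fun_neg.mul ((hnum.div hden hc'.ne').log (div_pos hτ hc').ne')).congr_deriv ?_
  rw [affinity, Pi.div_apply, ← inv_div (τ - c * τ₁), Real.log_inv]
  field_simp
  ring

theorem vol_sub_pos (hτ : 0 < τ₁) (hs : s ∈ stateSpace τ₁) : 0 < 1 / s.1 - s.2 * τ₁ := by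
  obtain ⟨_, hvol, _, hlt⟩ := hs
  nlinarith

theorem pressure_eq (hτ : 0 < τ₁) (hs : s ∈ stateSpace τ₁) (W : ℝ → ℝ → ℝ) (θ : ℝ) :
    pressure τ₁ W θ s = (1 - s.2) / (1 / s.1 - s.2 * τ₁) := by
  have h := (hasDerivAt_Uhat_vol (vol_sub_pos hτ hs) hs.2.2.2).add_const (W s.2 θ)
  exact neg_eq_iff_eq_neg.2 h.deriv

theorem pressure_mem_Ioo (hτ : 0 < τ₁) (hs : s ∈ stateSpace τ₁) (W : ℝ → ℝ → ℝ) (θ : ℝ) :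
    pressure τ₁ W θ s ∈ Ioo 0 (1 / τ₁) := by
  have hvol := vol_sub_pos hτ hs
  have hc : 0 < 1 - s.2 := sub_pos.2 hs.2.2.2
  rw [pressure_eq hτ hs]
  refine ⟨div_pos hc hvol, (div_lt_div_iff₀ hvol hτ).2 ?_⟩
  linarith [hs.2.1]

theorem rate_eq (hτ : 0 < τ₁) (hs : s ∈ stateSpace τ₁) {W : ℝ → ℝ → ℝ} {θ w : ℝ}
    (hW : HasDerivAt (fun c => W c θ) w s.2) :
    rate τ₁ W θ s = affinity τ₁ (pressure τ₁ W θ s) - w := by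
  have h : deriv (fun c => U τ₁ W θ (1 / s.1) c) s.2 = _ :=
    ((hasDerivAt_Uhat_frac (vol_sub_pos hτ hs) hs.2.2.2).add hW).deriv
  rw [rate, h, pressure_eq hτ hs]
  ring

theorem one_div_eq_specVol (hτ : 0 < τ₁) (hs : s ∈ stateSpace τ₁) (W : ℝ → ℝ → ℝ) (θ : ℝ) :
    1 / s.1 = specVol τ₁ (pressure τ₁ W θ s) s.2 := by
  rw [pressure_eq hτ hs, specVol, div_div_cancel₀ (sub_pos.2 hs.2.2.2).ne']
  ring

theorem stateOf_pressure (hτ : 0 < τ₁) (hs : s ∈ stateSpace τ₁) (W : ℝ → ℝ → ℝ) (θ : ℝ) :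
    stateOf τ₁ (pressure τ₁ W θ s) s.2 = s := by
  rw [stateOf, ← one_div_eq_specVol hτ hs, one_div_one_div]

theorem stateOf_mem_stateSpace (hτ : 0 < τ₁) (hp : p ∈ Ioo 0 (1 / τ₁)) (hc : c ∈ Ioo (0 : ℝ) 1) :
    stateOf τ₁ p c ∈ stateSpace τ₁ := by
  refine ⟨one_div_pos.2 (specVol_pos hτ hp.1 hc), ?_, hc.1, hc.2⟩
  have hp' : τ₁ < 1 / p := (lt_one_div hp.1 hτ).1 hp.2
  have hgap : 0 < (1 - c) * (1 / p - τ₁) := mul_pos (sub_pos.2 hc.2) (sub_pos.2 hp')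
  simp only [stateOf, one_div_one_div, specVol]
  linarith [mul_one_div (1 - c) p]

theorem pressure_stateOf (hτ : 0 < τ₁) (hp : p ∈ Ioo 0 (1 / τ₁)) (hc : c ∈ Ioo (0 : ℝ) 1)
    (W : ℝ → ℝ → ℝ) (θ : ℝ) : pressure τ₁ W θ (stateOf τ₁ p c) = p := by
  rw [pressure_eq hτ (stateOf_mem_stateSpace hτ hp hc)]
  simp only [stateOf, one_div_one_div, specVol, add_sub_cancel_left]
  exact div_div_cancel₀ (sub_pos.2 hc.2).ne'

end State

section Affinity

variable {τ₁ p : ℝ}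

theorem hasDerivAt_affinity (hp : 0 < p) : HasDerivAt (affinity τ₁) (1 / p - τ₁) p := by
  have := (((hasDerivAt_id' p).log hp.ne').const_add 1).sub ((hasDerivAt_id' p).const_mul τ₁)
  simpa [affinity] using! this

theorem strictMonoOn_affinity (hτ : 0 < τ₁) : StrictMonoOn (affinity τ₁) (Ioc 0 (1 / τ₁)) := by
  refine strictMonoOn_of_deriv_pos (convex_Ioc _ _)
    (fun p hp => (hasDerivAt_affinity hp.1).continuousAt.continuousWithinAt) fun p hp => ?_
  rw [interior_Ioc] at hp
  rw [(hasDerivAt_affinity hp.1).deriv, sub_pos]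
  exact (lt_one_div hp.1 hτ).1 hp.2

theorem affinity_one_div (hτ : 0 < τ₁) : affinity τ₁ (1 / τ₁) = -Real.log τ₁ := by
  rw [affinity, one_div, Real.log_inv, mul_inv_cancel₀ hτ.ne']
  ring

theorem exp_sub_one_lt_of_le_affinity {m : ℝ} (hτ : 0 < τ₁) (hp : 0 < p)
    (h : m ≤ affinity τ₁ p) : Real.exp (m - 1) < p := by
  rw [← Real.lt_log_iff_exp_lt hp]
  rw [affinity] at h
  linarith [mul_pos hτ hp]

theorem exists_continuousOn_affinity_inverse {m₀ m₁ : ℝ} (hτ : 0 < τ₁) (hm : m₀ ≤ m₁)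
    (h : m₁ < -Real.log τ₁) :
    ∃ P : ℝ → ℝ, ContinuousOn P (Icc m₀ m₁) ∧
      ∀ m ∈ Icc m₀ m₁, P m ∈ Ioo 0 (1 / τ₁) ∧ affinity τ₁ (P m) = m := by
  have hexp := Real.exp_pos (m₀ - 1)
  have exp_lt : Real.exp (m₀ - 1) < 1 / τ₁ :=
    exp_sub_one_lt_of_le_affinity hτ (one_div_pos.2 hτ)
      (affinity_one_div hτ ▸ hm.trans h.le)
  have low : affinity τ₁ (Real.exp (m₀ - 1)) ≤ m₀ := by
    rw [affinity, Real.log_exp]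
    linarith [mul_pos hτ hexp]
  obtain ⟨P, hPc, hP⟩ := exists_continuousOn_inverse (f := affinity τ₁) exp_lt.le
    (fun p hp => (hasDerivAt_affinity (hexp.trans_le hp.1)).continuousAt.continuousWithinAt)
    ((strictMonoOn_affinity hτ).mono fun p hp => ⟨hexp.trans_le hp.1, hp.2⟩).injOn
  have hsub : Icc m₀ m₁ ⊆ Icc (affinity τ₁ (Real.exp (m₀ - 1))) (affinity τ₁ (1 / τ₁)) :=
    Icc_subset_Icc low (affinity_one_div hτ ▸ h.le)
  refine ⟨P, hPc.mono hsub, fun m hm' => ?_⟩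
  obtain ⟨mem, eq⟩ := hP m (hsub hm')
  refine ⟨⟨hexp.trans_le mem.1, mem.2.lt_of_ne fun e => ?_⟩, eq⟩
  rw [e, affinity_one_div hτ] at eq
  linarith [hm'.2]

end Affinity

/-! ### The function `Γ` and its saddles -/

theorem hasDerivAt_Ghat {τ₁ p' c' x : ℝ} {p c : ℝ → ℝ} (hp : HasDerivAt p p' x)
    (hc : HasDerivAt c c' x) (hpos : 0 < p x) :
    HasDerivAt (fun t => Ghat τ₁ (p t) (c t))
      (specVol τ₁ (p x) (c x) * p' - affinity τ₁ (p x) * c') x := by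
  have h := ((hc.const_sub 1).mul ((hp.log hpos.ne').const_add 1)).add
    ((hc.mul hp).mul_const τ₁)
  unfold Ghat
  convert! h using 1
  rw [specVol, affinity]
  field_simp
  ring

theorem fderiv_fderiv_apply_of_hasLineDerivAt {E : Type*} [NormedAddCommGroup E]
    [NormedSpace ℝ E] {F : E → ℝ} {z v : E} {s : ℝ} (hF : ContDiffAt ℝ 2 F z)
    (h : HasLineDerivAt ℝ (fun w => fderiv ℝ F w v) s z v) :
    fderiv ℝ (fderiv ℝ F) z v v = s := by
  have hd : DifferentiableAt ℝ (fderiv ℝ F) z :=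
    (hF.fderiv_right (m := 1) (by norm_num)).differentiableAt (by norm_num)
  have h' := (hd.hasFDerivAt.clm_apply (hasFDerivAt_const v z)).hasLineDerivAt v
  exact HasLineDerivAt.unique (by simpa using h') h

theorem hasLineDerivAt_fst_of_hasDerivAt {F : ℝ × ℝ → ℝ} {x y s : ℝ}
    (h : HasDerivAt (fun t => F (t, y)) s x) : HasLineDerivAt ℝ F s (x, y) (1, 0) := by
  simpa [HasLineDerivAt] using HasDerivAt.comp_const_add x 0 (by simpa using h)

theorem hasLineDerivAt_snd_of_hasDerivAt {F : ℝ × ℝ → ℝ} {x y s : ℝ}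
    (h : HasDerivAt (fun t => F (x, t)) s y) : HasLineDerivAt ℝ F s (x, y) (0, 1) := by
  simpa [HasLineDerivAt] using HasDerivAt.comp_const_add y 0 (by simpa using h)

section Proot

variable {τ₁ ϖ c y : ℝ}

theorem proot_zero (hτ : 0 < τ₁) (hϖ : 0 < ϖ) (hc : c ∈ Ioo (0 : ℝ) 1) :
    proot τ₁ ϖ c 0 = ϖ :=
  (((proot_spec hτ hϖ hc.1 hc.2 0).2 ϖ hϖ).1 (by ring)).symm

theorem contDiffAt_proot (hτ : 0 < τ₁) (hϖ : 0 < ϖ) {z : ℝ × ℝ} (hc : z.1 ∈ Ioo (0 : ℝ) 1)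
    {n : WithTop ℕ∞} : ContDiffAt ℝ n (fun z : ℝ × ℝ => proot τ₁ ϖ z.1 z.2) z := by
  have hcτ : 0 < z.1 * τ₁ := mul_pos hc.1 hτ
  have hcϖ : 0 < ϖ * (1 - z.1) := mul_pos hϖ (sub_pos.2 hc.2)
  have : 0 < 4 * (z.1 * τ₁) * (ϖ * (1 - z.1)) := by positivity
  unfold proot
  refine ContDiffAt.div (ContDiffAt.add (by fun_prop) (ContDiffAt.sqrt (by fun_prop) ?_))
    (by fun_prop) (by positivity)
  positivity

theorem differentiableAt_proot (hτ : 0 < τ₁) (hϖ : 0 < ϖ) (hc : c ∈ Ioo (0 : ℝ) 1) :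
    DifferentiableAt ℝ (proot τ₁ ϖ c) y :=
  DifferentiableAt.fun_comp' (f := fun t : ℝ => ((c, t) : ℝ × ℝ)) y
    ((contDiffAt_proot hτ hϖ (z := (c, y)) hc (n := 1)).differentiableAt (by norm_num))
    (by fun_prop)

/-- The factor `k` in the identity `∂_y Γ(c, y) = y k(c, y)`. -/
def kineticFactor (τ₁ ϖ c y : ℝ) : ℝ :=
  1 - 2 * (c * τ₁ * proot τ₁ ϖ c y + (1 - c)) ^ 2 /
    ((c * τ₁ * proot τ₁ ϖ c y + (1 - c)) ^ 2 + y ^ 2 * (1 - c))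

theorem specVol_mul_deriv_proot_add (hτ : 0 < τ₁) (hϖ : 0 < ϖ) (hc : c ∈ Ioo (0 : ℝ) 1) :
    specVol τ₁ (proot τ₁ ϖ c y) c * deriv (proot τ₁ ϖ c) y + y = y * kineticFactor τ₁ ϖ c y := by
  have root : ∀ t, (proot τ₁ ϖ c t - ϖ) * (c * τ₁ * proot τ₁ ϖ c t + (1 - c))
      + t ^ 2 * proot τ₁ ϖ c t = 0 := fun t =>
    ((proot_spec hτ hϖ hc.1 hc.2 t).2 _ (proot_spec hτ hϖ hc.1 hc.2 t).1).2 rfl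
  have pos : 0 < proot τ₁ ϖ c y := (proot_spec hτ hϖ hc.1 hc.2 y).1
  have hp := (differentiableAt_proot hτ hϖ hc (y := y)).hasDerivAt
  have root_deriv := (((hp.sub_const ϖ).mul ((hp.const_mul (c * τ₁)).add_const (1 - c))).add
    ((hasDerivAt_pow 2 y).mul hp)).unique
      ((hasDerivAt_const y (0 : ℝ)).congr_of_eventuallyEq (Eventually.of_forall root))
  have root_y := root y
  have hcτ : 0 < c * τ₁ := mul_pos hc.1 hτ
  have hc' : 0 < 1 - c := sub_pos.2 hc.2
  simp only [Nat.cast_ofNat, Nat.add_one_sub_one, pow_one] at root_deriv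
  rw [kineticFactor]
  set p := proot τ₁ ϖ c y
  set p' := deriv (proot τ₁ ϖ c) y
  set A := c * τ₁ * p + (1 - c) with hA
  have hden : 0 < A ^ 2 + y ^ 2 * (1 - c) := by positivity
  have vol_eq : specVol τ₁ p c = A / p := by
    rw [specVol, hA]; field_simp
  have deriv_eq : p' * (A ^ 2 + y ^ 2 * (1 - c)) = -(2 * y * p * A) := by
    rw [show 1 - c = A - c * τ₁ * p by rw [hA]; ring]
    linear_combination A * root_deriv - c * τ₁ * p' * root_y
  rw [vol_eq, eq_div_of_mul_eq hden.ne' deriv_eq]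
  clear_value A
  field_simp
  ring

theorem hasDerivAt_mul_kineticFactor_zero (hτ : 0 < τ₁) (hϖ : 0 < ϖ) (hc : c ∈ Ioo (0 : ℝ) 1) :
    HasDerivAt (fun y => y * kineticFactor τ₁ ϖ c y) (-1) 0 := by
  have hA : 0 < c * τ₁ * ϖ + (1 - c) :=
    add_pos (mul_pos (mul_pos hc.1 hτ) hϖ) (sub_pos.2 hc.2)
  have hp : DifferentiableAt ℝ (proot τ₁ ϖ c) 0 := differentiableAt_proot hτ hϖ hc
  have hk : DifferentiableAt ℝ (kineticFactor τ₁ ϖ c) 0 := by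
    refine DifferentiableAt.const_sub (DifferentiableAt.div (by fun_prop) (by fun_prop) ?_) 1
    simp [proot_zero hτ hϖ hc, hA.ne']
  refine ((hasDerivAt_id' (0 : ℝ)).mul hk.hasDerivAt).congr_deriv ?_
  rw [kineticFactor, proot_zero hτ hϖ hc]
  field_simp
  ring

end Proot

section Saddle

variable {τ₁ ϖ θ c y w : ℝ} {W : ℝ → ℝ → ℝ}

theorem Gam_zero (hτ : 0 < τ₁) (hϖ : 0 < ϖ) (hc : c ∈ Ioo (0 : ℝ) 1) (W : ℝ → ℝ → ℝ) (θ : ℝ) :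
    Gam τ₁ W θ ϖ (c, 0) = Ghat τ₁ ϖ c + W c θ := by
  simp [Gam, proot_zero hτ hϖ hc]

theorem contDiffAt_Gam (hτ : 0 < τ₁) (hϖ : 0 < ϖ) {z : ℝ × ℝ} (hc : z.1 ∈ Ioo (0 : ℝ) 1)
    {n : WithTop ℕ∞} (hW : ContDiffAt ℝ n (fun c => W c θ) z.1) :
    ContDiffAt ℝ n (Gam τ₁ W θ ϖ) z := by
  have hp := contDiffAt_proot hτ hϖ hc (n := n)
  have hlog : ContDiffAt ℝ n (fun z : ℝ × ℝ => Real.log (proot τ₁ ϖ z.1 z.2)) z :=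
    hp.log (proot_spec hτ hϖ hc.1 hc.2 z.2).1.ne'
  have : ContDiffAt ℝ n (fun z : ℝ × ℝ => W z.1 θ) z :=
    ContDiffAt.comp (g := fun c => W c θ) (f := Prod.fst) z hW contDiffAt_fst
  unfold Gam Ghat
  fun_prop

theorem fderiv_Gam_zero_fst (hτ : 0 < τ₁) (hϖ : 0 < ϖ) (hc : c ∈ Ioo (0 : ℝ) 1)
    (hF : DifferentiableAt ℝ (Gam τ₁ W θ ϖ) (c, 0)) (hw : HasDerivAt (fun c => W c θ) w c) :
    fderiv ℝ (Gam τ₁ W θ ϖ) (c, 0) (1, 0) = w - affinity τ₁ ϖ := by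
  refine (hF.hasFDerivAt.hasLineDerivAt _).unique (hasLineDerivAt_fst_of_hasDerivAt ?_)
  have h := (hasDerivAt_Ghat (τ₁ := τ₁) (hasDerivAt_const c ϖ) (hasDerivAt_id' c) hϖ).add hw
  refine (h.congr_of_eventuallyEq ?_).congr_deriv (by ring)
  filter_upwards [isOpen_Ioo.mem_nhds hc] with t ht using Gam_zero hτ hϖ ht W θ

theorem fderiv_Gam_snd (hτ : 0 < τ₁) (hϖ : 0 < ϖ) (hc : c ∈ Ioo (0 : ℝ) 1)
    (hF : DifferentiableAt ℝ (Gam τ₁ W θ ϖ) (c, y)) :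
    fderiv ℝ (Gam τ₁ W θ ϖ) (c, y) (0, 1) = y * kineticFactor τ₁ ϖ c y := by
  refine (hF.hasFDerivAt.hasLineDerivAt _).unique (hasLineDerivAt_snd_of_hasDerivAt ?_)
  have h := ((hasDerivAt_Ghat (τ₁ := τ₁) (differentiableAt_proot hτ hϖ hc).hasDerivAt
    (hasDerivAt_const y c) (proot_spec hτ hϖ hc.1 hc.2 y).1).add_const (W c θ)).add
      ((hasDerivAt_pow 2 y).const_mul (1 / 2 : ℝ))
  rw [← specVol_mul_deriv_proot_add hτ hϖ hc]
  exact h.congr_deriv (by simp)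

theorem isSaddle_Gam (hτ : 0 < τ₁) (hϖ : 0 < ϖ) {w : ℝ → ℝ} {w' : ℝ}
    (hc : c ∈ Ioo (0 : ℝ) 1) (hW : ContDiffOn ℝ 2 (fun c => W c θ) (Ioo 0 1))
    (hw : ∀ x ∈ Ioo (0 : ℝ) 1, HasDerivAt (fun c => W c θ) (w x) x) (hw' : HasDerivAt w w' c)
    (hcrit : w c = affinity τ₁ ϖ) (hpos : 0 < w') : IsSaddle (Gam τ₁ W θ ϖ) (c, 0) := by
  have smooth : ∀ x ∈ Ioo (0 : ℝ) 1, ∀ y, ContDiffAt ℝ 2 (Gam τ₁ W θ ϖ) (x, y) := fun x hx y =>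
    contDiffAt_Gam hτ hϖ hx (hW.contDiffAt (isOpen_Ioo.mem_nhds hx))
  have diff : ∀ x ∈ Ioo (0 : ℝ) 1, ∀ y, DifferentiableAt ℝ (Gam τ₁ W θ ϖ) (x, y) := fun x hx y =>
    (smooth x hx y).differentiableAt (by norm_num)
  have fst_fst : fderiv ℝ (fderiv ℝ (Gam τ₁ W θ ϖ)) (c, 0) (1, 0) (1, 0) = w' := by
    refine fderiv_fderiv_apply_of_hasLineDerivAt (smooth c hc 0)
      (hasLineDerivAt_fst_of_hasDerivAt ((hw'.sub_const (affinity τ₁ ϖ)).congr_of_eventuallyEq ?_))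
    filter_upwards [isOpen_Ioo.mem_nhds hc] with x hx
      using fderiv_Gam_zero_fst hτ hϖ hx (diff x hx 0) (hw x hx)
  have snd_snd : fderiv ℝ (fderiv ℝ (Gam τ₁ W θ ϖ)) (c, 0) (0, 1) (0, 1) = -1 := by
    refine fderiv_fderiv_apply_of_hasLineDerivAt (smooth c hc 0)
      (hasLineDerivAt_snd_of_hasDerivAt
        ((hasDerivAt_mul_kineticFactor_zero hτ hϖ hc).congr_of_eventuallyEq ?_))
    exact Eventually.of_forall fun y => fderiv_Gam_snd hτ hϖ hc (diff c hc y)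
  refine ⟨diff c hc 0, ?_, ⟨(0, 1), by rw [snd_snd]; norm_num⟩, ⟨(1, 0), by rwa [fst_fst]⟩⟩
  ext
  · simp [fderiv_Gam_zero_fst hτ hϖ hc (diff c hc 0) (hw c hc), hcrit]
  · simp [fderiv_Gam_snd hτ hϖ hc (diff c hc 0)]

theorem slope_eq_affinity_of_isSaddle (hτ : 0 < τ₁) (hϖ : 0 < ϖ) (hc : c ∈ Ioo (0 : ℝ) 1)
    (hw : HasDerivAt (fun c => W c θ) w c) (h : IsSaddle (Gam τ₁ W θ ϖ) (c, 0)) :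
    w = affinity τ₁ ϖ := by
  have hfst := fderiv_Gam_zero_fst hτ hϖ hc h.1 hw
  rw [h.2.1] at hfst
  exact sub_eq_zero.1 hfst.symm

end Saddle

section Continuity

variable {τ₁ p c : ℝ}

theorem isOpen_stateSpace (τ₁ : ℝ) : IsOpen (stateSpace τ₁) := by
  have eq_inter : stateSpace τ₁ = {s : ℝ × ℝ | 0 < s.1} ∩ {s | τ₁ * s.1 < 1} ∩
      ({s | 0 < s.2} ∩ {s | s.2 < 1}) := by
    ext s
    simp only [stateSpace, mem_inter_iff, mem_ofPred_eq, and_assoc]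
    exact and_congr_right fun hpos => and_congr_left' (lt_div_iff₀ hpos)
  rw [eq_inter]
  exact ((isOpen_lt (by fun_prop) (by fun_prop)).inter
    (isOpen_lt (by fun_prop) (by fun_prop))).inter
      ((isOpen_lt (by fun_prop) (by fun_prop)).inter (isOpen_lt (by fun_prop) (by fun_prop)))

theorem continuousAt_pressure (hτ : 0 < τ₁) {s : ℝ × ℝ} (hs : s ∈ stateSpace τ₁)
    (W : ℝ → ℝ → ℝ) (θ : ℝ) : ContinuousAt (pressure τ₁ W θ) s := by
  have formula : ContinuousAt (fun s : ℝ × ℝ => (1 - s.2) / (1 / s.1 - s.2 * τ₁)) s := by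
    have : ContinuousAt (fun s : ℝ × ℝ => 1 / s.1) s :=
      continuousAt_const.div continuousAt_fst hs.1.ne'
    exact ContinuousAt.div (by fun_prop) (by fun_prop) (vol_sub_pos hτ hs).ne'
  refine formula.congr ?_
  filter_upwards [(isOpen_stateSpace τ₁).mem_nhds hs] with t ht
  exact (pressure_eq hτ ht W θ).symm

theorem continuousAt_Ghat (hp : 0 < p) :
    ContinuousAt (fun z : ℝ × ℝ => Ghat τ₁ z.1 z.2) (p, c) := by
  have : ContinuousAt (fun z : ℝ × ℝ => Real.log z.1) (p, c) :=
    ContinuousAt.log continuousAt_fst hp.ne'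
  unfold Ghat
  fun_prop

theorem continuousAt_specVol (hp : p ≠ 0) :
    ContinuousAt (fun z : ℝ × ℝ => specVol τ₁ z.1 z.2) (p, c) :=
  (by fun_prop : ContinuousAt (fun z : ℝ × ℝ => z.2 * τ₁) (p, c)).add
    (ContinuousAt.div (by fun_prop) (by fun_prop) hp)

theorem continuousAt_stateOf (hτ : 0 < τ₁) (hp : 0 < p) (hc : c ∈ Ioo (0 : ℝ) 1) :
    ContinuousAt (fun z : ℝ × ℝ => stateOf τ₁ z.1 z.2) (p, c) :=
  (continuousAt_const.div (continuousAt_specVol hp.ne') (specVol_pos hτ hp hc).ne').prodMk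
    continuousAt_snd

theorem stateOf_fst_lt_stateOf_fst {c' : ℝ} (hτ : 0 < τ₁) (hp : p ∈ Ioo 0 (1 / τ₁))
    (hc' : c' ∈ Ioo (0 : ℝ) 1) (h : c < c') : (stateOf τ₁ p c).1 < (stateOf τ₁ p c').1 := by
  refine one_div_lt_one_div_of_lt (specVol_pos hτ hp.1 hc') ?_
  have hp' : τ₁ < 1 / p := (lt_one_div hp.1 hτ).1 hp.2
  rw [specVol, specVol, div_eq_mul_one_div (1 - c'), div_eq_mul_one_div (1 - c)]
  nlinarith

end Continuity

/-! ### Heteroclinic orbits of scalar equations -/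

theorem exists_hasDerivAt_inv {a b : ℝ} (hab : a < b) {f : ℝ → ℝ} (hf : ContinuousOn f (Ioo a b))
    (hpos : ∀ c ∈ Ioo a b, 0 < f c) : ∃ X : ℝ → ℝ, ∀ c ∈ Ioo a b, HasDerivAt X (f c)⁻¹ c := by
  obtain ⟨m, hm⟩ := exists_between hab
  have hc : ContinuousOn (fun c => (f c)⁻¹) (Ioo a b) := hf.inv₀ fun c hc => (hpos c hc).ne'
  refine ⟨fun c => ∫ t in m..c, (f t)⁻¹, fun c hc' => ?_⟩
  exact intervalIntegral.integral_hasDerivAt_right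
    (hc.mono (ordConnected_Ioo.uIcc_subset hm hc')).intervalIntegrable
    (hc.stronglyMeasurableAtFilter isOpen_Ioo c hc') (hc.continuousAt (isOpen_Ioo.mem_nhds hc'))

theorem tendsto_nhdsLT_atTop_of_inv_le_deriv {a b K : ℝ} {X X' : ℝ → ℝ} (hab : a < b)
    (hK : 0 < K) (hX : ∀ c ∈ Ioo a b, HasDerivAt X (X' c) c)
    (hX' : ∀ c ∈ Ioo a b, (K * (b - c))⁻¹ ≤ X' c) : Tendsto X (𝓝[<] b) atTop := by
  have deriv : ∀ c ∈ Ioo a b, HasDerivAt (fun c => X c + K⁻¹ * Real.log (b - c))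
      (X' c + K⁻¹ * (-1 / (b - c))) c := fun c hc => (hX c hc).add
    ((((hasDerivAt_id' c).const_sub b).log (sub_pos.2 hc.2).ne').const_mul K⁻¹)
  have mono : MonotoneOn (fun c => X c + K⁻¹ * Real.log (b - c)) (Ioo a b) := by
    refine monotoneOn_of_hasDerivWithinAt_nonneg (convex_Ioo a b) (HasDerivAt.continuousOn deriv)
      (fun c hc => (deriv c (interior_subset hc)).hasDerivWithinAt) fun c hc => ?_
    have := hX' c (interior_subset hc)
    rw [mul_inv] at this
    rw [mul_div, mul_neg_one, neg_div, ← sub_eq_add_neg, sub_nonneg, div_eq_mul_inv]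
    exact this
  obtain ⟨m, hm⟩ := exists_between hab
  have sub_tendsto : Tendsto (fun c => b - c) (𝓝[<] b) (𝓝[>] 0) := tendsto_nhdsWithin_iff.2
    ⟨((by fun_prop : Continuous fun c : ℝ => b - c).tendsto' b 0 (sub_self b)).mono_left
      nhdsWithin_le_nhds, eventually_mem_nhdsWithin.mono fun c hc => mem_Ioi.2 (sub_pos.2 hc)⟩
  have log_tendsto : Tendsto (fun c => Real.log (b - c)) (𝓝[<] b) atBot :=
    Real.tendsto_log_nhdsGT_zero.comp sub_tendsto
  refine tendsto_atTop_mono' _ ?_ (tendsto_atTop_add_const_left _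
    (X m + K⁻¹ * Real.log (b - m))
    (tendsto_neg_atBot_atTop.comp (log_tendsto.const_mul_atBot (inv_pos.2 hK))))
  filter_upwards [Ioo_mem_nhdsLT hm.2] with c hc
  have := mono hm ⟨hm.1.trans hc.1, hc.2⟩ hc.1.le
  simp only [Function.comp_apply] at this ⊢
  linarith

theorem tendsto_nhdsGT_atBot_of_inv_le_deriv {a b K : ℝ} {X X' : ℝ → ℝ} (hab : a < b)
    (hK : 0 < K) (hX : ∀ c ∈ Ioo a b, HasDerivAt X (X' c) c)
    (hX' : ∀ c ∈ Ioo a b, (K * (c - a))⁻¹ ≤ X' c) : Tendsto X (𝓝[>] a) atBot := by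
  have mem : ∀ c ∈ Ioo (-b) (-a), -c ∈ Ioo a b := fun c hc => ⟨lt_neg.1 hc.2, neg_lt.1 hc.1⟩
  have reflected : Tendsto (fun c => -X (-c)) (𝓝[<] (-a)) atTop :=
    tendsto_nhdsLT_atTop_of_inv_le_deriv (X' := fun c => X' (-c)) (neg_lt_neg hab) hK
      (fun c hc => by
        simpa using! (HasDerivAt.scomp c (hX _ (mem c hc)) (hasDerivAt_neg c)).neg)
      fun c hc => by
        rw [show -a - c = -c - a by ring]
        exact hX' _ (mem c hc)
  have := tendsto_neg_atTop_atBot.comp (reflected.comp (tendsto_neg_nhdsGT (a := a)))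
  simpa [Function.comp_def] using this

/-- At an end point where the velocity `f` vanishes at least linearly the orbit spends an infinite
time, so that the time map is onto `ℝ`. -/
theorem exists_heteroclinic_orbit {a b K : ℝ} (hab : a < b) {f : ℝ → ℝ}
    (hf : ContinuousOn f (Ioo a b)) (hpos : ∀ c ∈ Ioo a b, 0 < f c)
    (hfa : ∀ c ∈ Ioo a b, f c ≤ K * (c - a)) (hfb : ∀ c ∈ Ioo a b, f c ≤ K * (b - c)) :
    ∃ C : ℝ → ℝ, (∀ x, C x ∈ Ioo a b) ∧ (∀ x, HasDerivAt C (f (C x)) x) ∧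
      Tendsto C atBot (𝓝 a) ∧ Tendsto C atTop (𝓝 b) := by
  obtain ⟨m, hm⟩ := exists_between hab
  have hK : 0 < K := pos_of_mul_pos_left ((hpos m hm).trans_le (hfa m hm)) (sub_nonneg.2 hm.1.le)
  obtain ⟨X, hX⟩ := exists_hasDerivAt_inv hab hf hpos
  have cont : ContinuousOn X (Ioo a b) := HasDerivAt.continuousOn hX
  have mono : StrictMonoOn X (Ioo a b) :=
    strictMonoOn_of_hasDerivWithinAt_pos (convex_Ioo a b) cont
      (fun c hc => (hX c (interior_subset hc)).hasDerivWithinAt)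
      fun c hc => inv_pos.2 (hpos c (interior_subset hc))
  have onto : SurjOn X (Ioo a b) univ :=
    cont.surjOn_of_tendsto ⟨m, hm⟩
      ((tendsto_comp_coe_Ioo_atBot hab).2 (tendsto_nhdsGT_atBot_of_inv_le_deriv hab hK hX
        fun c hc => inv_anti₀ (hpos c hc) (hfa c hc)))
      ((tendsto_comp_coe_Ioo_atTop hab).2 (tendsto_nhdsLT_atTop_of_inv_le_deriv hab hK hX
        fun c hc => inv_anti₀ (hpos c hc) (hfb c hc)))
  let e : Ioo a b ≃o ℝ := StrictMono.orderIsoOfSurjective (fun c : Ioo a b => X c)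
    (fun c d hcd => mono c.2 d.2 hcd) fun t =>
      let ⟨c, hc, hct⟩ := onto (mem_univ t); ⟨⟨c, hc⟩, hct⟩
  have X_symm : ∀ t, X (e.symm t) = t := e.apply_symm_apply
  refine ⟨fun t => e.symm t, fun t => (e.symm t).2, fun t => ?_,
    ((tendsto_Ioo_atBot).1 e.symm.tendsto_atBot).mono_right nhdsWithin_le_nhds,
    ((tendsto_Ioo_atTop).1 e.symm.tendsto_atTop).mono_right nhdsWithin_le_nhds⟩
  simpa using HasDerivAt.of_local_left_inverse (g := fun t => (e.symm t : ℝ))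
    (continuous_subtype_val.comp e.symm.continuous).continuousAt
    (hX _ (e.symm t).2) (inv_pos.2 (hpos _ (e.symm t).2)).ne' (Eventually.of_forall X_symm)

/-! ### Profiles -/

/-- The gap between the level of `Γ` at the saddles and its level at pressure `ϖ / r`, up to the
part depending on `W`. -/
def levelGap (τ₁ ϖ c r : ℝ) : ℝ :=
  (1 - c) * (Real.log r - (r - 1) / 2) + c * τ₁ * ϖ / 2 * (1 - 1 / r)

/-- The square of the velocity variable `y` of the level curve, if the pressure is `ϖ / r`. -/
def speedSq (τ₁ ϖ c r : ℝ) : ℝ := (r - 1) * (c * τ₁ * ϖ / r + (1 - c))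

section LevelGap

variable {τ₁ ϖ c r : ℝ}

theorem le_levelGap (hτ : 0 < τ₁) (hϖ : 0 < ϖ) (hc : c ∈ Ioo (0 : ℝ) 1) (hr : r ∈ Icc (1 : ℝ) 2) :
    c * τ₁ * ϖ / 4 * (r - 1) ≤ levelGap τ₁ ϖ c r := by
  have hr0 : 0 < r := one_pos.trans_le hr.1
  have hcτϖ : 0 < c * τ₁ * ϖ := mul_pos (mul_pos hc.1 hτ) hϖ
  have log_ge := Real.one_sub_inv_le_log_of_pos hr0
  have half_le : (r - 1) / 2 ≤ 1 - r⁻¹ := by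
    rw [show 1 - r⁻¹ = (r - 1) / r by field_simp]
    exact div_le_div_of_nonneg_left (sub_nonneg.2 hr.1) hr0 hr.2
  have log_part : 0 ≤ (1 - c) * (Real.log r - (r - 1) / 2) :=
    mul_nonneg (sub_nonneg.2 hc.2.le) (sub_nonneg.2 (half_le.trans log_ge))
  rw [levelGap, one_div]
  nlinarith

theorem hasDerivAt_levelGap (hr : 0 < r) :
    HasDerivAt (levelGap τ₁ ϖ c)
      ((1 - c) * (1 / r - 1 / 2) + c * τ₁ * ϖ / 2 * (1 / r ^ 2)) r := by
  have h := (((hasDerivAt_id' r).log hr.ne').sub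
    (((hasDerivAt_id' r).sub_const 1).div_const 2)).const_mul (1 - c) |>.add
      (((hasDerivAt_inv hr.ne').const_sub 1).const_mul (c * τ₁ * ϖ / 2))
  refine (h.congr_of_eventuallyEq (Eventually.of_forall fun t => ?_)).congr_deriv ?_
  · simp [levelGap]
  · simp

theorem deriv_levelGap_pos (hτ : 0 < τ₁) (hϖ : 0 < ϖ) (hc : c ∈ Ioo (0 : ℝ) 1)
    (hr : r ∈ Icc (1 : ℝ) 2) :
    0 < (1 - c) * (1 / r - 1 / 2) + c * τ₁ * ϖ / 2 * (1 / r ^ 2) := by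
  have hr0 : 0 < r := one_pos.trans_le hr.1
  have hcτϖ : 0 < c * τ₁ * ϖ := mul_pos (mul_pos hc.1 hτ) hϖ
  have log_part : 0 ≤ (1 - c) * (1 / r - 1 / 2) :=
    mul_nonneg (sub_nonneg.2 hc.2.le) (sub_nonneg.2 (one_div_le_one_div_of_le hr0 hr.2))
  positivity

theorem strictMonoOn_levelGap (hτ : 0 < τ₁) (hϖ : 0 < ϖ) (hc : c ∈ Ioo (0 : ℝ) 1) :
    StrictMonoOn (levelGap τ₁ ϖ c) (Icc 1 2) :=
  strictMonoOn_Icc_of_hasDerivAt_pos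
    (fun _ hr => hasDerivAt_levelGap (one_pos.trans_le hr.1))
    fun _ hr => deriv_levelGap_pos hτ hϖ hc (Ioo_subset_Icc_self hr)

theorem exists_levelGap_eq {v : ℝ} (hτ : 0 < τ₁) (hϖ : 0 < ϖ) (hc : c ∈ Ioo (0 : ℝ) 1)
    (hv : 0 < v) (hv' : v < c * τ₁ * ϖ / 4) : ∃ r ∈ Ioo (1 : ℝ) 2, levelGap τ₁ ϖ c r = v := by
  refine intermediate_value_Ioo one_le_two (fun r hr =>
    (hasDerivAt_levelGap (one_pos.trans_le hr.1)).continuousAt.continuousWithinAt) ⟨?_, ?_⟩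
  · simpa [levelGap] using hv
  · have := le_levelGap hτ hϖ hc (right_mem_Icc.2 one_le_two)
    linarith

theorem sub_one_le_of_levelGap_le {a k : ℝ} (hτ : 0 < τ₁) (hϖ : 0 < ϖ) (ha : 0 < a)
    (hc : c ∈ Ioo a 1) (hr : r ∈ Icc (1 : ℝ) 2) (h : levelGap τ₁ ϖ c r ≤ k) :
    r - 1 ≤ 4 / (a * τ₁ * ϖ) * k := by
  have le_gap := (le_levelGap hτ hϖ ⟨ha.trans hc.1, hc.2⟩ hr).trans h
  have coeff_le : a * τ₁ * ϖ / 4 * (r - 1) ≤ c * τ₁ * ϖ / 4 * (r - 1) := by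
    have := sub_nonneg.2 hr.1
    gcongr
    exact hc.1.le
  rw [div_mul_eq_mul_div, le_div_iff₀ (by positivity)]
  linarith

theorem Ghat_add_speedSq_half (hϖ : 0 < ϖ) (hr : 0 < r) :
    Ghat τ₁ (ϖ / r) c + speedSq τ₁ ϖ c r / 2 = Ghat τ₁ ϖ c - levelGap τ₁ ϖ c r := by
  rw [Ghat, Ghat, speedSq, levelGap, Real.log_div hϖ.ne' hr.ne']
  field_simp
  ring

theorem Ghat_sub_Ghat (τ₁ ϖ a c : ℝ) :
    Ghat τ₁ ϖ c - Ghat τ₁ ϖ a = -(affinity τ₁ ϖ * (c - a)) := by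
  rw [Ghat, Ghat, affinity]; ring

theorem div_add_speedSq_div_specVol (hτ : 0 < τ₁) (hϖ : 0 < ϖ) (hc : c ∈ Ioo (0 : ℝ) 1)
    (hr : 0 < r) : ϖ / r + speedSq τ₁ ϖ c r / specVol τ₁ (ϖ / r) c = ϖ := by
  have vol_pos := specVol_pos hτ (div_pos hϖ hr) hc
  have : speedSq τ₁ ϖ c r = (r - 1) * (ϖ / r) * specVol τ₁ (ϖ / r) c := by
    rw [speedSq, specVol]; field_simp
  rw [this, mul_div_cancel_right₀ _ vol_pos.ne']
  field_simp
  ring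

theorem speedSq_pos (hτ : 0 < τ₁) (hϖ : 0 < ϖ) (hc : c ∈ Ioo (0 : ℝ) 1) (hr : 1 < r) :
    0 < speedSq τ₁ ϖ c r := by
  have hr0 : 0 < r := one_pos.trans hr
  have hcτϖ : 0 < c * τ₁ * ϖ := mul_pos (mul_pos hc.1 hτ) hϖ
  exact mul_pos (sub_pos.2 hr) (add_pos (div_pos hcτϖ hr0) (sub_pos.2 hc.2))

theorem speedSq_le_sub_one (hτ : 0 < τ₁) (hϖ : ϖ ∈ Ioo 0 (1 / τ₁)) (hc : c ∈ Ioo (0 : ℝ) 1)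
    (hr : 1 ≤ r) : speedSq τ₁ ϖ c r ≤ r - 1 := by
  have hτϖ : ϖ * τ₁ < 1 := (lt_div_iff₀ hτ).1 hϖ.2
  have div_le : c * τ₁ * ϖ / r ≤ c * τ₁ * ϖ :=
    div_le_self (mul_pos (mul_pos hc.1 hτ) hϖ.1).le hr
  have factor_le : c * τ₁ * ϖ / r + (1 - c) ≤ 1 := by nlinarith [hc.1]
  exact mul_le_of_le_one_right (sub_nonneg.2 hr) factor_le

end LevelGap

theorem contDiffAt_of_implicit {F : ℝ × ℝ → ℝ} {ρ : ℝ → ℝ} {c k : ℝ} {S : Set ℝ}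
    (hF : ContDiffAt ℝ 1 F (c, ρ c)) (hk : HasDerivAt (fun r => F (c, r)) k (ρ c)) (hk0 : k ≠ 0)
    (hS : S ∈ 𝓝 (ρ c))
    (huniq : ∀ᶠ x in 𝓝 c, ∀ r ∈ S, F (x, r) = F (c, ρ c) → ρ x = r) : ContDiffAt ℝ 1 ρ c := by
  have hinv : (fderiv ℝ F (c, ρ c) ∘L .inr ℝ ℝ ℝ).IsInvertible := by
    refine ⟨ContinuousLinearEquiv.unitsEquivAut ℝ (Units.mk0 k hk0), ?_⟩
    have := (HasFDerivAt.comp_hasDerivAt (ρ c) (f := fun r : ℝ => ((c, r) : ℝ × ℝ))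
      (hF.differentiableAt (by norm_num)).hasFDerivAt
      ((hasDerivAt_const _ _).prodMk (hasDerivAt_id _))).unique hk
    ext
    simp [this]
  have implicit_smooth := hF.contDiffAt_implicitFunction (by norm_num) hinv
  have implicit_self := hF.implicitFunction_apply_self (by norm_num) hinv
  refine implicit_smooth.congr_of_eventuallyEq ?_
  filter_upwards [huniq, hF.eventually_apply_implicitFunction (by norm_num) hinv,
    implicit_smooth.continuousAt.eventually (by rwa [implicit_self])] with x hx hF' hS'
  exact hx _ hS' hF'

theorem exists_contDiffOn_levelGap_eq {τ₁ ϖ a b : ℝ} {v : ℝ → ℝ} (hτ : 0 < τ₁) (hϖ : 0 < ϖ)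
    (hsub : Ioo a b ⊆ Ioo 0 1) (hv : ContDiffOn ℝ 1 v (Ioo a b)) (hpos : ∀ c ∈ Ioo a b, 0 < v c)
    (hsmall : ∀ c ∈ Ioo a b, v c < c * τ₁ * ϖ / 4) :
    ∃ r : ℝ → ℝ, ContDiffOn ℝ 1 r (Ioo a b) ∧
      ∀ c ∈ Ioo a b, r c ∈ Ioo (1 : ℝ) 2 ∧ levelGap τ₁ ϖ c (r c) = v c := by
  choose! r hr gap_eq using fun c (hc : c ∈ Ioo a b) =>
    exists_levelGap_eq hτ hϖ (hsub hc) (hpos c hc) (hsmall c hc)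
  refine ⟨r, fun c hc => ContDiffAt.contDiffWithinAt ?_, fun c hc => ⟨hr c hc, gap_eq c hc⟩⟩
  have hrc : 0 < r c := one_pos.trans (hr c hc).1
  have smooth : ContDiffAt ℝ 1 (fun z : ℝ × ℝ => levelGap τ₁ ϖ z.1 z.2 - v z.1) (c, r c) := by
    have hv' : ContDiffAt ℝ 1 (fun z : ℝ × ℝ => v z.1) (c, r c) :=
      ContDiffAt.comp (g := v) (f := Prod.fst) (c, r c)
        (hv.contDiffAt (isOpen_Ioo.mem_nhds hc)) contDiffAt_fst
    refine ContDiffAt.sub ?_ hv'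
    unfold levelGap
    fun_prop (disch := exact hrc.ne')
  refine contDiffAt_of_implicit smooth ((hasDerivAt_levelGap hrc).sub_const (v c))
    (deriv_levelGap_pos hτ hϖ (hsub hc) (Ioo_subset_Icc_self (hr c hc))).ne'
    (isOpen_Ioo.mem_nhds (hr c hc)) ?_
  filter_upwards [isOpen_Ioo.mem_nhds hc] with x hx s hs e
  refine (strictMonoOn_levelGap hτ hϖ (hsub hx)).injOn (Ioo_subset_Icc_self (hr x hx))
    (Ioo_subset_Icc_self hs) ?_
  simp only [gap_eq c hc, sub_self, sub_eq_zero] at e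
  rw [gap_eq x hx, e]

/-- A profile with mass fraction `C` and pressure `p` on the level set of `Γ`, joining `a` to `b`
at total pressure `ϖ`, for the potential `w = W(·, θ)`. -/
structure IsProfile (τ₁ δ ϖ a b : ℝ) (w p C : ℝ → ℝ) : Prop where
  smooth_p : ContDiff ℝ 1 p
  smooth_C : ContDiff ℝ 2 C
  mem_p : ∀ x, p x ∈ Ioo 0 ϖ
  mem_C : ∀ x, C x ∈ Ioo a b
  deriv_pos : ∀ x, 0 < deriv C x
  balance : ∀ x, p x + δ * deriv C x ^ 2 / specVol τ₁ (p x) (C x) = ϖ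
  energy : ∀ x, Ghat τ₁ (p x) (C x) + w (C x) + δ * deriv C x ^ 2 / 2 = Ghat τ₁ ϖ a + w a
  C_bot : Tendsto C atBot (𝓝 a)
  C_top : Tendsto C atTop (𝓝 b)
  deriv_bot : Tendsto (deriv C) atBot (𝓝 0)
  deriv_top : Tendsto (deriv C) atTop (𝓝 0)

theorem IsBitangent.excess_le_sq {a b c : ℝ} {K : NNReal} {w f : ℝ → ℝ}
    (hw : ∀ c ∈ Icc a b, HasDerivAt w (f c) c) (hf : LipschitzOnWith K f (Icc a b))
    (h : IsBitangent w f a b) (hc : c ∈ Icc a b) :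
    w c - w a - f a * (c - a) ≤ K * (c - a) ^ 2 ∧
      w c - w a - f a * (c - a) ≤ K * (b - c) ^ 2 := by
  have hab : a ≤ b := hc.1.trans hc.2
  have left := sub_le_mul_sub_of_deriv_le (m := f a + K * (c - a)) hc.1
    (fun t ht => hw t ⟨ht.1, ht.2.trans hc.2⟩) fun t ht => by
      have hK : (K : ℝ) * (t - a) ≤ K * (c - a) := by gcongr; exact ht.2.le
      have := (le_abs_self _).trans
        (hf.dist_le_mul t ⟨ht.1.le, ht.2.le.trans hc.2⟩ a (left_mem_Icc.2 hab))
      rw [Real.dist_eq, abs_of_pos (sub_pos.2 ht.1)] at this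
      linarith
  have right := mul_sub_le_sub_of_le_deriv (m := f b - K * (b - c)) hc.2
    (fun t ht => hw t ⟨hc.1.trans ht.1, ht.2⟩) fun t ht => by
      have hK : (K : ℝ) * (b - t) ≤ K * (b - c) := by gcongr; exact ht.1.le
      have := (le_abs_self _).trans
        (hf.dist_le_mul b (right_mem_Icc.2 hab) t ⟨hc.1.trans ht.1.le, ht.2.le⟩)
      rw [Real.dist_eq, abs_of_pos (sub_pos.2 ht.2)] at this
      linarith
  have := h.sub_eq
  rw [← h.slope_eq] at right
  exact ⟨by linarith, by linarith⟩

theorem contDiff_two_of_hasDerivAt_comp {f C : ℝ → ℝ} {S : Set ℝ} (hf : ContDiffOn ℝ 1 f S)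
    (hmem : ∀ x, C x ∈ S) (hC : ∀ x, HasDerivAt C (f (C x)) x) : ContDiff ℝ 2 C := by
  have hderiv : deriv C = fun x => f (C x) := funext fun x => (hC x).deriv
  have cont : Continuous C := continuous_iff_continuousAt.2 fun x => (hC x).continuousAt
  have smooth : ContDiff ℝ 1 C := by
    rw [contDiff_one_iff_deriv, hderiv]
    exact ⟨fun x => (hC x).differentiableAt, hf.continuousOn.comp_continuous cont hmem⟩
  rw [show (2 : WithTop ℕ∞) = 1 + 1 by norm_num, contDiff_succ_iff_deriv, hderiv]
  exact ⟨fun x => (hC x).differentiableAt, by simp, hf.comp_contDiff smooth hmem⟩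

theorem contDiffOn_one_of_hasDerivAt {w f : ℝ → ℝ} {S : Set ℝ} (hS : IsOpen S)
    (hw : ∀ c ∈ S, HasDerivAt w (f c) c) (hf : ContinuousOn f S) : ContDiffOn ℝ 1 w S := by
  rw [show (1 : WithTop ℕ∞) = 0 + 1 by norm_num, contDiffOn_succ_iff_deriv_of_isOpen hS,
    contDiffOn_zero]
  exact ⟨fun c hc => (hw c hc).differentiableAt.differentiableWithinAt, by simp,
    hf.congr fun c hc => (hw c hc).deriv⟩

/-- The speed `C' = y / √δ` of the level curve, if the pressure is `ϖ / r`. -/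
def speed (τ₁ δ ϖ c r : ℝ) : ℝ := √(speedSq τ₁ ϖ c r) / √δ

theorem speed_pos {τ₁ δ ϖ c r : ℝ} (hτ : 0 < τ₁) (hδ : 0 < δ) (hϖ : 0 < ϖ)
    (hc : c ∈ Ioo (0 : ℝ) 1) (hr : 1 < r) : 0 < speed τ₁ δ ϖ c r :=
  div_pos (Real.sqrt_pos.2 (speedSq_pos hτ hϖ hc hr)) (Real.sqrt_pos.2 hδ)

theorem mul_speed_sq {τ₁ δ ϖ c r : ℝ} (hτ : 0 < τ₁) (hδ : 0 < δ) (hϖ : 0 < ϖ)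
    (hc : c ∈ Ioo (0 : ℝ) 1) (hr : 1 < r) : δ * speed τ₁ δ ϖ c r ^ 2 = speedSq τ₁ ϖ c r := by
  rw [speed, div_pow, Real.sq_sqrt (speedSq_pos hτ hϖ hc hr).le, Real.sq_sqrt hδ.le,
    mul_div_cancel₀ _ hδ.ne']

theorem speed_le {τ₁ δ ϖ c r M s : ℝ} (hτ : 0 < τ₁) (hϖ : ϖ ∈ Ioo 0 (1 / τ₁))
    (hc : c ∈ Ioo (0 : ℝ) 1) (hr : 1 ≤ r) (hs : 0 ≤ s) (h : r - 1 ≤ M * s ^ 2) :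
    speed τ₁ δ ϖ c r ≤ √M / √δ * s := by
  rw [speed, div_mul_eq_mul_div]
  gcongr
  calc √(speedSq τ₁ ϖ c r) ≤ √(M * s ^ 2) :=
        Real.sqrt_le_sqrt ((speedSq_le_sub_one hτ hϖ hc hr).trans h)
    _ = √M * s := by rw [Real.sqrt_mul' _ (sq_nonneg s), Real.sqrt_sq hs]

theorem contDiffOn_speed {τ₁ δ ϖ a b : ℝ} {r : ℝ → ℝ} (hτ : 0 < τ₁) (hϖ : 0 < ϖ)
    (hsub : Ioo a b ⊆ Ioo 0 1) (hr : ∀ c ∈ Ioo a b, 1 < r c)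
    (hrC : ContDiffOn ℝ 1 r (Ioo a b)) :
    ContDiffOn ℝ 1 (fun c => speed τ₁ δ ϖ c (r c)) (Ioo a b) := by
  have : ContDiffOn ℝ 1 (fun c => c * τ₁ * ϖ / r c) (Ioo a b) :=
    ContDiffOn.div (by fun_prop) hrC fun c hc => (one_pos.trans (hr c hc)).ne'
  have speedSq_smooth : ContDiffOn ℝ 1 (fun c => speedSq τ₁ ϖ c (r c)) (Ioo a b) := by
    unfold speedSq
    fun_prop
  exact (speedSq_smooth.sqrt fun c hc => (speedSq_pos hτ hϖ (hsub hc) (hr c hc)).ne').div_const _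

theorem isProfile_of_hasDerivAt_speed {τ₁ δ ϖ a b : ℝ} {w r C : ℝ → ℝ} (hτ : 0 < τ₁)
    (hδ : 0 < δ) (hϖ : 0 < ϖ) (hsub : Ioo a b ⊆ Ioo 0 1) (hrC : ContDiffOn ℝ 1 r (Ioo a b))
    (hr : ∀ c ∈ Ioo a b,
      1 < r c ∧ levelGap τ₁ ϖ c (r c) = w c - w a - affinity τ₁ ϖ * (c - a))
    (hmem : ∀ x, C x ∈ Ioo a b) (hC : ∀ x, HasDerivAt C (speed τ₁ δ ϖ (C x) (r (C x))) x)
    (hbot : Tendsto C atBot (𝓝 a)) (htop : Tendsto C atTop (𝓝 b))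
    (hbot' : Tendsto (fun x => speed τ₁ δ ϖ (C x) (r (C x))) atBot (𝓝 0))
    (htop' : Tendsto (fun x => speed τ₁ δ ϖ (C x) (r (C x))) atTop (𝓝 0)) :
    IsProfile τ₁ δ ϖ a b w (fun x => ϖ / r (C x)) C := by
  have frac_mem : ∀ x, C x ∈ Ioo (0 : ℝ) 1 := fun x => hsub (hmem x)
  have one_lt : ∀ x, 1 < r (C x) := fun x => (hr _ (hmem x)).1
  have r_pos : ∀ x, 0 < r (C x) := fun x => one_pos.trans (one_lt x)
  have hderiv : deriv C = fun x => speed τ₁ δ ϖ (C x) (r (C x)) := funext fun x => (hC x).deriv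
  have deriv_sq : ∀ x, δ * deriv C x ^ 2 = speedSq τ₁ ϖ (C x) (r (C x)) := fun x =>
    hderiv ▸ mul_speed_sq hτ hδ hϖ (frac_mem x) (one_lt x)
  have C_smooth := contDiff_two_of_hasDerivAt_comp
    (contDiffOn_speed hτ hϖ hsub (fun c hc => (hr c hc).1) hrC) hmem hC
  exact {
    smooth_p := contDiff_const.div (hrC.comp_contDiff (C_smooth.of_le one_le_two) hmem)
      fun x => (r_pos x).ne'
    smooth_C := C_smooth
    mem_p := fun x => ⟨div_pos hϖ (r_pos x), div_lt_self hϖ (one_lt x)⟩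
    mem_C := hmem
    deriv_pos := fun x => hderiv ▸ speed_pos hτ hδ hϖ (frac_mem x) (one_lt x)
    balance := fun x => deriv_sq x ▸ div_add_speedSq_div_specVol hτ hϖ (frac_mem x) (r_pos x)
    energy := fun x => by
      have level := Ghat_add_speedSq_half (τ₁ := τ₁) (c := C x) hϖ (r_pos x)
      have := Ghat_sub_Ghat τ₁ ϖ a (C x)
      rw [(hr _ (hmem x)).2] at level
      rw [deriv_sq]
      linarith
    C_bot := hbot
    C_top := htop
    deriv_bot := hderiv ▸ hbot'
    deriv_top := hderiv ▸ htop' }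

theorem exists_speed_le {τ₁ δ ϖ a b : ℝ} {K : NNReal} {w f r : ℝ → ℝ} (hτ : 0 < τ₁)
    (hϖ : ϖ ∈ Ioo 0 (1 / τ₁)) (hsub : Icc a b ⊆ Ioo 0 1)
    (hw : ∀ c ∈ Icc a b, HasDerivAt w (f c) c) (hf : LipschitzOnWith K f (Icc a b))
    (htan : IsBitangent w f a b)
    (hr : ∀ c ∈ Ioo a b, r c ∈ Ioo (1 : ℝ) 2 ∧
      levelGap τ₁ ϖ c (r c) = w c - w a - f a * (c - a)) :
    ∃ L : ℝ, ∀ c ∈ Ioo a b,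
      speed τ₁ δ ϖ c (r c) ≤ L * (c - a) ∧ speed τ₁ δ ϖ c (r c) ≤ L * (b - c) := by
  refine ⟨√(4 / (a * τ₁ * ϖ) * K) / √δ, fun c hc => ?_⟩
  have hab : a < b := hc.1.trans hc.2
  have hc' : c ∈ Ioo (0 : ℝ) 1 := hsub (Ioo_subset_Icc_self hc)
  have le_of_excess_le : ∀ s, 0 ≤ s → w c - w a - f a * (c - a) ≤ K * s ^ 2 →
      speed τ₁ δ ϖ c (r c) ≤ √(4 / (a * τ₁ * ϖ) * K) / √δ * s := fun s hs h => by
    refine speed_le hτ hϖ hc' (hr c hc).1.1.le hs ?_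
    rw [mul_assoc]
    exact sub_one_le_of_levelGap_le hτ hϖ.1 (hsub (left_mem_Icc.2 hab.le)).1 ⟨hc.1, hc'.2⟩
      (Ioo_subset_Icc_self (hr c hc).1) ((hr c hc).2.trans_le h)
  have excess_le := htan.excess_le_sq hw hf (Ioo_subset_Icc_self hc)
  exact ⟨le_of_excess_le _ (sub_pos.2 hc.1).le excess_le.1,
    le_of_excess_le _ (sub_pos.2 hc.2).le excess_le.2⟩

/- On the level of the saddles the pressure is determined by the mass fraction, and then so is the
speed; this speed vanishes linearly at `a` and `b`. -/
theorem exists_isProfile {τ₁ δ ϖ a b : ℝ} {K : NNReal} {w f : ℝ → ℝ} (hτ : 0 < τ₁) (hδ : 0 < δ)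
    (hϖ : ϖ ∈ Ioo 0 (1 / τ₁)) (hab : a < b) (hsub : Icc a b ⊆ Ioo 0 1)
    (hw : ∀ c ∈ Icc a b, HasDerivAt w (f c) c) (hf : LipschitzOnWith K f (Icc a b))
    (hslope : f a = affinity τ₁ ϖ) (htan : IsBitangent w f a b)
    (habove : ∀ c ∈ Ioo a b, 0 < w c - w a - f a * (c - a))
    (hsmall : ∀ c ∈ Ioo a b, w c - w a - f a * (c - a) < c * τ₁ * ϖ / 4) :
    ∃ p C : ℝ → ℝ, IsProfile τ₁ δ ϖ a b w p C := by
  have hsub' : Ioo a b ⊆ Ioo 0 1 := Ioo_subset_Icc_self.trans hsub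
  have smooth : ContDiffOn ℝ 1 w (Ioo a b) :=
    contDiffOn_one_of_hasDerivAt isOpen_Ioo (fun c hc => hw c (Ioo_subset_Icc_self hc))
      (hf.continuousOn.mono Ioo_subset_Icc_self)
  obtain ⟨r, r_smooth, hr⟩ := exists_contDiffOn_levelGap_eq hτ hϖ.1 hsub'
    (v := fun c => w c - w a - f a * (c - a)) (by fun_prop) habove hsmall
  have one_lt : ∀ c ∈ Ioo a b, 1 < r c := fun c hc => (hr c hc).1.1
  obtain ⟨L, hL⟩ := exists_speed_le (δ := δ) hτ hϖ hsub hw hf htan hr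
  have pos : ∀ c ∈ Ioo a b, 0 < speed τ₁ δ ϖ c (r c) := fun c hc =>
    speed_pos hτ hδ hϖ.1 (hsub' hc) (one_lt c hc)
  have speed_smooth := contDiffOn_speed (δ := δ) hτ hϖ.1 hsub' one_lt r_smooth
  obtain ⟨C, mem, hC, bot, top⟩ := exists_heteroclinic_orbit hab speed_smooth.continuousOn pos
    (fun c hc => (hL c hc).1) fun c hc => (hL c hc).2
  refine ⟨_, C, isProfile_of_hasDerivAt_speed hτ hδ hϖ.1 hsub' r_smooth
    (fun c hc => ⟨one_lt c hc, hslope ▸ (hr c hc).2⟩) mem hC bot top ?_ ?_⟩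
  · exact squeeze_zero (fun x => (pos _ (mem x)).le) (fun x => (hL _ (mem x)).1)
      (by simpa using (bot.sub_const a).const_mul L)
  · exact squeeze_zero (fun x => (pos _ (mem x)).le) (fun x => (hL _ (mem x)).2)
      (by simpa using (top.const_sub b).const_mul L)

/-! ### Planar stationary fields -/

section Planar

variable {d : ℕ} {e : EuclideanSpace ℝ (Fin d)} {τ₁ θ δ μ lam : ℝ} {W : ℝ → ℝ → ℝ}
  {R C : ℝ → ℝ}

/-- The system of ordinary differential equations to which the Navier-Stokes-Allen-Cahn system
reduces on stationary fields `ρ = R(e·x)`, `u = 0`, `c = C(e·x)`. -/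
structure IsStationaryProfile (τ₁ : ℝ) (W : ℝ → ℝ → ℝ) (θ δ : ℝ) (R C : ℝ → ℝ) : Prop where
  smooth_R : ContDiff ℝ 1 R
  smooth_C : ContDiff ℝ 2 C
  mem_states : ∀ s, (R s, C s) ∈ stateSpace τ₁
  momentum : ∀ s, deriv (fun s => pressure τ₁ W θ (R s, C s)) s
    + deriv (fun s => δ * R s * deriv C s ^ 2) s = 0
  phase : ∀ s, R s * rate τ₁ W θ (R s, C s) + deriv (fun s => δ * R s * deriv C s) s = 0

theorem pd_zero (i : Fin d) (x : EuclideanSpace ℝ (Fin d)) : pd i (fun _ => (0 : ℝ)) x = 0 := by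
  simp [pd]

theorem pd_planar {H : ℝ → ℝ} {x : EuclideanSpace ℝ (Fin d)}
    (hH : DifferentiableAt ℝ H (inner ℝ e x)) (i : Fin d) :
    pd i (fun z => H (inner ℝ e z)) x = e i * deriv H (inner ℝ e x) := by
  have comp := hH.hasDerivAt.comp_hasFDerivAt x (innerSL ℝ e).hasFDerivAt
  have fderiv_eq : fderiv ℝ (fun z => H (inner ℝ e z)) x =
      deriv H (inner ℝ e x) • innerSL ℝ e := comp.fderiv
  rw [pd, fderiv_eq]
  simp [EuclideanSpace.inner_single_right, mul_comm]

theorem sum_mul_self_eq_one (he : ‖e‖ = 1) : ∑ i, e i * e i = 1 := by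
  simpa [he, sq] using (EuclideanSpace.real_norm_sq_eq e).symm

theorem sum_pd_mul_planar {H : ℝ → ℝ} {x : EuclideanSpace ℝ (Fin d)} (he : ‖e‖ = 1)
    (hH : DifferentiableAt ℝ H (inner ℝ e x)) :
    ∑ i, pd i (fun z => e i * H (inner ℝ e z)) x = deriv H (inner ℝ e x) := by
  have term (i : Fin d) :
      pd i (fun z => e i * H (inner ℝ e z)) x = e i * e i * deriv H (inner ℝ e x) := by
    rw [pd_planar (H := fun s => e i * H s) (hH.const_mul _), deriv_const_mul _ hH, mul_assoc]
  rw [Finset.sum_congr rfl fun i _ => term i, ← Finset.sum_mul, sum_mul_self_eq_one he, one_mul]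

theorem sum_pd_pressure_planar {P : ℝ → ℝ} {x : EuclideanSpace ℝ (Fin d)}
    (hP : DifferentiableAt ℝ P (inner ℝ e x)) (R : ℝ → ℝ) (j : Fin d) :
    ∑ i, pd i (fun z => R (inner ℝ e z) * (0 : EuclideanSpace ℝ (Fin d)) i *
        (0 : EuclideanSpace ℝ (Fin d)) j + if i = j then P (inner ℝ e z) else 0) x
      = e j * deriv P (inner ℝ e x) := by
  rw [Finset.sum_eq_single j]
  · simp [pd_planar hP]
  · intro i _ hij
    simp [hij, pd_zero]
  · simp

theorem sum_pd_stress_planar (hR : Differentiable ℝ R) (hC : Differentiable ℝ C)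
    (hC' : Differentiable ℝ (deriv C)) (he : ‖e‖ = 1) (δ μ lam : ℝ)
    (x : EuclideanSpace ℝ (Fin d)) (j : Fin d) :
    ∑ i, pd i (fun z =>
        μ * (pd i (fun _ => (0 : EuclideanSpace ℝ (Fin d)) j) z
          + pd j (fun _ => (0 : EuclideanSpace ℝ (Fin d)) i) z)
        + (if i = j then lam * ∑ k, pd k (fun _ => (0 : EuclideanSpace ℝ (Fin d)) k) z else 0)
        - δ * R (inner ℝ e z) * (pd i (fun z => C (inner ℝ e z)) z
          * pd j (fun z => C (inner ℝ e z)) z)) x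
      = -(e j * deriv (fun s => δ * R s * deriv C s ^ 2) (inner ℝ e x)) := by
  have hH : Differentiable ℝ fun s => δ * R s * deriv C s ^ 2 := by fun_prop
  rw [neg_mul_eq_neg_mul, ← deriv_const_mul _ (hH _),
    ← sum_pd_mul_planar (H := fun s => -e j * (δ * R s * deriv C s ^ 2)) he
      ((hH _).const_mul _)]
  refine Finset.sum_congr rfl fun i _ => congrArg (pd i · x) (funext fun z => ?_)
  simp only [pd_planar (hC _), PiLp.zero_apply, pd_zero, add_zero, mul_zero,
    Finset.sum_const_zero, ite_self]
  ring

theorem sum_pd_diffusion_planar (hR : Differentiable ℝ R) (hC : Differentiable ℝ C)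
    (hC' : Differentiable ℝ (deriv C)) (he : ‖e‖ = 1) (δ : ℝ) (x : EuclideanSpace ℝ (Fin d)) :
    ∑ i, pd i (fun z => δ * R (inner ℝ e z) * pd i (fun z => C (inner ℝ e z)) z) x
      = deriv (fun s => δ * R s * deriv C s) (inner ℝ e x) := by
  have hH : Differentiable ℝ fun s => δ * R s * deriv C s := by fun_prop
  rw [← sum_pd_mul_planar he (hH _)]
  refine Finset.sum_congr rfl fun i _ => congrArg (pd i · x) (funext fun z => ?_)
  rw [pd_planar (hC _)]
  ring

theorem differentiable_pressure (hτ : 0 < τ₁) (hR : Differentiable ℝ R)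
    (hC : Differentiable ℝ C) (hmem : ∀ s, (R s, C s) ∈ stateSpace τ₁) (W : ℝ → ℝ → ℝ) (θ : ℝ) :
    Differentiable ℝ fun s => pressure τ₁ W θ (R s, C s) := by
  simp only [fun s => pressure_eq hτ (hmem s) W θ]
  have : Differentiable ℝ fun s => 1 / R s :=
    (differentiable_const _).fun_div hR fun s => (hmem s).1.ne'
  exact Differentiable.fun_div (by fun_prop) (by fun_prop) fun s => (vol_sub_pos hτ (hmem s)).ne'

theorem IsStationaryProfile.isSolution (h : IsStationaryProfile τ₁ W θ δ R C) (hτ : 0 < τ₁)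
    (he : ‖e‖ = 1) (μ lam : ℝ) :
    IsSolution τ₁ W θ d δ μ lam
      (fun _ x => R (inner ℝ e x)) (fun _ _ => 0) (fun _ x => C (inner ℝ e x)) := by
  have inner_smooth :
      ContDiff ℝ 2 (fun z : ℝ × EuclideanSpace ℝ (Fin d) => (inner ℝ e z.2 : ℝ)) :=
    (innerSL ℝ e).contDiff.comp contDiff_snd
  have hR : Differentiable ℝ R := h.smooth_R.differentiable (by norm_num)
  have hC : Differentiable ℝ C := h.smooth_C.differentiable (by norm_num)
  have hC' : Differentiable ℝ (deriv C) := h.smooth_C.differentiable_deriv_two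
  refine ⟨h.smooth_R.comp (inner_smooth.of_le (by norm_num)), contDiff_const,
    h.smooth_C.comp inner_smooth, fun _ x => h.mem_states _, fun t x => ?mass,
    fun t x j => ?momentum, fun t x => ?phase⟩
  case mass => simp [pd_zero]
  case momentum =>
    have flux := sum_pd_pressure_planar
      (differentiable_pressure hτ hR hC h.mem_states W θ (inner ℝ e x)) R j
    refine (congrArg _ flux).trans
      (Eq.trans ?_ (sum_pd_stress_planar hR hC hC' he δ μ lam x j).symm)
    simp only [PiLp.zero_apply, mul_zero, deriv_const, zero_add]
    linear_combination e j * h.momentum (inner ℝ e x)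
  case phase =>
    rw [sum_pd_diffusion_planar hR hC hC' he, h.phase]
    simp [pd_zero]

theorem isStationaryProfile_of_isSolution (hτ : 0 < τ₁) (hδ : 0 < δ) (he : ‖e‖ = 1)
    (h : IsSolution τ₁ W θ d δ μ lam
      (fun _ x => R (inner ℝ e x)) (fun _ _ => 0) (fun _ x => C (inner ℝ e x))) :
    IsStationaryProfile τ₁ W θ δ R C := by
  have inner_smul_self (s : ℝ) : inner ℝ e (s • e) = s := by
    rw [inner_smul_right, real_inner_self_eq_norm_sq, he, one_pow, mul_one]
  have line_smooth : ContDiff ℝ 2 (fun s : ℝ => ((0 : ℝ), s • e)) := by fun_prop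
  have smooth_R : ContDiff ℝ 1 R := by
    simpa only [Function.comp_def, inner_smul_self] using
      h.smooth_ρ.comp (line_smooth.of_le (by norm_num))
  have smooth_C : ContDiff ℝ 2 C := by
    simpa only [Function.comp_def, inner_smul_self] using h.smooth_c.comp line_smooth
  have mem (s : ℝ) : (R s, C s) ∈ stateSpace τ₁ := by
    simpa only [inner_smul_self] using h.mem_states 0 (s • e)
  have hR : Differentiable ℝ R := smooth_R.differentiable (by norm_num)
  have hC : Differentiable ℝ C := smooth_C.differentiable (by norm_num)
  have hC' : Differentiable ℝ (deriv C) := smooth_C.differentiable_deriv_two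
  refine ⟨smooth_R, smooth_C, mem, fun s => ?momentum, fun s => ?phase⟩
  case momentum =>
    obtain ⟨j, hj⟩ : ∃ j, e j ≠ 0 := by
      by_contra! all_zero
      simpa [all_zero] using sum_mul_self_eq_one he
    have flux := sum_pd_pressure_planar
      (differentiable_pressure hτ hR hC mem W θ (inner ℝ e (s • e))) R j
    have balance := (congrArg _ flux).symm.trans
      ((h.momentum 0 (s • e) j).trans (sum_pd_stress_planar hR hC hC' he δ μ lam _ j))
    simp only [PiLp.zero_apply, mul_zero, deriv_const, zero_add, inner_smul_self] at balance
    refine (mul_eq_zero.1 (?_ : e j * _ = 0)).resolve_left hj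
    linear_combination balance
  case phase =>
    have balance := h.phase 0 (s • e)
    rw [sum_pd_diffusion_planar hR hC hC' he, inner_smul_self] at balance
    simp only [PiLp.zero_apply, mul_zero, deriv_const, pd_zero, Finset.sum_const_zero,
      add_zero] at balance
    exact (mul_eq_zero.1 balance.symm).resolve_left (inv_ne_zero (Real.sqrt_pos.2 hδ).ne')

end Planar

/-! ### The energy of a stationary profile -/

theorem hasDerivAt_energy {τ₁ δ x P' R' D' w' : ℝ} {P R C w : ℝ → ℝ} (hP : HasDerivAt P P' x)
    (hR : HasDerivAt R R' x) (hC : DifferentiableAt ℝ C x) (hD : HasDerivAt (deriv C) D' x)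
    (hw : HasDerivAt w w' (C x)) (hP_pos : 0 < P x) (hR_pos : 0 < R x)
    (hvol : 1 / R x = specVol τ₁ (P x) (C x))
    (hbal : P' + deriv (fun s => δ * R s * deriv C s ^ 2) x = 0) :
    HasDerivAt (fun s => Ghat τ₁ (P s) (C s) + w (C s) + δ * deriv C s ^ 2 / 2)
      (-(deriv C x / R x) * (R x * (affinity τ₁ (P x) - w')
        + deriv (fun s => δ * R s * deriv C s) x)) x := by
  have stress : deriv (fun s => δ * R s * deriv C s ^ 2) x = _ :=
    ((hR.const_mul δ).mul (hD.pow 2)).deriv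
  have diffusion : deriv (fun s => δ * R s * deriv C s) x = _ := ((hR.const_mul δ).mul hD).deriv
  rw [stress] at hbal
  rw [diffusion]
  refine (((hasDerivAt_Ghat (τ₁ := τ₁) hP hC.hasDerivAt hP_pos).add
    (hw.comp x hC.hasDerivAt)).add (((hD.pow 2).const_mul δ).div_const 2)).congr_deriv ?_
  rw [← hvol]
  simp only [Nat.cast_ofNat, Nat.add_one_sub_one, pow_one, Pi.pow_apply] at hbal ⊢
  field_simp at hbal ⊢
  linear_combination hbal

theorem eq_zero_of_tendsto_deriv_sq {C : ℝ → ℝ} (hC : Differentiable ℝ C) {c L : ℝ}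
    (h : Tendsto C atTop (𝓝 c)) (hL : Tendsto (fun x => deriv C x ^ 2) atTop (𝓝 L)) : L = 0 := by
  choose t ht increment using fun n : ℕ =>
    exists_sub_eq_deriv_mul_sub (lt_add_one (n : ℝ)) fun s _ => (hC s).hasDerivAt
  have cast_top : Tendsto (fun n : ℕ => (n : ℝ)) atTop atTop := tendsto_natCast_atTop_atTop
  have t_top : Tendsto t atTop atTop := tendsto_atTop_mono (fun n => (ht n).1.le) cast_top
  have increment_lim : Tendsto (fun n : ℕ => C (n + 1) - C n) atTop (𝓝 (c - c)) :=
    (h.comp (tendsto_atTop_add_const_right _ 1 cast_top)).sub (h.comp cast_top)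
  have deriv_lim : Tendsto (fun n => deriv C (t n) ^ 2) atTop (𝓝 ((c - c) ^ 2)) :=
    (increment_lim.pow 2).congr fun n => by rw [increment n]; ring
  simpa using tendsto_nhds_unique (hL.comp t_top) deriv_lim

theorem eq_zero_of_tendsto_deriv_sq_atBot {C : ℝ → ℝ} (hC : Differentiable ℝ C) {c L : ℝ}
    (h : Tendsto C atBot (𝓝 c)) (hL : Tendsto (fun x => deriv C x ^ 2) atBot (𝓝 L)) : L = 0 := by
  refine eq_zero_of_tendsto_deriv_sq (C := fun x => C (-x)) (hC.comp differentiable_neg)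
    (h.comp tendsto_neg_atTop_atBot) ?_
  simp only [deriv_comp_neg, neg_sq]
  exact hL.comp tendsto_neg_atTop_atBot

namespace IsStationaryProfile

variable {τ₁ θ δ : ℝ} {W : ℝ → ℝ → ℝ} {R C w : ℝ → ℝ}

theorem differentiable_C (h : IsStationaryProfile τ₁ W θ δ R C) : Differentiable ℝ C :=
  h.smooth_C.differentiable (by norm_num)

theorem exists_total_pressure_eq (h : IsStationaryProfile τ₁ W θ δ R C) (hτ : 0 < τ₁) :
    ∃ k, ∀ s, pressure τ₁ W θ (R s, C s) + δ * R s * deriv C s ^ 2 = k := by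
  have hR : Differentiable ℝ R := h.smooth_R.differentiable (by norm_num)
  have hC' : Differentiable ℝ (deriv C) := h.smooth_C.differentiable_deriv_two
  have hP := differentiable_pressure hτ hR h.differentiable_C h.mem_states W θ
  have hstress : Differentiable ℝ fun s => δ * R s * deriv C s ^ 2 := by fun_prop
  exact ⟨_, fun s => is_const_of_deriv_eq_zero (hP.add hstress) (fun s => by
    rw [deriv_add (hP s) (hstress s)]; exact h.momentum s) s 0⟩

theorem exists_energy_eq (h : IsStationaryProfile τ₁ W θ δ R C) (hτ : 0 < τ₁)
    (hw : ∀ c ∈ Ioo (0 : ℝ) 1, HasDerivAt (fun c => W c θ) (w c) c) :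
    ∃ E, ∀ s, Ghat τ₁ (pressure τ₁ W θ (R s, C s)) (C s) + W (C s) θ
      + δ * deriv C s ^ 2 / 2 = E := by
  have hR : Differentiable ℝ R := h.smooth_R.differentiable (by norm_num)
  have hC' : Differentiable ℝ (deriv C) := h.smooth_C.differentiable_deriv_two
  have hP := differentiable_pressure hτ hR h.differentiable_C h.mem_states W θ
  have hE (s : ℝ) : HasDerivAt (fun s => Ghat τ₁ (pressure τ₁ W θ (R s, C s)) (C s) + W (C s) θ
      + δ * deriv C s ^ 2 / 2) 0 s := by
    have hmem := h.mem_states s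
    have hw_s := hw _ hmem.2.2
    have phase := h.phase s
    rw [rate_eq hτ hmem hw_s] at phase
    refine (hasDerivAt_energy (w := fun c => W c θ) (hP s).hasDerivAt (hR s).hasDerivAt
      (h.differentiable_C s) (hC' s).hasDerivAt hw_s (pressure_mem_Ioo hτ hmem W θ).1 hmem.1
      (one_div_eq_specVol hτ hmem W θ) (h.momentum s)).congr_deriv ?_
    rw [phase, mul_zero]
  exact ⟨_, fun s =>
    is_const_of_deriv_eq_zero (fun s => (hE s).differentiableAt) (fun s => (hE s).deriv) s 0⟩

/-- As `C` converges, so do the pressure and hence `C' ^ 2`; its limit must then be `0`. -/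
theorem tendsto_energy (h : IsStationaryProfile τ₁ W θ δ R C) {l : Filter ℝ} {a : ℝ × ℝ}
    (hδ : 0 < δ) (hτ : 0 < τ₁) (ha : a ∈ stateSpace τ₁)
    (hlim : Tendsto (fun s => (R s, C s)) l (𝓝 a)) (hW : ContinuousAt (fun c => W c θ) a.2)
    (hzero : ∀ L, Tendsto (fun x => deriv C x ^ 2) l (𝓝 L) → L = 0) :
    Tendsto (fun s => Ghat τ₁ (pressure τ₁ W θ (R s, C s)) (C s) + W (C s) θ
        + δ * deriv C s ^ 2 / 2) l (𝓝 (Ghat τ₁ (pressure τ₁ W θ a) a.2 + W a.2 θ)) := by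
  obtain ⟨k, total_eq⟩ := h.exists_total_pressure_eq hτ
  have hR : Tendsto R l (𝓝 a.1) := (continuous_fst.tendsto a).comp hlim
  have hC : Tendsto C l (𝓝 a.2) := (continuous_snd.tendsto a).comp hlim
  have hP : Tendsto (fun s => pressure τ₁ W θ (R s, C s)) l (𝓝 (pressure τ₁ W θ a)) :=
    (continuousAt_pressure hτ ha W θ).tendsto.comp hlim
  have hC' : Tendsto (fun x => deriv C x ^ 2) l
      (𝓝 ((k - pressure τ₁ W θ a) / (δ * a.1))) := by
    refine ((hP.const_sub k).div (hR.const_mul δ) (mul_pos hδ ha.1).ne').congr fun s => ?_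
    rw [Pi.div_apply, ← total_eq s, add_sub_cancel_left,
      mul_div_cancel_left₀ _ (mul_pos hδ (h.mem_states s).1).ne']
  rw [hzero _ hC'] at hC'
  have hG := (continuousAt_Ghat (τ₁ := τ₁) (c := a.2)
    (pressure_mem_Ioo hτ ha W θ).1).tendsto.comp (hP.prodMk_nhds hC)
  simpa using (hG.add (hW.tendsto.comp hC)).add ((hC'.const_mul δ).div_const 2)

end IsStationaryProfile

theorem IsNoFluxPhaseBoundary.level_eq {τ₁ θ δ μ lam : ℝ} {W : ℝ → ℝ → ℝ} {d : ℕ}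
    {e : EuclideanSpace ℝ (Fin d)} {R C w : ℝ → ℝ} {a b : ℝ × ℝ}
    (h : IsNoFluxPhaseBoundary τ₁ W θ d δ μ lam e R C a b) (hδ : 0 < δ) (hτ : 0 < τ₁)
    (he : ‖e‖ = 1) (hw : ∀ c ∈ Ioo (0 : ℝ) 1, HasDerivAt (fun c => W c θ) (w c) c)
    (ha : a ∈ stateSpace τ₁) (hb : b ∈ stateSpace τ₁) :
    Ghat τ₁ (pressure τ₁ W θ a) a.2 + W a.2 θ = Ghat τ₁ (pressure τ₁ W θ b) b.2 + W b.2 θ := by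
  have hs := isStationaryProfile_of_isSolution hτ hδ he h.solution
  obtain ⟨E, energy_eq⟩ := hs.exists_energy_eq hτ hw
  have left := hs.tendsto_energy hδ hτ ha h.left_end (hw _ ha.2.2).continuousAt fun L hL =>
    eq_zero_of_tendsto_deriv_sq_atBot hs.differentiable_C
      ((continuous_snd.tendsto a).comp h.left_end) hL
  have right := hs.tendsto_energy hδ hτ hb h.right_end (hw _ hb.2.2).continuousAt fun L hL =>
    eq_zero_of_tendsto_deriv_sq hs.differentiable_C
      ((continuous_snd.tendsto b).comp h.right_end) hL
  simp only [energy_eq] at left right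
  exact (tendsto_nhds_unique left tendsto_const_nhds).trans
    (tendsto_nhds_unique tendsto_const_nhds right)

/-! ### Phase boundaries from profiles -/

namespace IsProfile

variable {τ₁ δ ϖ θ a b : ℝ} {W : ℝ → ℝ → ℝ} {p C w : ℝ → ℝ}

theorem lt (h : IsProfile τ₁ δ ϖ a b w p C) : a < b := (h.mem_C 0).1.trans (h.mem_C 0).2

theorem tendsto_pressure (h : IsProfile τ₁ δ ϖ a b w p C) (hτ : 0 < τ₁) (hδ : 0 < δ)
    (hsub : Icc a b ⊆ Ioo 0 1) {l : Filter ℝ} (hC' : Tendsto (deriv C) l (𝓝 0)) :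
    Tendsto p l (𝓝 ϖ) := by
  have ha : 0 < a := (hsub (left_mem_Icc.2 h.lt.le)).1
  have lower : Tendsto (fun x => ϖ - δ * deriv C x ^ 2 / (a * τ₁)) l (𝓝 ϖ) := by
    simpa using (((hC'.pow 2).const_mul δ).div_const (a * τ₁)).const_sub ϖ
  refine tendsto_of_tendsto_of_tendsto_of_le_of_le lower tendsto_const_nhds (fun x => ?_)
    fun x => (h.mem_p x).2.le
  have vol_le : a * τ₁ ≤ specVol τ₁ (p x) (C x) := by
    have hC := hsub (Ioo_subset_Icc_self (h.mem_C x))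
    have := div_nonneg (sub_nonneg.2 hC.2.le) (h.mem_p x).1.le
    have := mul_le_mul_of_nonneg_right (h.mem_C x).1.le hτ.le
    rw [specVol]
    linarith
  have := div_le_div_of_nonneg_left (by positivity : 0 ≤ δ * deriv C x ^ 2) (mul_pos ha hτ) vol_le
  linarith [h.balance x]

theorem tendsto_stateOf (h : IsProfile τ₁ δ ϖ a b w p C) (hτ : 0 < τ₁) (hδ : 0 < δ)
    (hϖ : 0 < ϖ) (hsub : Icc a b ⊆ Ioo 0 1) {l : Filter ℝ} {c : ℝ} (hc : c ∈ Icc a b)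
    (hC : Tendsto C l (𝓝 c)) (hC' : Tendsto (deriv C) l (𝓝 0)) :
    Tendsto (fun x => stateOf τ₁ (p x) (C x)) l (𝓝 (stateOf τ₁ ϖ c)) :=
  (continuousAt_stateOf hτ hϖ (hsub hc)).tendsto.comp
    ((h.tendsto_pressure hτ hδ hsub hC').prodMk_nhds hC)

theorem proot_eq (h : IsProfile τ₁ δ ϖ a b w p C) (hτ : 0 < τ₁) (hδ : 0 < δ)
    (hϖ : 0 < ϖ) (hsub : Icc a b ⊆ Ioo 0 1) (x : ℝ) :
    p x = proot τ₁ ϖ (C x) (√δ * deriv C x) := by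
  have hc := hsub (Ioo_subset_Icc_self (h.mem_C x))
  have hp := (h.mem_p x).1
  refine ((proot_spec hτ hϖ hc.1 hc.2 _).2 _ hp).1 ?_
  have vol_eq : C x * τ₁ * p x + (1 - C x) = p x * specVol τ₁ (p x) (C x) := by
    rw [specVol]
    field_simp
  have kinetic_eq : δ * deriv C x ^ 2 = (ϖ - p x) * specVol τ₁ (p x) (C x) := by
    rw [← div_eq_iff (specVol_pos hτ hp hc).ne']
    linarith [h.balance x]
  rw [mul_pow, Real.sq_sqrt hδ.le, vol_eq, kinetic_eq]
  ring

theorem Gam_eq (h : IsProfile τ₁ δ ϖ a b (W · θ) p C) (hτ : 0 < τ₁) (hδ : 0 < δ)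
    (hϖ : 0 < ϖ) (hsub : Icc a b ⊆ Ioo 0 1) (x : ℝ) :
    Gam τ₁ W θ ϖ (C x, √δ * deriv C x) = Ghat τ₁ ϖ a + W a θ := by
  rw [Gam, ← h.proot_eq hτ hδ hϖ hsub x, ← h.energy x, mul_pow, Real.sq_sqrt hδ.le]
  ring

theorem level_right (h : IsProfile τ₁ δ ϖ a b w p C) (hτ : 0 < τ₁) (hδ : 0 < δ) (hϖ : 0 < ϖ)
    (hsub : Icc a b ⊆ Ioo 0 1) (hw : ContinuousAt w b) :
    Ghat τ₁ ϖ b + w b = Ghat τ₁ ϖ a + w a := by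
  have hp := h.tendsto_pressure hτ hδ hsub h.deriv_top
  have limit := (((continuousAt_Ghat (τ₁ := τ₁) (c := b) hϖ).tendsto.comp
    (hp.prodMk_nhds h.C_top)).add (hw.tendsto.comp h.C_top)).add
      (((h.deriv_top.pow 2).const_mul δ).div_const 2)
  simpa using tendsto_nhds_unique limit (tendsto_const_nhds.congr fun x => (h.energy x).symm)

theorem joinsInLevelSet (h : IsProfile τ₁ δ ϖ a b (W · θ) p C) (hτ : 0 < τ₁) (hδ : 0 < δ)
    (hϖ : 0 < ϖ) (hsub : Icc a b ⊆ Ioo 0 1) :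
    JoinsInLevelSet (Gam τ₁ W θ ϖ) (fun x => (C x, √δ * deriv C x)) (a, 0) (b, 0) := by
  refine ⟨fun x => ?_, h.C_bot.prodMk_nhds ?_, h.C_top.prodMk_nhds ?_⟩
  · rw [h.Gam_eq hτ hδ hϖ hsub, Gam_zero hτ hϖ (hsub (left_mem_Icc.2 h.lt.le))]
  · simpa using h.deriv_bot.const_mul √δ
  · simpa using h.deriv_top.const_mul √δ

theorem joinsInLevelSet_reflected (h : IsProfile τ₁ δ ϖ a b (W · θ) p C) (hτ : 0 < τ₁)
    (hδ : 0 < δ) (hϖ : 0 < ϖ) (hsub : Icc a b ⊆ Ioo 0 1)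
    (hW : ContinuousAt (fun c => W c θ) b) :
    JoinsInLevelSet (Gam τ₁ W θ ϖ) (fun x => (C (-x), √δ * deriv (fun s => C (-s)) x))
      (b, 0) (a, 0) := by
  simp only [deriv_comp_neg]
  have deriv_lim {l l' : Filter ℝ} (hneg : Tendsto Neg.neg l l')
      (hC' : Tendsto (deriv C) l' (𝓝 0)) :
      Tendsto (fun x => √δ * -deriv C (-x)) l (𝓝 0) := by
    simpa using ((hC'.comp hneg).neg.const_mul √δ)
  refine ⟨fun x => ?_,
    (h.C_top.comp tendsto_neg_atBot_atTop).prodMk_nhds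
      (deriv_lim tendsto_neg_atBot_atTop h.deriv_top),
    (h.C_bot.comp tendsto_neg_atTop_atBot).prodMk_nhds
      (deriv_lim tendsto_neg_atTop_atBot h.deriv_bot)⟩
  rw [Gam_zero hτ hϖ (hsub (right_mem_Icc.2 h.lt.le)),
    h.level_right (w := (W · θ)) hτ hδ hϖ hsub hW, ← h.Gam_eq hτ hδ hϖ hsub (-x)]
  simp only [Gam, proot, mul_neg, neg_sq]

theorem contDiff_density (h : IsProfile τ₁ δ ϖ a b w p C) (hτ : 0 < τ₁)
    (hsub : Icc a b ⊆ Ioo 0 1) : ContDiff ℝ 1 fun x => (stateOf τ₁ (p x) (C x)).1 := by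
  have hC : ContDiff ℝ 1 C := h.smooth_C.of_le (by norm_num)
  have : ContDiff ℝ 1 fun x => (1 - C x) / p x :=
    ContDiff.div (by fun_prop) h.smooth_p fun x => (h.mem_p x).1.ne'
  refine contDiff_const.div ?_ fun x =>
    (specVol_pos hτ (h.mem_p x).1 (hsub (Ioo_subset_Icc_self (h.mem_C x)))).ne'
  unfold specVol
  fun_prop

theorem isStationaryProfile (h : IsProfile τ₁ δ ϖ a b (W · θ) p C) (hτ : 0 < τ₁)
    (hϖ : ϖ < 1 / τ₁) (hsub : Icc a b ⊆ Ioo 0 1) {f : ℝ → ℝ}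
    (hw : ∀ c ∈ Ioo (0 : ℝ) 1, HasDerivAt (fun c => W c θ) (f c) c) :
    IsStationaryProfile τ₁ W θ δ (fun x => (stateOf τ₁ (p x) (C x)).1) C := by
  set R : ℝ → ℝ := fun x => (stateOf τ₁ (p x) (C x)).1
  have hC_mem (x) : C x ∈ Ioo (0 : ℝ) 1 := hsub (Ioo_subset_Icc_self (h.mem_C x))
  have hp_mem (x) : p x ∈ Ioo 0 (1 / τ₁) := ⟨(h.mem_p x).1, (h.mem_p x).2.trans hϖ⟩
  have hR : Differentiable ℝ R := (h.contDiff_density hτ hsub).differentiable (by norm_num)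
  have hp : Differentiable ℝ p := h.smooth_p.differentiable (by norm_num)
  have hC : Differentiable ℝ C := h.smooth_C.differentiable (by norm_num)
  have hC' : Differentiable ℝ (deriv C) := h.smooth_C.differentiable_deriv_two
  have mem (x) : (R x, C x) ∈ stateSpace τ₁ := stateOf_mem_stateSpace hτ (hp_mem x) (hC_mem x)
  have pressure_eq (x) : pressure τ₁ W θ (R x, C x) = p x :=
    pressure_stateOf hτ (hp_mem x) (hC_mem x) W θ
  have momentum (s) : deriv p s + deriv (fun s => δ * R s * deriv C s ^ 2) s = 0 := by
    have balance (x) : p x + δ * R x * deriv C x ^ 2 = ϖ := by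
      rw [← h.balance x]
      simp only [R, stateOf]
      ring
    have hstress : Differentiable ℝ fun s => δ * R s * deriv C s ^ 2 := by fun_prop
    rw [← deriv_fun_add (hp s) (hstress s), funext balance, deriv_const]
  refine ⟨h.contDiff_density hτ hsub, h.smooth_C, mem, fun s => ?_, fun s => ?_⟩
  · simpa only [pressure_eq] using momentum s
  · have denergy := hasDerivAt_energy (τ₁ := τ₁) (hp s).hasDerivAt (hR s).hasDerivAt (hC s)
      (hC' s).hasDerivAt (hw _ (hC_mem s)) (hp_mem s).1 (mem s).1 (one_div_one_div _) (momentum s)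
    rw [funext h.energy] at denergy
    rw [rate_eq hτ (mem s) (hw _ (hC_mem s)), pressure_eq]
    exact (mul_eq_zero.1 (denergy.unique (hasDerivAt_const s _))).resolve_left
      (neg_ne_zero.2 (div_pos (h.deriv_pos s) (mem s).1).ne')

theorem isNoFluxPhaseBoundary (h : IsProfile τ₁ δ ϖ a b (W · θ) p C) (hτ : 0 < τ₁)
    (hδ : 0 < δ) (hϖ : ϖ ∈ Ioo 0 (1 / τ₁)) (hsub : Icc a b ⊆ Ioo 0 1) {f : ℝ → ℝ}
    (hw : ∀ c ∈ Ioo (0 : ℝ) 1, HasDerivAt (fun c => W c θ) (f c) c) {d : ℕ}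
    {e : EuclideanSpace ℝ (Fin d)} (he : ‖e‖ = 1) (μ lam : ℝ) :
    IsNoFluxPhaseBoundary τ₁ W θ d δ μ lam e (fun x => (stateOf τ₁ (p x) (C x)).1) C
        (stateOf τ₁ ϖ a) (stateOf τ₁ ϖ b) ∧
      IsNoFluxPhaseBoundary τ₁ W θ d δ μ lam e (fun x => (stateOf τ₁ (p (-x)) (C (-x))).1)
        (fun x => C (-x)) (stateOf τ₁ ϖ b) (stateOf τ₁ ϖ a) := by
  have hs := h.isStationaryProfile hτ hϖ.2 hsub hw
  have bot := h.tendsto_stateOf hτ hδ hϖ.1 hsub (left_mem_Icc.2 h.lt.le) h.C_bot h.deriv_bot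
  have top := h.tendsto_stateOf hτ hδ hϖ.1 hsub (right_mem_Icc.2 h.lt.le) h.C_top h.deriv_top
  refine ⟨⟨hs.isSolution hτ he μ lam, bot, top⟩,
    ⟨?_, top.comp tendsto_neg_atBot_atTop, bot.comp tendsto_neg_atTop_atBot⟩⟩
  simpa only [inner_neg_left] using hs.isSolution (e := -e) hτ (by rwa [norm_neg]) μ lam

end IsProfile

/-! ### Maxwell states -/

theorem sub_sub_lt_of_deriv_mem_Ioo {w f : ℝ → ℝ} {a c m₀ m₁ : ℝ} (hac : a < c)
    (hw : ∀ t ∈ Icc a c, HasDerivAt w (f t) t) (hf : ∀ t ∈ Icc a c, f t ∈ Ioo m₀ m₁) :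
    w c - w a - f a * (c - a) < (m₁ - m₀) * (c - a) := by
  obtain ⟨t, ht, h⟩ := exists_sub_eq_deriv_mul_sub hac hw
  have hslope : f t - f a < m₁ - m₀ :=
    sub_lt_sub (hf t (Ioo_subset_Icc_self ht)).2 (hf a (left_mem_Icc.2 hac.le)).1
  rw [h, ← sub_mul]
  exact mul_lt_mul_of_pos_right hslope (sub_pos.2 hac)

theorem mul_sub_le_of_radius_le {τ₁ cs ε κ E ϖ a c : ℝ} (hτ : 0 < τ₁) (hcs : 0 < cs) (hκ : 0 < κ)
    (hE : 0 < E) (hε : ε ≤ min (cs / 2) (cs * τ₁ * E / (16 * κ))) (ha : cs - ε ≤ a) (hac : a ≤ c)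
    (hc : c ≤ cs + ε) (hϖ : E ≤ ϖ) : κ * (c - a) ≤ c * τ₁ * ϖ / 4 := by
  have half_le : cs / 2 ≤ c := by linarith [hε.trans (min_le_left _ _)]
  have : 0 < c := (half_pos hcs).trans_le half_le
  have hradius : ε * (16 * κ) ≤ cs * τ₁ * E :=
    (le_div_iff₀ (by positivity)).1 (hε.trans (min_le_right _ _))
  calc κ * (c - a) ≤ κ * (2 * ε) := by gcongr; linarith
    _ ≤ cs / 2 * τ₁ * E / 4 := by linarith
    _ ≤ c * τ₁ * ϖ / 4 := by gcongr

theorem rate_eq_zero_iff {τ₁ θ w : ℝ} {W : ℝ → ℝ → ℝ} {s : ℝ × ℝ} (hτ : 0 < τ₁)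
    (hs : s ∈ stateSpace τ₁) (hw : HasDerivAt (fun c => W c θ) w s.2) :
    rate τ₁ W θ s = 0 ↔ w = affinity τ₁ (pressure τ₁ W θ s) := by
  rw [rate_eq hτ hs hw, sub_eq_zero, eq_comm]

theorem eq_of_pressure_eq {τ₁ θ : ℝ} {W : ℝ → ℝ → ℝ} {s t : ℝ × ℝ} (hτ : 0 < τ₁)
    (hs : s ∈ stateSpace τ₁) (ht : t ∈ stateSpace τ₁)
    (hp : pressure τ₁ W θ s = pressure τ₁ W θ t) (hc : s.2 = t.2) : s = t := by
  rw [← stateOf_pressure hτ hs W θ, ← stateOf_pressure hτ ht W θ, hp, hc]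

/-- The fluid states with mass fraction within `ε` of `cs`: the set `N` of the theorem. -/
def statesNear (τ₁ cs ε : ℝ) : Set (ℝ × ℝ) :=
  stateSpace τ₁ ∩ Prod.snd ⁻¹' Ioo (cs - ε) (cs + ε)

theorem isOpen_statesNear (τ₁ cs ε : ℝ) : IsOpen (statesNear τ₁ cs ε) :=
  (isOpen_stateSpace τ₁).inter (isOpen_Ioo.preimage continuous_snd)

/-- A Maxwell family together with the equilibrium pressure `ϖ` of its phases. The Maxwell states
at temperature `θ` are `stateOf τ₁ (ϖ θ) (a θ)` and `stateOf τ₁ (ϖ θ) (b θ)`. The excess of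
`W(·, θ)` over its common tangent is so small that the level curve through the saddles stays in
the domain of `Γ`. -/
structure IsMaxwellStateFamily (τ₁ : ℝ) (W : ℝ → ℝ → ℝ) (Θ : Set ℝ) (cs θs θt ε : ℝ)
    (a b ϖ : ℝ → ℝ) : Prop extends IsMaxwellFamily W cs θs θt ε a b where
  box_subset : Icc (cs - ε) (cs + ε) ×ˢ Ioc θt θs ⊆ Ioo 0 1 ×ˢ Θ
  continuousOn_pressure : ContinuousOn ϖ (Ioc θt θs)
  pressure_mem : ∀ θ ∈ Ioc θt θs, ϖ θ ∈ Ioo 0 (1 / τ₁)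
  affinity_eq : ∀ θ ∈ Ioc θt θs, affinity τ₁ (ϖ θ) = cDeriv W 1 (a θ, θ)
  excess_lt : ∀ θ ∈ Ioo θt θs, ∀ c ∈ Ioo (a θ) (b θ),
    W c θ - W (a θ) θ - cDeriv W 1 (a θ, θ) * (c - a θ) < c * τ₁ * ϖ θ / 4

namespace GenericTransition

variable {W : ℝ → ℝ → ℝ} {Θ : Set ℝ} {cs θs θ : ℝ}

theorem contDiffOn_potential (h : GenericTransition W Θ cs θs) (hθ : θ ∈ Θ) :
    ContDiffOn ℝ 4 (fun c => W c θ) (Ioo 0 1) :=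
  h.smooth.comp (f := fun c : ℝ => (c, θ)) (by fun_prop) fun _ hc => ⟨hc, hθ⟩

theorem exists_isMaxwellStateFamily (h : GenericTransition W Θ cs θs) {τ₁ : ℝ} (hτ : 0 < τ₁)
    (hslope : cDeriv W 1 (cs, θs) < -Real.log τ₁) :
    ∃ ε θt a b ϖ, IsMaxwellStateFamily τ₁ W Θ cs θs θt ε a b ϖ := by
  obtain ⟨m₁, lt_m₁, hm₁⟩ := exists_between hslope
  obtain ⟨m₀, m₀_lt⟩ := exists_lt (cDeriv W 1 (cs, θs))
  have hm : 0 < m₁ - m₀ := sub_pos.2 (m₀_lt.trans lt_m₁)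
  have : 0 < cs := h.mem_frac.1
  have hz : (cs, θs) ∈ Ioo (0 : ℝ) 1 ×ˢ Θ := ⟨h.mem_frac, h.mem_temp⟩
  have hV : Ioo (0 : ℝ) 1 ×ˢ Θ ∩ cDeriv W 1 ⁻¹' Ioo m₀ m₁ ∈ 𝓝 (cs, θs) :=
    inter_mem (h.isOpen_domain.mem_nhds hz)
      (h.continuousAt_cDeriv (by norm_num) hz (Ioo_mem_nhds m₀_lt lt_m₁))
  obtain ⟨ε, θt, a, b, hε, hsub, hM⟩ := h.exists_isMaxwellFamily hV
    (ε₀ := min (cs / 2) (cs * τ₁ * Real.exp (m₀ - 1) / (16 * (m₁ - m₀)))) (by positivity)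
  obtain ⟨P, hPc, hP⟩ :=
    exists_continuousOn_affinity_inverse hτ (m₀_lt.trans lt_m₁).le hm₁
  have hbox := hsub.trans inter_subset_left
  have mem_slope {θ : ℝ} (hθ : θ ∈ Ioc θt θs) {c : ℝ} (hc : c ∈ Icc (cs - ε) (cs + ε)) :
      cDeriv W 1 (c, θ) ∈ Ioo m₀ m₁ := (hsub (mk_mem_prod hc hθ)).2
  have mem_a {θ : ℝ} (hθ : θ ∈ Ioc θt θs) := Ioo_subset_Icc_self (hM.left_mem hθ)
  have hslope_a : MapsTo (fun θ => cDeriv W 1 (a θ, θ)) (Ioc θt θs) (Icc m₀ m₁) := fun θ hθ =>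
    Ioo_subset_Icc_self (mem_slope hθ (mem_a hθ))
  have hcont : ContinuousOn (fun θ => cDeriv W 1 (a θ, θ)) (Ioc θt θs) := fun θ hθ =>
    (h.continuousAt_cDeriv (by norm_num) (hbox ⟨mem_a hθ, hθ⟩)).comp_continuousWithinAt
      (f := fun θ => (a θ, θ)) ((hM.continuousOn_left θ hθ).prodMk continuousWithinAt_id)
  refine ⟨ε, θt, a, b, fun θ => P (cDeriv W 1 (a θ, θ)), hM, hbox, hPc.comp hcont hslope_a,
    fun θ hθ => (hP _ (hslope_a hθ)).1, fun θ hθ => (hP _ (hslope_a hθ)).2, fun θ hθ c hc => ?_⟩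
  have hθ' := Ioo_subset_Ioc_self hθ
  have hsub_c : Icc (a θ) c ⊆ Icc (cs - ε) (cs + ε) :=
    Icc_subset_Icc (mem_a hθ').1 (hc.2.le.trans (hM.right_mem hθ').2.le)
  have excess_lt : W c θ - W (a θ) θ - cDeriv W 1 (a θ, θ) * (c - a θ)
      < (m₁ - m₀) * (c - a θ) :=
    sub_sub_lt_of_deriv_mem_Ioo (w := (W · θ)) (f := fun c => cDeriv W 1 (c, θ)) hc.1
      (fun t ht => h.hasDerivAt_potential (hbox ⟨hsub_c ht, hθ'⟩))
      fun t ht => mem_slope hθ' (hsub_c ht)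
  have exp_lt : Real.exp (m₀ - 1) < P (cDeriv W 1 (a θ, θ)) := by
    obtain ⟨mem, eq⟩ := hP _ (hslope_a hθ')
    exact exp_sub_one_lt_of_le_affinity hτ mem.1 (eq.symm ▸ (hslope_a hθ').1)
  exact excess_lt.trans_le <| mul_sub_le_of_radius_le hτ h.mem_frac.1 hm (Real.exp_pos _) hε
    (mem_a hθ').1 hc.1.le (hsub_c ⟨hc.1.le, le_rfl⟩).2 exp_lt.le

end GenericTransition

namespace IsMaxwellStateFamily

variable {τ₁ : ℝ} {W : ℝ → ℝ → ℝ} {Θ : Set ℝ} {cs θs θt ε θ : ℝ} {a b ϖ : ℝ → ℝ}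

theorem mem_domain (h : IsMaxwellStateFamily τ₁ W Θ cs θs θt ε a b ϖ) (hθ : θ ∈ Ioc θt θs) {c : ℝ}
    (hc : c ∈ Ioo (cs - ε) (cs + ε)) : (c, θ) ∈ Ioo (0 : ℝ) 1 ×ˢ Θ :=
  h.box_subset ⟨Ioo_subset_Icc_self hc, hθ⟩

theorem temp_subset (h : IsMaxwellStateFamily τ₁ W Θ cs θs θt ε a b ϖ) : Ioc θt θs ⊆ Θ :=
  fun _ hθ => (h.mem_domain hθ (h.left_mem hθ)).2

theorem left_frac_mem (h : IsMaxwellStateFamily τ₁ W Θ cs θs θt ε a b ϖ) (hθ : θ ∈ Ioc θt θs) :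
    a θ ∈ Ioo (0 : ℝ) 1 := (h.mem_domain hθ (h.left_mem hθ)).1

theorem right_frac_mem (h : IsMaxwellStateFamily τ₁ W Θ cs θs θt ε a b ϖ) (hθ : θ ∈ Ioc θt θs) :
    b θ ∈ Ioo (0 : ℝ) 1 := (h.mem_domain hθ (h.right_mem hθ)).1

theorem Icc_subset (h : IsMaxwellStateFamily τ₁ W Θ cs θs θt ε a b ϖ) (hθ : θ ∈ Ioc θt θs) :
    Icc (a θ) (b θ) ⊆ Ioo 0 1 := fun _ hc =>
  ⟨(h.left_frac_mem hθ).1.trans_le hc.1, hc.2.trans_lt (h.right_frac_mem hθ).2⟩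

theorem stateOf_mem_statesNear (h : IsMaxwellStateFamily τ₁ W Θ cs θs θt ε a b ϖ) (hτ : 0 < τ₁)
    (hθ : θ ∈ Ioc θt θs) {c : ℝ} (hc : c ∈ Ioo (cs - ε) (cs + ε)) :
    stateOf τ₁ (ϖ θ) c ∈ statesNear τ₁ cs ε :=
  ⟨stateOf_mem_stateSpace hτ (h.pressure_mem θ hθ) (h.mem_domain hθ hc).1, hc⟩

theorem continuousOn_stateOf (h : IsMaxwellStateFamily τ₁ W Θ cs θs θt ε a b ϖ) (hτ : 0 < τ₁)
    {c : ℝ → ℝ} (hc : ContinuousOn c (Ioc θt θs)) (hmem : MapsTo c (Ioc θt θs) (Ioo 0 1)) :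
    ContinuousOn (fun θ => stateOf τ₁ (ϖ θ) (c θ)) (Ioc θt θs) := fun θ hθ =>
  (continuousAt_stateOf hτ (h.pressure_mem θ hθ).1 (hmem hθ)).comp_continuousWithinAt
    (f := fun θ => (ϖ θ, c θ)) ((h.continuousOn_pressure θ hθ).prodMk (hc θ hθ))

theorem slope_right_eq_affinity (h : IsMaxwellStateFamily τ₁ W Θ cs θs θt ε a b ϖ)
    (hθ : θ ∈ Ioc θt θs) : cDeriv W 1 (b θ, θ) = affinity τ₁ (ϖ θ) :=
  (h.slope_eq hθ).symm.trans (h.affinity_eq θ hθ).symm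

theorem slope_eq_affinity_of_rate_eq_zero (h : IsMaxwellStateFamily τ₁ W Θ cs θs θt ε a b ϖ)
    (hW : GenericTransition W Θ cs θs) (hτ : 0 < τ₁) (hθ : θ ∈ Ioc θt θs) {s : ℝ × ℝ}
    (hs : s ∈ statesNear τ₁ cs ε) (hrate : rate τ₁ W θ s = 0) :
    cDeriv W 1 (s.2, θ) = affinity τ₁ (pressure τ₁ W θ s) :=
  (rate_eq_zero_iff hτ hs.1 (hW.hasDerivAt_potential (h.mem_domain hθ hs.2))).1 hrate

theorem rate_stateOf_eq_zero (h : IsMaxwellStateFamily τ₁ W Θ cs θs θt ε a b ϖ)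
    (hW : GenericTransition W Θ cs θs) (hτ : 0 < τ₁) (hθ : θ ∈ Ioc θt θs) {c : ℝ}
    (hc : c ∈ Ioo (cs - ε) (cs + ε)) (hslope : cDeriv W 1 (c, θ) = affinity τ₁ (ϖ θ)) :
    rate τ₁ W θ (stateOf τ₁ (ϖ θ) c) = 0 := by
  have hdom := h.mem_domain hθ hc
  rw [rate_eq_zero_iff hτ (h.stateOf_mem_statesNear hτ hθ hc).1 (hW.hasDerivAt_potential hdom),
    pressure_stateOf hτ (h.pressure_mem θ hθ) hdom.1]
  exact hslope

theorem isEquilibriumPair (h : IsMaxwellStateFamily τ₁ W Θ cs θs θt ε a b ϖ)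
    (hW : GenericTransition W Θ cs θs) (hτ : 0 < τ₁) (hθ : θ ∈ Ioc θt θs) :
    IsEquilibriumPair τ₁ W θ (stateOf τ₁ (ϖ θ) (a θ)) (stateOf τ₁ (ϖ θ) (b θ)) := by
  refine ⟨h.rate_stateOf_eq_zero hW hτ hθ (h.left_mem hθ) (h.affinity_eq θ hθ).symm,
    h.rate_stateOf_eq_zero hW hτ hθ (h.right_mem hθ) (h.slope_right_eq_affinity hθ), ?_⟩
  rw [pressure_stateOf hτ (h.pressure_mem θ hθ) (h.left_frac_mem hθ),
    pressure_stateOf hτ (h.pressure_mem θ hθ) (h.right_frac_mem hθ)]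

theorem stateOf_crit_eq (h : IsMaxwellStateFamily τ₁ W Θ cs θs θt ε a b ϖ) :
    stateOf τ₁ (ϖ θs) (a θs) = stateOf τ₁ (ϖ θs) (b θs) := by
  rw [h.left_crit, h.right_crit]

theorem eq_of_isEquilibriumPair_crit (h : IsMaxwellStateFamily τ₁ W Θ cs θs θt ε a b ϖ)
    (hW : GenericTransition W Θ cs θs) (hτ : 0 < τ₁) {s t : ℝ × ℝ} (hs : s ∈ statesNear τ₁ cs ε)
    (ht : t ∈ statesNear τ₁ cs ε) (heq : IsEquilibriumPair τ₁ W θs s t) : s = t := by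
  obtain ⟨rate_s, rate_t, hp⟩ := heq
  have hθ := right_mem_Ioc.2 h.lt_crit
  refine eq_of_pressure_eq hτ hs.1 ht.1 hp <|
    h.injOn_crit (Ioo_subset_Icc_self hs.2) (Ioo_subset_Icc_self ht.2) ?_
  simp only [h.slope_eq_affinity_of_rate_eq_zero hW hτ hθ hs rate_s,
    h.slope_eq_affinity_of_rate_eq_zero hW hτ hθ ht rate_t, hp]

theorem stateOf_fst_lt (h : IsMaxwellStateFamily τ₁ W Θ cs θs θt ε a b ϖ) (hτ : 0 < τ₁)
    (hθ : θ ∈ Ioo θt θs) :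
    (stateOf τ₁ (ϖ θ) (a θ)).1 < (stateOf τ₁ (ϖ θ) (b θ)).1 :=
  stateOf_fst_lt_stateOf_fst hτ (h.pressure_mem θ (Ioo_subset_Ioc_self hθ))
    (h.right_frac_mem (Ioo_subset_Ioc_self hθ)) (h.pair θ hθ).lt

theorem level_eq (h : IsMaxwellStateFamily τ₁ W Θ cs θs θt ε a b ϖ) (hθ : θ ∈ Ioo θt θs) :
    Ghat τ₁ (ϖ θ) (a θ) + W (a θ) θ = Ghat τ₁ (ϖ θ) (b θ) + W (b θ) θ := by
  have htan := (h.pair θ hθ).bitangent.sub_eq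
  rw [← h.affinity_eq θ (Ioo_subset_Ioc_self hθ)] at htan
  linarith [Ghat_sub_Ghat τ₁ (ϖ θ) (a θ) (b θ)]

theorem areEqualLevelSaddles (h : IsMaxwellStateFamily τ₁ W Θ cs θs θt ε a b ϖ)
    (hW : GenericTransition W Θ cs θs) (hτ : 0 < τ₁) (hθ : θ ∈ Ioo θt θs) :
    AreEqualLevelSaddles (Gam τ₁ W θ (ϖ θ)) (a θ, 0) (b θ, 0) := by
  have hθ' := Ioo_subset_Ioc_self hθ
  have hϖ := (h.pressure_mem θ hθ').1
  have isSaddle {c : ℝ} (hc : c ∈ Ioo (0 : ℝ) 1)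
      (hslope : cDeriv W 1 (c, θ) = affinity τ₁ (ϖ θ)) (hpos : 0 < cDeriv W 2 (c, θ)) :
      IsSaddle (Gam τ₁ W θ (ϖ θ)) (c, 0) :=
    isSaddle_Gam hτ hϖ hc ((hW.contDiffOn_potential (h.temp_subset hθ')).of_le (by norm_num))
      (fun x hx => hW.hasDerivAt_potential ⟨hx, h.temp_subset hθ'⟩)
      (hW.hasDerivAt_cDeriv (by norm_num) ⟨hc, h.temp_subset hθ'⟩) hslope hpos
  refine ⟨fun hab => (h.pair θ hθ).lt.ne (congrArg Prod.fst hab),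
    isSaddle (h.left_frac_mem hθ') (h.affinity_eq θ hθ').symm (h.pair θ hθ).pos_left,
    isSaddle (h.right_frac_mem hθ') (h.slope_right_eq_affinity hθ') (h.pair θ hθ).pos_right, ?_⟩
  rw [Gam_zero hτ hϖ (h.left_frac_mem hθ'), Gam_zero hτ hϖ (h.right_frac_mem hθ'), h.level_eq hθ]

theorem exists_isProfile (h : IsMaxwellStateFamily τ₁ W Θ cs θs θt ε a b ϖ)
    (hW : GenericTransition W Θ cs θs) (hτ : 0 < τ₁) {δ : ℝ} (hδ : 0 < δ) (hθ : θ ∈ Ioo θt θs) :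
    ∃ p C : ℝ → ℝ, IsProfile τ₁ δ (ϖ θ) (a θ) (b θ) (W · θ) p C := by
  have hθ' := Ioo_subset_Ioc_self hθ
  have hpair := h.pair θ hθ
  have mem_domain : ∀ c ∈ Icc (a θ) (b θ), (c, θ) ∈ Ioo (0 : ℝ) 1 ×ˢ Θ := fun c hc =>
    ⟨h.Icc_subset hθ' hc, h.temp_subset hθ'⟩
  have hcont : ContinuousOn (fun c => cDeriv W 2 (c, θ)) (Icc (a θ) (b θ)) := fun c hc =>
    (hW.hasDerivAt_cDeriv (by norm_num) (mem_domain c hc)).continuousAt.continuousWithinAt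
  obtain ⟨K, hK⟩ := isCompact_Icc.exists_bound_of_continuousOn hcont
  have hlip : LipschitzOnWith K.toNNReal (fun c => cDeriv W 1 (c, θ)) (Icc (a θ) (b θ)) :=
    (convex_Icc _ _).lipschitzOnWith_of_nnnorm_hasDerivWithin_le
      (fun c hc => (hW.hasDerivAt_cDeriv (by norm_num) (mem_domain c hc)).hasDerivWithinAt)
      fun c hc => NNReal.le_toNNReal_of_coe_le (hK c hc)
  exact NSAC.exists_isProfile hτ hδ (h.pressure_mem θ hθ') hpair.lt (h.Icc_subset hθ')
    (fun c hc => hW.hasDerivAt_potential (mem_domain c hc)) hlip (h.affinity_eq θ hθ').symm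
    hpair.bitangent hpair.above (h.excess_lt θ hθ)

theorem exists_isNoFluxPhaseBoundary (h : IsMaxwellStateFamily τ₁ W Θ cs θs θt ε a b ϖ)
    (hW : GenericTransition W Θ cs θs) (hτ : 0 < τ₁) {δ : ℝ} (hδ : 0 < δ) (hθ : θ ∈ Ioo θt θs)
    (d : ℕ) (μ lam : ℝ) :
    ∃ R C : ℝ → ℝ,
      (∀ e : EuclideanSpace ℝ (Fin d), ‖e‖ = 1 →
        IsNoFluxPhaseBoundary τ₁ W θ d δ μ lam e R C
          (stateOf τ₁ (ϖ θ) (a θ)) (stateOf τ₁ (ϖ θ) (b θ)) ∧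
        IsNoFluxPhaseBoundary τ₁ W θ d δ μ lam e (fun x => R (-x)) (fun x => C (-x))
          (stateOf τ₁ (ϖ θ) (b θ)) (stateOf τ₁ (ϖ θ) (a θ))) ∧
      (∀ x, 0 < deriv C x) ∧
      (∀ x, pressure τ₁ W θ (R x, C x) = proot τ₁ (ϖ θ) (C x) (√δ * deriv C x)) ∧
      JoinsInLevelSet (Gam τ₁ W θ (ϖ θ)) (fun x => (C x, √δ * deriv C x)) (a θ, 0) (b θ, 0) ∧
      JoinsInLevelSet (Gam τ₁ W θ (ϖ θ)) (fun x => (C (-x), √δ * deriv (fun s => C (-s)) x))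
        (b θ, 0) (a θ, 0) := by
  obtain ⟨p, C, hC⟩ := h.exists_isProfile hW hτ hδ hθ
  have hθ' := Ioo_subset_Ioc_self hθ
  have hϖ := h.pressure_mem θ hθ'
  have hsub := h.Icc_subset hθ'
  have hpot {c : ℝ} (hc : c ∈ Ioo (0 : ℝ) 1) :=
    hW.hasDerivAt_potential ⟨hc, h.temp_subset hθ'⟩
  refine ⟨fun x => (stateOf τ₁ (p x) (C x)).1, C,
    fun e he => hC.isNoFluxPhaseBoundary hτ hδ hϖ hsub (fun c hc => hpot hc) he μ lam,
    hC.deriv_pos, fun x => ?_, hC.joinsInLevelSet hτ hδ hϖ.1 hsub,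
    hC.joinsInLevelSet_reflected hτ hδ hϖ.1 hsub (hpot (h.right_frac_mem hθ')).continuousAt⟩
  rw [← hC.proot_eq hτ hδ hϖ.1 hsub x]
  exact pressure_stateOf hτ ⟨(hC.mem_p x).1, (hC.mem_p x).2.trans hϖ.2⟩
    (hsub (Ioo_subset_Icc_self (hC.mem_C x))) W θ

theorem eq_of_critical_of_lt (h : IsMaxwellStateFamily τ₁ W Θ cs θs θt ε a b ϖ) (hτ : 0 < τ₁)
    (hθ : θ ∈ Ioo θt θs) {s t : ℝ × ℝ} (hs : s ∈ statesNear τ₁ cs ε) (ht : t ∈ statesNear τ₁ cs ε)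
    (hlt : s.2 < t.2) (hp : pressure τ₁ W θ s = pressure τ₁ W θ t)
    (hslope_s : cDeriv W 1 (s.2, θ) = affinity τ₁ (pressure τ₁ W θ s))
    (hslope_t : cDeriv W 1 (t.2, θ) = affinity τ₁ (pressure τ₁ W θ s))
    (hlevel : Ghat τ₁ (pressure τ₁ W θ s) s.2 + W s.2 θ
      = Ghat τ₁ (pressure τ₁ W θ s) t.2 + W t.2 θ) :
    s = stateOf τ₁ (ϖ θ) (a θ) ∧ t = stateOf τ₁ (ϖ θ) (b θ) := by
  have htan : IsBitangent (W · θ) (fun c => cDeriv W 1 (c, θ)) s.2 t.2 :=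
    ⟨hslope_s.trans hslope_t.symm, by
      simp only [hslope_s]
      linarith [Ghat_sub_Ghat τ₁ (pressure τ₁ W θ s) s.2 t.2]⟩
  obtain ⟨eq_a, eq_b⟩ := (h.pair θ hθ).unique _ _ hs.2.1.le hlt ht.2.2.le htan
  have hθ' := Ioo_subset_Ioc_self hθ
  have eq_ϖ : pressure τ₁ W θ s = ϖ θ :=
    (strictMonoOn_affinity hτ).injOn (Ioo_subset_Ioc_self (pressure_mem_Ioo hτ hs.1 W θ))
      (Ioo_subset_Ioc_self (h.pressure_mem θ hθ'))
      (by rw [← hslope_s, eq_a, h.affinity_eq θ hθ'])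
  rw [← eq_a, ← eq_b, ← eq_ϖ, stateOf_pressure hτ hs.1, hp, stateOf_pressure hτ ht.1]
  exact ⟨rfl, rfl⟩

theorem eq_of_critical (h : IsMaxwellStateFamily τ₁ W Θ cs θs θt ε a b ϖ) (hτ : 0 < τ₁)
    (hθ : θ ∈ Ioo θt θs) {s t : ℝ × ℝ} (hs : s ∈ statesNear τ₁ cs ε) (ht : t ∈ statesNear τ₁ cs ε)
    (hne : s.2 ≠ t.2) (hp : pressure τ₁ W θ s = pressure τ₁ W θ t)
    (hslope_s : cDeriv W 1 (s.2, θ) = affinity τ₁ (pressure τ₁ W θ s))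
    (hslope_t : cDeriv W 1 (t.2, θ) = affinity τ₁ (pressure τ₁ W θ s))
    (hlevel : Ghat τ₁ (pressure τ₁ W θ s) s.2 + W s.2 θ
      = Ghat τ₁ (pressure τ₁ W θ s) t.2 + W t.2 θ) :
    (s = stateOf τ₁ (ϖ θ) (a θ) ∧ t = stateOf τ₁ (ϖ θ) (b θ)) ∨
      (s = stateOf τ₁ (ϖ θ) (b θ) ∧ t = stateOf τ₁ (ϖ θ) (a θ)) := by
  rcases lt_or_gt_of_ne hne with hlt | hlt
  · exact Or.inl (h.eq_of_critical_of_lt hτ hθ hs ht hlt hp hslope_s hslope_t hlevel)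
  · rw [hp] at hslope_s hslope_t hlevel
    exact Or.inr (h.eq_of_critical_of_lt hτ hθ ht hs hlt hp.symm hslope_t hslope_s
      hlevel.symm).symm

theorem eq_of_isNoFluxPhaseBoundary (h : IsMaxwellStateFamily τ₁ W Θ cs θs θt ε a b ϖ)
    (hW : GenericTransition W Θ cs θs) (hτ : 0 < τ₁) (hθ : θ ∈ Ioo θt θs) {s t : ℝ × ℝ}
    (hs : s ∈ statesNear τ₁ cs ε) (ht : t ∈ statesNear τ₁ cs ε) (hne : s ≠ t)
    (heq : IsEquilibriumPair τ₁ W θ s t) {d : ℕ} {e : EuclideanSpace ℝ (Fin d)}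
    {δ μ lam : ℝ} {R C : ℝ → ℝ} (hδ : 0 < δ) (he : ‖e‖ = 1)
    (hb : IsNoFluxPhaseBoundary τ₁ W θ d δ μ lam e R C s t) :
    (s = stateOf τ₁ (ϖ θ) (a θ) ∧ t = stateOf τ₁ (ϖ θ) (b θ)) ∨
      (s = stateOf τ₁ (ϖ θ) (b θ) ∧ t = stateOf τ₁ (ϖ θ) (a θ)) := by
  obtain ⟨rate_s, rate_t, hp⟩ := heq
  have hθ' := Ioo_subset_Ioc_self hθ
  have hslope_t := h.slope_eq_affinity_of_rate_eq_zero hW hτ hθ' ht rate_t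
  have hlevel := hb.level_eq hδ hτ he
    (fun _ hc => hW.hasDerivAt_potential ⟨hc, h.temp_subset hθ'⟩) hs.1 ht.1
  rw [← hp] at hslope_t hlevel
  exact h.eq_of_critical hτ hθ hs ht (fun hc => hne (eq_of_pressure_eq hτ hs.1 ht.1 hp hc)) hp
    (h.slope_eq_affinity_of_rate_eq_zero hW hτ hθ' hs rate_s) hslope_t hlevel

theorem eq_of_areEqualLevelSaddles (h : IsMaxwellStateFamily τ₁ W Θ cs θs θt ε a b ϖ)
    (hW : GenericTransition W Θ cs θs) (hτ : 0 < τ₁) (hθ : θ ∈ Ioo θt θs) {s t : ℝ × ℝ}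
    (hs : s ∈ statesNear τ₁ cs ε) (ht : t ∈ statesNear τ₁ cs ε)
    (hp : pressure τ₁ W θ s = pressure τ₁ W θ t)
    (hsaddle : AreEqualLevelSaddles (Gam τ₁ W θ (pressure τ₁ W θ s)) (s.2, 0) (t.2, 0)) :
    (s = stateOf τ₁ (ϖ θ) (a θ) ∧ t = stateOf τ₁ (ϖ θ) (b θ)) ∨
      (s = stateOf τ₁ (ϖ θ) (b θ) ∧ t = stateOf τ₁ (ϖ θ) (a θ)) := by
  obtain ⟨hne, saddle_s, saddle_t, hlevel⟩ := hsaddle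
  have hθ' := Ioo_subset_Ioc_self hθ
  have hpos := (pressure_mem_Ioo hτ hs.1 W θ).1
  obtain ⟨frac_s, temp⟩ := h.mem_domain hθ' hs.2
  have frac_t := (h.mem_domain hθ' ht.2).1
  rw [Gam_zero hτ hpos frac_s, Gam_zero hτ hpos frac_t] at hlevel
  exact h.eq_of_critical hτ hθ hs ht (fun hc => hne (by rw [hc])) hp
    (slope_eq_affinity_of_isSaddle hτ hpos frac_s (hW.hasDerivAt_potential ⟨frac_s, temp⟩) saddle_s)
    (slope_eq_affinity_of_isSaddle hτ hpos frac_t (hW.hasDerivAt_potential ⟨frac_t, temp⟩) saddle_t)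
    hlevel

end IsMaxwellStateFamily

end NSAC

end

theorem theorem1_general
    (τ₁ : ℝ) (hτ : 0 < τ₁)
    (W : ℝ → ℝ → ℝ) (Θ : Set ℝ) (cs θs : ℝ)
    (hW : NSAC.GenericTransition W Θ cs θs)
    (hslope : deriv (fun c => W c θs) cs < -Real.log τ₁)
    (d : ℕ) (δ : ℝ) (hδ : 0 < δ) (μ lam : ℝ) :
    ∃ θt : ℝ, θt < θs ∧ Ioc θt θs ⊆ Θ ∧
    ∃ N : Set (ℝ × ℝ), IsOpen N ∧ N ⊆ NSAC.stateSpace τ₁ ∧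
    ∃ lo hi : ℝ → ℝ × ℝ,
      ContinuousOn lo (Ioc θt θs) ∧ ContinuousOn hi (Ioc θt θs) ∧
      (∀ θ ∈ Ioc θt θs,
        lo θ ∈ N ∧ hi θ ∈ N ∧ NSAC.IsEquilibriumPair τ₁ W θ (lo θ) (hi θ)) ∧
      lo θs = hi θs ∧ (lo θs).2 = cs ∧
      (∀ a ∈ N, ∀ b ∈ N, NSAC.IsEquilibriumPair τ₁ W θs a b → a = b) ∧
      (∀ θ ∈ Ioo θt θs,
        (lo θ).1 < (hi θ).1 ∧
        NSAC.AreEqualLevelSaddles (NSAC.Gam τ₁ W θ (NSAC.pressure τ₁ W θ (lo θ)))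
          ((lo θ).2, 0) ((hi θ).2, 0) ∧
        (∃ R C : ℝ → ℝ,
          (∀ e : EuclideanSpace ℝ (Fin d), ‖e‖ = 1 →
            NSAC.IsNoFluxPhaseBoundary τ₁ W θ d δ μ lam e R C (lo θ) (hi θ) ∧
            NSAC.IsNoFluxPhaseBoundary τ₁ W θ d δ μ lam e
              (fun x => R (-x)) (fun x => C (-x)) (hi θ) (lo θ)) ∧
          (∀ x, 0 < deriv C x) ∧
          (∀ x, NSAC.pressure τ₁ W θ (R x, C x)
            = NSAC.proot τ₁ (NSAC.pressure τ₁ W θ (lo θ)) (C x) (Real.sqrt δ * deriv C x)) ∧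
          NSAC.JoinsInLevelSet (NSAC.Gam τ₁ W θ (NSAC.pressure τ₁ W θ (lo θ)))
            (fun x => (C x, Real.sqrt δ * deriv C x)) ((lo θ).2, 0) ((hi θ).2, 0) ∧
          NSAC.JoinsInLevelSet (NSAC.Gam τ₁ W θ (NSAC.pressure τ₁ W θ (lo θ)))
            (fun x => (C (-x), Real.sqrt δ * deriv (fun s => C (-s)) x))
            ((hi θ).2, 0) ((lo θ).2, 0)) ∧
        (∀ a ∈ N, ∀ b ∈ N, a ≠ b → NSAC.IsEquilibriumPair τ₁ W θ a b →
          ∀ (e : EuclideanSpace ℝ (Fin d)) (R C : ℝ → ℝ), ‖e‖ = 1 →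
            NSAC.IsNoFluxPhaseBoundary τ₁ W θ d δ μ lam e R C a b →
            (a = lo θ ∧ b = hi θ) ∨ (a = hi θ ∧ b = lo θ)) ∧
        (∀ a ∈ N, ∀ b ∈ N, NSAC.pressure τ₁ W θ a = NSAC.pressure τ₁ W θ b →
          NSAC.AreEqualLevelSaddles (NSAC.Gam τ₁ W θ (NSAC.pressure τ₁ W θ a))
            (a.2, 0) (b.2, 0) →
          (a = lo θ ∧ b = hi θ) ∨ (a = hi θ ∧ b = lo θ))) := by
  have deriv_eq := hW.hasDerivAt_potential ⟨hW.mem_frac, hW.mem_temp⟩ |>.deriv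
  obtain ⟨ε, θt, a, b, ϖ, h⟩ := hW.exists_isMaxwellStateFamily hτ (deriv_eq ▸ hslope)
  refine ⟨θt, h.lt_crit, h.temp_subset, NSAC.statesNear τ₁ cs ε, NSAC.isOpen_statesNear τ₁ cs ε,
    inter_subset_left, fun θ => NSAC.stateOf τ₁ (ϖ θ) (a θ), fun θ => NSAC.stateOf τ₁ (ϖ θ) (b θ),
    h.continuousOn_stateOf hτ h.continuousOn_left fun _ => h.left_frac_mem,
    h.continuousOn_stateOf hτ h.continuousOn_right fun _ => h.right_frac_mem,
    fun θ hθ => ⟨h.stateOf_mem_statesNear hτ hθ (h.left_mem hθ),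
      h.stateOf_mem_statesNear hτ hθ (h.right_mem hθ), h.isEquilibriumPair hW hτ hθ⟩,
    h.stateOf_crit_eq, h.left_crit,
    fun s hs t ht => h.eq_of_isEquilibriumPair_crit hW hτ hs ht, fun θ hθ => ?_⟩
  have hθ' := Ioo_subset_Ioc_self hθ
  have pressure_lo : NSAC.pressure τ₁ W θ (NSAC.stateOf τ₁ (ϖ θ) (a θ)) = ϖ θ :=
    NSAC.pressure_stateOf hτ (h.pressure_mem θ hθ') (h.left_frac_mem hθ') W θ
  rw [pressure_lo]
  exact ⟨h.stateOf_fst_lt hτ hθ, h.areEqualLevelSaddles hW hτ hθ,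
    h.exists_isNoFluxPhaseBoundary hW hτ hδ hθ d μ lam,
    fun s hs t ht hne heq e R C he => h.eq_of_isNoFluxPhaseBoundary hW hτ hθ hs ht hne heq hδ he,
    fun s hs t ht => h.eq_of_areEqualLevelSaddles hW hτ hθ hs ht⟩

theorem theorem1
    (τ₁ : ℝ) (hτ₀ : 0 < τ₁) (hτ₁ : τ₁ < 1)
    (W : ℝ → ℝ → ℝ) (Θ : Set ℝ) (cs θs : ℝ)
    (hW : NSAC.GenericTransition W Θ cs θs)
    (hslope : deriv (fun c => W c θs) cs < -Real.log τ₁)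
    (d : ℕ) (hd : 1 ≤ d) (δ : ℝ) (hδ : 0 < δ) (μ lam : ℝ) :
    ∃ θt : ℝ, θt < θs ∧ Ioc θt θs ⊆ Θ ∧
    ∃ N : Set (ℝ × ℝ), IsOpen N ∧ N ⊆ NSAC.stateSpace τ₁ ∧
    ∃ lo hi : ℝ → ℝ × ℝ,
      ContinuousOn lo (Ioc θt θs) ∧ ContinuousOn hi (Ioc θt θs) ∧
      (∀ θ ∈ Ioc θt θs,
        lo θ ∈ N ∧ hi θ ∈ N ∧ NSAC.IsEquilibriumPair τ₁ W θ (lo θ) (hi θ)) ∧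
      -- the critical temperature
      lo θs = hi θs ∧ (lo θs).2 = cs ∧
      (∀ a ∈ N, ∀ b ∈ N, NSAC.IsEquilibriumPair τ₁ W θs a b → a = b) ∧
      -- temperatures below the critical one
      (∀ θ ∈ Ioo θt θs,
        (lo θ).1 < (hi θ).1 ∧
        -- the two end states, as equal-level saddles
        NSAC.AreEqualLevelSaddles (NSAC.Gam τ₁ W θ (NSAC.pressure τ₁ W θ (lo θ)))
          ((lo θ).2, 0) ((hi θ).2, 0) ∧
        -- the two profiles, as heteroclinic orbits between these saddles
        (∃ R C : ℝ → ℝ,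
          (∀ e : EuclideanSpace ℝ (Fin d), ‖e‖ = 1 →
            NSAC.IsNoFluxPhaseBoundary τ₁ W θ d δ μ lam e R C (lo θ) (hi θ) ∧
            NSAC.IsNoFluxPhaseBoundary τ₁ W θ d δ μ lam e
              (fun x => R (-x)) (fun x => C (-x)) (hi θ) (lo θ)) ∧
          (∀ x, 0 < deriv C x) ∧
          (∀ x, NSAC.pressure τ₁ W θ (R x, C x)
            = NSAC.proot τ₁ (NSAC.pressure τ₁ W θ (lo θ)) (C x) (Real.sqrt δ * deriv C x)) ∧
          NSAC.JoinsInLevelSet (NSAC.Gam τ₁ W θ (NSAC.pressure τ₁ W θ (lo θ)))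
            (fun x => (C x, Real.sqrt δ * deriv C x)) ((lo θ).2, 0) ((hi θ).2, 0) ∧
          NSAC.JoinsInLevelSet (NSAC.Gam τ₁ W θ (NSAC.pressure τ₁ W θ (lo θ)))
            (fun x => (C (-x), Real.sqrt δ * deriv (fun s => C (-s)) x))
            ((hi θ).2, 0) ((lo θ).2, 0)) ∧
        -- local uniqueness of the pair, among the pairs that are joined by a profile
        (∀ a ∈ N, ∀ b ∈ N, a ≠ b → NSAC.IsEquilibriumPair τ₁ W θ a b →
          ∀ (e : EuclideanSpace ℝ (Fin d)) (R C : ℝ → ℝ), ‖e‖ = 1 →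
            NSAC.IsNoFluxPhaseBoundary τ₁ W θ d δ μ lam e R C a b →
            (a = lo θ ∧ b = hi θ) ∨ (a = hi θ ∧ b = lo θ)) ∧
        -- local uniqueness of the pressure and of the pair, among the equal-level saddles
        (∀ a ∈ N, ∀ b ∈ N, NSAC.pressure τ₁ W θ a = NSAC.pressure τ₁ W θ b →
          NSAC.AreEqualLevelSaddles (NSAC.Gam τ₁ W θ (NSAC.pressure τ₁ W θ a))
            (a.2, 0) (b.2, 0) →
          (a = lo θ ∧ b = hi θ) ∨ (a = hi θ ∧ b = lo θ))) :=
  theorem1_general τ₁ hτ₀ W Θ cs θs hW hslope d δ hδ μ lam
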